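/- Fix a context $\langle X,\mathcal V,\mathcal F,\mathcal Q\rangle$: a non-empty set $X$ of constants, an infinite set $\mathcal V$ of variables, and sets $\mathcal F$, $\mathcal Q$ of function and predicate symbols with arities. Terms are constants, variables and expressions $f(t_1,\dots,t_n)$ with $f/n\in\mathcal F$; atoms are expressions $p(t_1,\dots,t_n)$ with $p/n\in\mathcal Q$; a goal is a finite set of atoms. For goals, $G\sqsubseteq G'$ means that there is a substitution $\theta$ with $G\theta\subseteq G'$ and $|G\theta|=|G|$ (distinct atoms of $G$ remain distinct). For an expression $e$ let $\mathrm{ter}(e)$ be the multiset of all atoms and terms occurring in $e$, and $\tau(e)$ the multiset of all atoms and non-variable terms occurring in $e$. A common generalization of $G_1,G_2$ is a goal $G$ with $G\sqsubseteq G_1$ and $G\sqsubseteq G_2$; it is a $\sqsubseteq$-most specific generalization ($\sqsubseteq$-msg) if no common generalization $G'$ has $|\tau(G')|>|\tau(G)|$. **Theorem.** Let $G_1,G_2$ be goals and $N=\max_{A\in G_1}|\mathrm{ter}(A)|$ (with $N=0$ if $G_1=\emptyset$). (1) A $\sqsubseteq$-msg of $G_1$ and $G_2$ can be computed in time $$\mathcal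 O\big(|G_1|\cdot|G_2|\cdot N+\max(|G_1|,|G_2|)^3\big).$$ Precisely: there are one program $P$ of a random access machine and one constant $C$ such that, for every context and all goals $G_1,G_2$, $P$ halts on every input that represents $(G_1,G_2)$, after at most $C\,(|G_1|\,|G_2|\,N+\max(|G_1|,|G_2|)^3+1)$ steps, and its output represents a $\sqsubseteq$-msg of $G_1$ and $G_2$. The machine has integer registers and integer arrays; assignment, addition, subtraction, comparison, and reading or writing an array entry at a computed index take one step each. Symbols are given by numbers, a term or atom by a record holding its kind, its symbol, its arity and the addresses of its arguments, and a goal by the number of its atoms and the list of their addresses. (2) Let $\Phi:\mathcal T^2\to\mathcal V\cup X$ (with $\mathcal T$ the set of terms) be a variabilization function for $G_1,G_2$: it is injective, its values are not variables of $G_1$ or $G_2$, and $\Phi(t,u)\in X$ if and only if $t=u\in X$, in which case $\Phi(t,u)=t$. Define deep anti-unification on terms by $\mathrm{dau}(t(t_1,\dots,t_n),t(u_1,\dots,u_n))=t(\mathrm{dau}(t_1,u_1),\dots,\mathrm{dau}(t_n,u_n))$ for terms that start with the same function symbol $t$ or are the same constant ($n=0$), and $\mathrm{dau}(T,U)=\Phi(T,U)$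 for all other pairs, in particular if $T$ or $U$ is a variable. On atoms, $\mathrm{dau}(a(t_1,\dots,t_n),a(u_1,\dots,u_n))=a(\mathrm{dau}(t_1,u_1),\dots,\mathrm{dau}(t_n,u_n))$, and $\mathrm{dau}(A,B)=\bot$ if $A$ and $B$ have different predicate symbols. Give the edge between $A_1\in G_1$ and $A_2\in G_2$ of the complete bipartite graph the weight $-1$ if $\mathrm{dau}(A_1,A_2)=\bot$ and $|\tau(\mathrm{dau}(A_1,A_2))|$ otherwise. Then for every matching $M$ of maximum total weight, the goal $\{\mathrm{dau}(A_1,A_2) : (A_1,A_2)\in M,\ \mathrm{dau}(A_1,A_2)\neq\bot\}$ is a $\sqsubseteq$-msg of $G_1$ and $G_2$. -/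

import Mathlib

namespace AntiUnif

/-! ### Terms, atoms, goals -/

/-- A context: constants, variables, function symbols and predicate symbols, the latter two with
their arities. There are infinitely many variables, so that new ones are always available. -/
structure Context where
  X : Type*
  V : Type*
  F : Type*
  Q : Type*
  arityF : F → ℕ
  arityQ : Q → ℕ
  nonempty_X : Nonempty X
  infinite_V : Infinite V

/-- Terms over a context. -/
inductive Term (L : Context)
  | const (x : L.X) : Term L
  | var (v : L.V) : Term L
  | app (f : L.F) (ts : Fin (L.arityF f) → Term L) : Term L

/-- Atoms `p(t₁, …, tₙ)` over a context. -/
structure Atom (L : Context) where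
  pred : L.Q
  args : Fin (L.arityQ pred) → Term L

/-- A goal is a finite set of atoms. -/
abbrev Goal (L : Context) := Finset (Atom L)

variable {L : Context}

/-- Application of a substitution to a term. A substitution is a total map from variables to
terms, equal to `Term.var` outside its domain. -/
def Term.subst (θ : L.V → Term L) : Term L → Term L
  | .const x => .const x
  | .var v => θ v
  | .app f ts => .app f (fun i => (ts i).subst θ)

/-- Application of a substitution to an atom. -/
def Atom.subst (θ : L.V → Term L) (A : Atom L) : Atom L :=
  ⟨A.pred, fun i => (A.args i).subst θ⟩

/-- `G` is a generalization of `G'`: some substitution `θ` turns the atoms of `G` into pairwise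
distinct atoms of `G'`, that is, `Gθ ⊆ G'` and `|Gθ| = |G|`. -/
def Generalizes (G G' : Goal L) : Prop :=
  ∃ θ : L.V → Term L, (∀ A ∈ G, A.subst θ ∈ G') ∧ Set.InjOn (Atom.subst θ) (G : Set (Atom L))

/-- `G` is a common generalization of the goals in `S`. -/
def IsCommonGeneralization (S : Set (Goal L)) (G : Goal L) : Prop :=
  ∀ G' ∈ S, Generalizes G G'

/-- The multiset of all terms occurring in a term, variables included. -/
def Term.ter : Term L → Multiset (Term L ⊕ Atom L)
  | .const x => {Sum.inl (.const x)}
  | .var v => {Sum.inl (.var v)}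
  | .app f ts => Sum.inl (.app f ts) ::ₘ ∑ i, (ts i).ter

/-- The multiset of all non-variable terms occurring in a term. -/
def Term.tau : Term L → Multiset (Term L ⊕ Atom L)
  | .const x => {Sum.inl (.const x)}
  | .var _ => 0
  | .app f ts => Sum.inl (.app f ts) ::ₘ ∑ i, (ts i).tau

/-- The multiset of the atom itself and all terms occurring in it. -/
def Atom.ter (A : Atom L) : Multiset (Term L ⊕ Atom L) :=
  Sum.inr A ::ₘ ∑ i, (A.args i).ter

/-- The multiset of the atom itself and all non-variable terms occurring in it. -/
def Atom.tau (A : Atom L) : Multiset (Term L ⊕ Atom L) :=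
  Sum.inr A ::ₘ ∑ i, (A.args i).tau

/-- The multiset of all atoms and non-variable terms occurring in a goal. -/
def Goal.tau (G : Goal L) : Multiset (Term L ⊕ Atom L) :=
  ∑ A ∈ G, A.tau

/-- `G` is a most specific generalization of the goals in `S`: a common generalization of
largest `τ`-value. -/
def IsMsg (S : Set (Goal L)) (G : Goal L) : Prop :=
  IsCommonGeneralization S G ∧
    ∀ G' : Goal L, IsCommonGeneralization S G' → (Goal.tau G').card ≤ (Goal.tau G).card

/-! ### Deep anti-unification and maximum weight matchings -/

/-- The variables occurring in a term. -/
def Term.vars : Term L → Set L.V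
  | .const _ => ∅
  | .var v => {v}
  | .app _ ts => ⋃ i, (ts i).vars

/-- The variables occurring in a goal. -/
def Goal.vars (G : Goal L) : Set L.V :=
  ⋃ A ∈ G, ⋃ i, (A.args i).vars

/-- `Φ` is a variabilization function avoiding the set `W` of variables: it maps pairs of terms
to variables or constants; the variables it produces are not in `W`, it is injective, and it
yields a constant exactly on pairs of equal constants, namely that constant. -/
def IsVariabilization (W : Set L.V) (Φ : Term L × Term L → L.V ⊕ L.X) : Prop :=
  (∀ p v, Φ p = Sum.inl v → v ∉ W) ∧
  Function.Injective Φ ∧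
  ∀ t u x, Φ (t, u) = Sum.inr x ↔ t = Term.const x ∧ u = Term.const x

/-- The value of a variabilization function, as a term. -/
def generalizer (Φ : Term L × Term L → L.V ⊕ L.X) (t u : Term L) : Term L :=
  Sum.elim Term.var Term.const (Φ (t, u))

open Classical in
/-- Deep anti-unification of terms. -/
noncomputable def Term.dau (Φ : Term L × Term L → L.V ⊕ L.X) : Term L → Term L → Term L
  | .app f ts, .app g us =>
      if h : f = g then
        .app f (fun i => (ts i).dau Φ (us (Fin.cast (congrArg L.arityF h) i)))
      else generalizer Φ (.app f ts) (.app g us)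
  | .const x, .const y => if x = y then .const x else generalizer Φ (.const x) (.const y)
  | t, u => generalizer Φ t u

open Classical in
/-- Deep anti-unification of atoms; `none` plays the part of `⊥`. -/
noncomputable def Atom.dau (Φ : Term L × Term L → L.V ⊕ L.X) (A B : Atom L) : Option (Atom L) :=
  if h : A.pred = B.pred then
    some ⟨A.pred, fun i => (A.args i).dau Φ (B.args (Fin.cast (congrArg L.arityQ h) i))⟩
  else none

/-- The weight of the pair `(A, B)`: the `τ`-value of the deep anti-unification of `A` and `B`,
and `-1` if they do not anti-unify. -/
noncomputable def weight (Φ : Term L × Term L → L.V ⊕ L.X) (A B : Atom L) : ℤ :=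
  (A.dau Φ B).elim (-1) (fun C => (C.tau.card : ℤ))

/-- `M` is a matching of the complete bipartite graph with sides `G₁` and `G₂`. -/
def IsMatching (G₁ G₂ : Goal L) (M : Finset (Atom L × Atom L)) : Prop :=
  (∀ e ∈ M, e.1 ∈ G₁ ∧ e.2 ∈ G₂) ∧
  Set.InjOn Prod.fst (M : Set (Atom L × Atom L)) ∧
  Set.InjOn Prod.snd (M : Set (Atom L × Atom L))

/-- `M` is a matching of largest total weight. -/
def IsMaxWeightMatching (w : Atom L → Atom L → ℤ) (G₁ G₂ : Goal L)
    (M : Finset (Atom L × Atom L)) : Prop :=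
  IsMatching G₁ G₂ M ∧
    ∀ M' : Finset (Atom L × Atom L), IsMatching G₁ G₂ M' →
      ∑ e ∈ M', w e.1 e.2 ≤ ∑ e ∈ M, w e.1 e.2

open Classical in
/-- The goal formed by the deep anti-unifications of the pairs in `M`. -/
noncomputable def goalOfMatching (Φ : Term L × Term L → L.V ⊕ L.X)
    (M : Finset (Atom L × Atom L)) : Goal L :=
  M.biUnion (fun e => (e.1.dau Φ e.2).toFinset)

/-! ### Unit-cost random access machine -/

/-- A machine state: integer registers and integer arrays. A program mentions only finitely many
of them. -/
structure State where
  reg : ℕ → ℤ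
  mem : ℕ → ℤ → ℤ

/-- Elementary instructions. -/
inductive Instr
  /-- `reg d := k` -/
  | set (d : ℕ) (k : ℤ) : Instr
  /-- `reg d := reg a` -/
  | copy (d a : ℕ) : Instr
  /-- `reg d := reg a + reg b` -/
  | add (d a b : ℕ) : Instr
  /-- `reg d := reg a - reg b` -/
  | sub (d a b : ℕ) : Instr
  /-- `reg d := mem m [reg a]` -/
  | load (d m a : ℕ) : Instr
  /-- `mem m [reg a] := reg b` -/
  | store (m a b : ℕ) : Instr

/-- Assign a value to a register. -/
def State.setReg (s : State) (d : ℕ) (z : ℤ) : State :=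
  { s with reg := Function.update s.reg d z }

/-- Effect of an elementary instruction. -/
def Instr.exec : Instr → State → State
  | .set d k, s => s.setReg d k
  | .copy d a, s => s.setReg d (s.reg a)
  | .add d a b, s => s.setReg d (s.reg a + s.reg b)
  | .sub d a b, s => s.setReg d (s.reg a - s.reg b)
  | .load d m a, s => s.setReg d (s.mem m (s.reg a))
  | .store m a b, s =>
      { s with mem := Function.update s.mem m (Function.update (s.mem m) (s.reg a) (s.reg b)) }

/-- Tests: comparison of two registers. -/
inductive Test
  | lt (a b : ℕ) : Test
  | eq (a b : ℕ) : Test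

/-- The test succeeds in the given state. -/
def Test.Holds : Test → State → Prop
  | .lt a b, s => s.reg a < s.reg b
  | .eq a b, s => s.reg a = s.reg b

/-- Programs. -/
inductive Prog
  | skip : Prog
  | instr (i : Instr) : Prog
  | seq (p q : Prog) : Prog
  | ite (c : Test) (p q : Prog) : Prog
  | loop (c : Test) (p : Prog) : Prog

/-- `Exec p s s' t`: program `p`, started in state `s`, halts in state `s'` after `t` steps. Every
elementary instruction and every evaluation of a test takes one step. -/
inductive Exec : Prog → State → State → ℕ → Prop
  | skip (s : State) : Exec .skip s s 1
  | instr (i : Instr) (s : State) : Exec (.instr i) s (i.exec s) 1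
  | seq {p q : Prog} {s s' s'' : State} {t t' : ℕ} :
      Exec p s s' t → Exec q s' s'' t' → Exec (.seq p q) s s'' (t + t')
  | iteTrue {c : Test} {p q : Prog} {s s' : State} {t : ℕ} :
      c.Holds s → Exec p s s' t → Exec (.ite c p q) s s' (t + 1)
  | iteFalse {c : Test} {p q : Prog} {s s' : State} {t : ℕ} :
      ¬ c.Holds s → Exec q s s' t → Exec (.ite c p q) s s' (t + 1)
  | loopTrue {c : Test} {p : Prog} {s s' s'' : State} {t t' : ℕ} :
      c.Holds s → Exec p s s' t → Exec (.loop c p) s' s'' t' →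
        Exec (.loop c p) s s'' (t + t' + 1)
  | loopFalse {c : Test} {p : Prog} {s : State} :
      ¬ c.Holds s → Exec (.loop c p) s s 1

/-! ### Goals in memory -/

/-- A numbering of the symbols of a context. A number denotes at most one constant, and a constant
has at most one number; likewise for function and predicate symbols. Every natural number denotes
a variable, distinct numbers denoting distinct variables. -/
structure Numbering (L : Context) where
  const : ℕ ≃. L.X
  func : ℕ ≃. L.F
  pred : ℕ ≃. L.Q
  var : ℕ ↪ L.V

/-- The term is stored in the array `h` as a record at address `a`: a tag (`0` for a variable,
`1` for a constant, `2` for a function symbol), the number of the symbol, and for a function symbol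
its arity followed by the addresses of the arguments. -/
def Term.StoredAt (ν : Numbering L) (h : ℤ → ℤ) : Term L → ℤ → Prop
  | .var v, a => h a = 0 ∧ ∃ k : ℕ, ν.var k = v ∧ h (a + 1) = k
  | .const x, a => h a = 1 ∧ ∃ k : ℕ, ν.const k = some x ∧ h (a + 1) = k
  | .app f ts, a => h a = 2 ∧ (∃ k : ℕ, ν.func k = some f ∧ h (a + 1) = k) ∧
      h (a + 2) = L.arityF f ∧ ∀ i, (ts i).StoredAt ν h (h (a + 3 + (i : ℕ)))

/-- The atom is stored in the array `h` as a record at address `a`: the tag `3`, the number of the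
predicate symbol, its arity, and the addresses of the arguments. -/
def Atom.StoredAt (ν : Numbering L) (h : ℤ → ℤ) (A : Atom L) (a : ℤ) : Prop :=
  h a = 3 ∧ (∃ k : ℕ, ν.pred k = some A.pred ∧ h (a + 1) = k) ∧
    h (a + 2) = L.arityQ A.pred ∧ ∀ i, (A.args i).StoredAt ν h (h (a + 3 + (i : ℕ)))

/-- The goal is stored in the arrays `h`, `l`: `n` is its number of atoms, and
`l 0, …, l (n - 1)` are the addresses in `h` of its atoms, each listed once, in any order. -/
def Goal.StoredIn (ν : Numbering L) (h l : ℤ → ℤ) (n : ℤ) (G : Goal L) : Prop :=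
  n = G.card ∧ ∃ e : Fin G.card ≃ G, ∀ i, (e i).1.StoredAt ν h (l (i : ℕ))

/-- Input convention: `G₁` and `G₂` are stored with records in array `0`, address lists in arrays
`1` and `2`, and numbers of atoms in registers `0` and `1`. Everything else is arbitrary. -/
def IsInput (ν : Numbering L) (s : State) (G₁ G₂ : Goal L) : Prop :=
  Goal.StoredIn ν (s.mem 0) (s.mem 1) (s.reg 0) G₁ ∧
  Goal.StoredIn ν (s.mem 0) (s.mem 2) (s.reg 1) G₂

/-- Output convention: `G` is stored with records in array `3`, address list in array `4`, and
number of atoms in register `2`. -/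
def IsOutput (ν : Numbering L) (s : State) (G : Goal L) : Prop :=
  Goal.StoredIn ν (s.mem 3) (s.mem 4) (s.reg 2) G

end AntiUnif

open AntiUnif

set_option linter.unusedSimpArgs false

namespace AntiUnif

section

variable {L : Context}

/-! ### Common positions -/

/-! Let `common` count the positions, from the root down, at which two expressions carry the same
symbol. The non-variable positions of an atom A survive in all its instances, so |τ(A)| ≤
common(Aθ₁, Aθ₂) (`Atom.card_tau_le_common`). Deep anti-unification attains this bound
(`Atom.card_tau_dau`), and as Φ is injective, sending the variable of a pair to its first or second
component recovers the two atoms. A common generalization G with substitutions θ₁, θ₂ therefore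
yields a matching, the pairs (Aθ₁, Aθ₂) for A ∈ G, of weight at least |τ(G)|. Conversely a matching
yields a common generalization whose τ-value is at least its weight. Comparing the two gives part
(2), `isMsg_goalOfMatching`.

For part (1) a program is written down and verified. For each pair of atoms, `build` descends into
both records with an explicit stack, copies common symbols and writes a fresh variable at every
disagreement. Since τ ignores variables, equal disagreement pairs need not share a variable, and no
lookup table for Φ is required. Each stack item belongs to a node of the first atom, so a pair costs
O(N) (`builds`, `Runs.buildPair`) and the whole table O(|G₁|·|G₂|·N) plus lower-order terms
(`Runs.fill`). One pair of substitutions, extended at each fresh variable, instantiates all atoms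
built.

The matching is found by the Hungarian method: dual variables with W ≤ u + v, matched edges tight,
rows added one by one along augmenting paths. The slacks of unreached columns are maintained, so a
row costs O(m²) (`Runs.search`). The matrix is padded to m = |G₁| + |G₂| + 1 columns by zeros. Thus
every row can be matched, and some zero column stays free, which forces u ≥ 0. With v ≥ 0, weak
duality then bounds all matchings and not only those covering every row (`Stage.optimal`). The
matched pairs of positive weight form the output goal (`exists_isMsg`), and |G₁|·m² is O(max(|G₁|,
|G₂|)³) up to lower-order terms (`time_bound`). -/

open Classical in
/-- The number of positions at which two terms carry the same function symbol or constant, all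
positions above carrying the same symbols as well. -/
noncomputable def Term.common : Term L → Term L → ℕ
  | .app f ts, .app g us =>
      if h : f = g then
        1 + ∑ i, (ts i).common (us (Fin.cast (congrArg L.arityF h) i))
      else 0
  | .const x, .const y => if x = y then 1 else 0
  | _, _ => 0

open Classical in
/-- The number of common positions of two atoms, the predicate symbol included. -/
noncomputable def Atom.common (A B : Atom L) : ℕ :=
  if h : A.pred = B.pred then
    1 + ∑ i, (A.args i).common (B.args (Fin.cast (congrArg L.arityQ h) i))
  else 0

theorem Term.common_app (f : L.F) (ts us : Fin (L.arityF f) → Term L) :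
    (Term.app f ts).common (.app f us) = 1 + ∑ i, (ts i).common (us i) := by
  simp [Term.common]

theorem Atom.common_mk (q : L.Q) (ts us : Fin (L.arityQ q) → Term L) :
    Atom.common ⟨q, ts⟩ ⟨q, us⟩ = 1 + ∑ i, (ts i).common (us i) := by
  simp [Atom.common]

theorem Atom.common_of_ne {A B : Atom L} (h : A.pred ≠ B.pred) : A.common B = 0 := by
  simp [Atom.common, h]

theorem Term.card_tau_app (f : L.F) (ts : Fin (L.arityF f) → Term L) :
    (Term.app f ts).tau.card = 1 + ∑ i, (ts i).tau.card := by
  simp [Term.tau, add_comm]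

theorem Atom.card_tau (A : Atom L) : A.tau.card = 1 + ∑ i, (A.args i).tau.card := by
  simp [Atom.tau, add_comm]

theorem Term.card_ter_app (f : L.F) (ts : Fin (L.arityF f) → Term L) :
    (Term.app f ts).ter.card = 1 + ∑ i, (ts i).ter.card := by
  simp [Term.ter, add_comm]

theorem Atom.card_ter (A : Atom L) : A.ter.card = 1 + ∑ i, (A.args i).ter.card := by
  simp [Atom.ter, add_comm]

/-- A substitution changes a term only at its variables, so every other position keeps its symbol in
both instances. Below the variables the instances may agree further, hence only an inequality. -/
theorem Term.card_tau_le_common (θ₁ θ₂ : L.V → Term L) (t : Term L) :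
    t.tau.card ≤ (t.subst θ₁).common (t.subst θ₂) := by
  induction t with
  | const x => simp [Term.tau, Term.subst, Term.common]
  | var v => simp [Term.tau]
  | app f ts ih =>
    rw [Term.card_tau_app, Term.subst, Term.subst, Term.common_app]
    exact Nat.add_le_add_left (Finset.sum_le_sum fun i _ => ih i) 1

theorem Atom.card_tau_le_common (θ₁ θ₂ : L.V → Term L) (A : Atom L) :
    A.tau.card ≤ (A.subst θ₁).common (A.subst θ₂) := by
  rw [Atom.card_tau, Atom.subst, Atom.subst, Atom.common_mk]
  exact Nat.add_le_add_left (Finset.sum_le_sum fun i _ => Term.card_tau_le_common θ₁ θ₂ _) 1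

theorem Goal.card_tau (G : Goal L) : (Goal.tau G).card = ∑ A ∈ G, A.tau.card := by
  simp [Goal.tau]

theorem isCommonGeneralization_pair {G₁ G₂ G : Goal L} :
    IsCommonGeneralization {G₁, G₂} G ↔ Generalizes G G₁ ∧ Generalizes G G₂ := by
  simp [IsCommonGeneralization]

/-! ### Deep anti-unification -/

section Dau

variable {W : Set L.V} {Φ : Term L × Term L → L.V ⊕ L.X}

theorem card_tau_generalizer (hΦ : IsVariabilization W Φ) {t u : Term L}
    (h : ∀ x, ¬ (t = .const x ∧ u = .const x)) : (generalizer Φ t u).tau.card = 0 := by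
  unfold generalizer
  rcases hp : Φ (t, u) with v | x
  · simp [Term.tau]
  · exact absurd ((hΦ.2.2 t u x).1 hp) (h x)

/-- Symbols are copied exactly at the common positions, and the recursion stops with an uncounted
variable elsewhere. In particular the count does not depend on the choice of Φ. -/
theorem Term.card_tau_dau (hΦ : IsVariabilization W Φ) (t u : Term L) :
    (t.dau Φ u).tau.card = t.common u := by
  induction t generalizing u with
  | const x =>
    cases u with
    | const y =>
      by_cases h : x = y
      · simp [Term.dau, Term.common, h, Term.tau]
      · simp only [Term.dau, Term.common, h, if_false]
        exact card_tau_generalizer hΦ fun z hz => h (by simp_all)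
    | var v => exact card_tau_generalizer hΦ (by simp)
    | app g us => exact card_tau_generalizer hΦ (by simp)
  | var v =>
    cases u <;> exact card_tau_generalizer hΦ (by simp)
  | app f ts ih =>
    cases u with
    | const y => exact card_tau_generalizer hΦ (by simp)
    | var v => exact card_tau_generalizer hΦ (by simp)
    | app g us =>
      by_cases h : f = g
      · subst h
        simp only [Term.dau, dite_true, Term.card_tau_app, Term.common, ih]
      · simp only [Term.dau, Term.common, h, dite_false]
        exact card_tau_generalizer hΦ (by simp)

theorem Atom.card_tau_dau (hΦ : IsVariabilization W Φ) {A B C : Atom L}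
    (h : A.dau Φ B = some C) : C.tau.card = A.common B := by
  unfold Atom.dau at h
  split_ifs at h with hp
  cases h
  simp [Atom.card_tau, Atom.common, hp, Term.card_tau_dau hΦ]

theorem Atom.dau_isSome {A B : Atom L} : (A.dau Φ B).isSome ↔ A.pred = B.pred := by
  unfold Atom.dau; split_ifs with h <;> simp [h]

open Classical in
/-- The substitution that sends the variable of a pair of terms to the component of the pair
selected by `π`. -/
noncomputable def component (Φ : Term L × Term L → L.V ⊕ L.X)
    (π : Term L × Term L → Term L) (v : L.V) : Term L :=
  if h : ∃ p, Φ p = Sum.inl v then π h.choose else .var v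

/-- By injectivity of Φ the pair picked by choice is the only one with this variable. -/
theorem component_eq (hΦ : IsVariabilization W Φ) {π : Term L × Term L → Term L}
    {p : Term L × Term L} {v : L.V} (h : Φ p = Sum.inl v) : component Φ π v = π p := by
  have he : ∃ p, Φ p = Sum.inl v := ⟨p, h⟩
  rw [component, dif_pos he, hΦ.2.1 (he.choose_spec.trans h.symm)]

/-- The condition on π serves the pairs of equal constants: there Φ yields a constant, which no
substitution moves. -/
theorem subst_generalizer (hΦ : IsVariabilization W Φ) {π : Term L × Term L → Term L}
    (hπ : ∀ t, π (t, t) = t) (t u : Term L) :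
    (generalizer Φ t u).subst (component Φ π) = π (t, u) := by
  unfold generalizer
  rcases hp : Φ (t, u) with v | x
  · exact component_eq hΦ hp
  · obtain ⟨rfl, rfl⟩ := (hΦ.2.2 t u x).1 hp
    simp [Term.subst, hπ]

theorem Term.subst_dau_fst (hΦ : IsVariabilization W Φ) (t u : Term L) :
    (t.dau Φ u).subst (component Φ Prod.fst) = t := by
  have key := subst_generalizer hΦ (π := Prod.fst) (fun _ => rfl)
  induction t generalizing u with
  | const x =>
    cases u with
    | const y => by_cases h : x = y <;> simp [Term.dau, h, key, Term.subst]
    | var v => exact key _ _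
    | app g us => exact key _ _
  | var v => cases u <;> exact key _ _
  | app f ts ih =>
    cases u with
    | const y => exact key _ _
    | var v => exact key _ _
    | app g us =>
      by_cases h : f = g
      · subst h; simp [Term.dau, Term.subst, ih]
      · simp [Term.dau, h, key]

theorem Term.subst_dau_snd (hΦ : IsVariabilization W Φ) (t u : Term L) :
    (t.dau Φ u).subst (component Φ Prod.snd) = u := by
  have key := subst_generalizer hΦ (π := Prod.snd) (fun _ => rfl)
  induction t generalizing u with
  | const x =>
    cases u with
    | const y => by_cases h : x = y <;> simp [Term.dau, h, key, Term.subst]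
    | var v => exact key _ _
    | app g us => exact key _ _
  | var v => cases u <;> exact key _ _
  | app f ts ih =>
    cases u with
    | const y => exact key _ _
    | var v => exact key _ _
    | app g us =>
      by_cases h : f = g
      · subst h; simp [Term.dau, Term.subst, ih]
      · simp [Term.dau, h, key]

theorem Atom.subst_dau_fst (hΦ : IsVariabilization W Φ) {A B C : Atom L}
    (h : A.dau Φ B = some C) : C.subst (component Φ Prod.fst) = A := by
  obtain ⟨q, us⟩ := A
  unfold Atom.dau at h
  split_ifs at h with hp
  cases h
  simp [Atom.subst, Term.subst_dau_fst hΦ]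

theorem Atom.subst_dau_snd (hΦ : IsVariabilization W Φ) {A B C : Atom L}
    (h : A.dau Φ B = some C) : C.subst (component Φ Prod.snd) = B := by
  obtain ⟨q, us⟩ := A
  obtain ⟨q', us'⟩ := B
  unfold Atom.dau at h
  split_ifs at h with hp
  cases hp
  cases h
  simp [Atom.subst, Term.subst_dau_snd hΦ]

theorem mem_goalOfMatching {M : Finset (Atom L × Atom L)} {C : Atom L} :
    C ∈ goalOfMatching Φ M ↔ ∃ e ∈ M, e.1.dau Φ e.2 = some C := by
  simp [goalOfMatching]

theorem weight_eq_of_pred_eq (hΦ : IsVariabilization W Φ) {A B : Atom L} (h : A.pred = B.pred) :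
    weight Φ A B = A.common B := by
  obtain ⟨C, hC⟩ := Option.isSome_iff_exists.1 (Atom.dau_isSome (Φ := Φ).2 h)
  simp [weight, hC, Atom.card_tau_dau hΦ hC]

/-- The goal of a matching is a common generalization. -/
theorem isCommonGeneralization_goalOfMatching (hΦ : IsVariabilization W Φ) {G₁ G₂ : Goal L}
    {M : Finset (Atom L × Atom L)} (hM : IsMatching G₁ G₂ M) :
    IsCommonGeneralization {G₁, G₂} (goalOfMatching Φ M) := by
  obtain ⟨hmem, hfst, hsnd⟩ := hM
  refine isCommonGeneralization_pair.2 ⟨⟨component Φ Prod.fst, ?_, ?_⟩,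
    ⟨component Φ Prod.snd, ?_, ?_⟩⟩
  · intro C hC
    obtain ⟨e, he, h⟩ := mem_goalOfMatching.1 hC
    rw [Atom.subst_dau_fst hΦ h]; exact (hmem e he).1
  · intro C hC D hD h
    obtain ⟨e, he, h1⟩ := mem_goalOfMatching.1 hC
    obtain ⟨e', he', h2⟩ := mem_goalOfMatching.1 hD
    rw [Atom.subst_dau_fst hΦ h1, Atom.subst_dau_fst hΦ h2] at h
    obtain rfl := hfst he he' h
    exact Option.some.inj (h1.symm.trans h2)
  · intro C hC
    obtain ⟨e, he, h⟩ := mem_goalOfMatching.1 hC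
    rw [Atom.subst_dau_snd hΦ h]; exact (hmem e he).2
  · intro C hC D hD h
    obtain ⟨e, he, h1⟩ := mem_goalOfMatching.1 hC
    obtain ⟨e', he', h2⟩ := mem_goalOfMatching.1 hD
    rw [Atom.subst_dau_snd hΦ h1, Atom.subst_dau_snd hΦ h2] at h
    obtain rfl := hsnd he he' h
    exact Option.some.inj (h1.symm.trans h2)

/-- Equality may fail because an edge of weight -1 contributes no atom. Distinct edges contribute
distinct atoms, since the first instance of the atom recovers the first end of its edge. -/
theorem sum_weight_le_card_tau (hΦ : IsVariabilization W Φ) {G₁ G₂ : Goal L}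
    {M : Finset (Atom L × Atom L)} (hM : IsMatching G₁ G₂ M) :
    ∑ e ∈ M, weight Φ e.1 e.2 ≤ (Goal.tau (goalOfMatching Φ M)).card := by
  classical
  have hdisj : (M : Set (Atom L × Atom L)).PairwiseDisjoint
      (fun e => (e.1.dau Φ e.2).toFinset) := by
    intro e he e' he' hne
    refine Finset.disjoint_left.2 fun C h1 h2 => hne (hM.2.1 he he' ?_)
    simp only [Option.mem_toFinset, Option.mem_def] at h1 h2
    rw [← Atom.subst_dau_fst hΦ h1, Atom.subst_dau_fst hΦ h2]
  have hbi : goalOfMatching Φ M = M.biUnion fun e => (e.1.dau Φ e.2).toFinset := by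
    ext C; simp [mem_goalOfMatching]
  rw [Goal.card_tau, hbi, Finset.sum_biUnion hdisj]
  push_cast
  refine Finset.sum_le_sum fun e _ => ?_
  rcases h : e.1.dau Φ e.2 with _ | C <;> simp [weight, h]

open Classical in
/-- The pairs of instances of the atoms of a common generalization. -/
noncomputable def instancePairs (θ₁ θ₂ : L.V → Term L) (G : Goal L) :
    Finset (Atom L × Atom L) :=
  G.image fun A => (A.subst θ₁, A.subst θ₂)

/-- The requirement that distinct atoms remain distinct, imposed on both substitutions, is precisely
the matching condition. -/
theorem isMatching_instancePairs {θ₁ θ₂ : L.V → Term L} {G₁ G₂ G : Goal L}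
    (h₁ : ∀ A ∈ G, A.subst θ₁ ∈ G₁) (i₁ : Set.InjOn (Atom.subst θ₁) (G : Set (Atom L)))
    (h₂ : ∀ A ∈ G, A.subst θ₂ ∈ G₂) (i₂ : Set.InjOn (Atom.subst θ₂) (G : Set (Atom L))) :
    IsMatching G₁ G₂ (instancePairs θ₁ θ₂ G) := by
  classical
  refine ⟨?_, ?_, ?_⟩
  · intro e he
    obtain ⟨A, hA, rfl⟩ := Finset.mem_image.1 he
    exact ⟨h₁ A hA, h₂ A hA⟩
  · intro e he e' he' h
    obtain ⟨A, hA, rfl⟩ := Finset.mem_image.1 he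
    obtain ⟨B, hB, rfl⟩ := Finset.mem_image.1 he'
    rw [i₁ hA hB h]
  · intro e he e' he' h
    obtain ⟨A, hA, rfl⟩ := Finset.mem_image.1 he
    obtain ⟨B, hB, rfl⟩ := Finset.mem_image.1 he'
    rw [i₂ hA hB h]

theorem sum_instancePairs {R : Type*} [AddCommMonoid R] {θ₁ θ₂ : L.V → Term L} {G : Goal L}
    (i₁ : Set.InjOn (Atom.subst θ₁) (G : Set (Atom L))) (w : Atom L → Atom L → R) :
    ∑ e ∈ instancePairs θ₁ θ₂ G, w e.1 e.2 = ∑ A ∈ G, w (A.subst θ₁) (A.subst θ₂) := by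
  classical
  unfold instancePairs
  rw [Finset.sum_image]
  intro A hA B hB h
  exact i₁ hA hB (Prod.ext_iff.1 h).1

/-- A matching of largest weight yields a most specific generalization. -/
theorem isMsg_goalOfMatching (hΦ : IsVariabilization W Φ) {G₁ G₂ : Goal L}
    {M : Finset (Atom L × Atom L)} (hM : IsMaxWeightMatching (weight Φ) G₁ G₂ M) :
    IsMsg {G₁, G₂} (goalOfMatching Φ M) := by
  refine ⟨isCommonGeneralization_goalOfMatching hΦ hM.1, fun G' hG' => ?_⟩
  obtain ⟨⟨θ₁, h₁, i₁⟩, ⟨θ₂, h₂, i₂⟩⟩ := isCommonGeneralization_pair.1 hG'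
  -- The instance pairs of `G'` compete with `M`; it remains to bound τ of `G'` by their weight,
  -- atom by atom.
  have hle := (hM.2 _ (isMatching_instancePairs h₁ i₁ h₂ i₂)).trans
    (sum_weight_le_card_tau hΦ hM.1)
  rw [sum_instancePairs i₁] at hle
  rw [← Nat.cast_le (α := ℤ)]
  refine le_trans ?_ hle
  rw [Goal.card_tau]
  push_cast
  refine Finset.sum_le_sum fun A _ => ?_
  -- Both instances of an atom keep its predicate symbol, so the weight -1 does not occur here.
  rw [weight_eq_of_pred_eq hΦ (by rfl)]
  exact_mod_cast Atom.card_tau_le_common θ₁ θ₂ A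

end Dau

end

section

/-! ### Reasoning about programs -/

/-- `p`, started in `s`, halts within `T` steps in a state satisfying `Q`. -/
def Runs (p : Prog) (s : State) (T : ℕ) (Q : State → Prop) : Prop :=
  ∃ s' t, Exec p s s' t ∧ t ≤ T ∧ Q s'

/-- The registers a program may write. -/
def Prog.regs : Prog → List ℕ
  | .skip => []
  | .instr (.set d _) => [d]
  | .instr (.copy d _) => [d]
  | .instr (.add d _ _) => [d]
  | .instr (.sub d _ _) => [d]
  | .instr (.load d _ _) => [d]
  | .instr (.store _ _ _) => []
  | .seq p q => p.regs ++ q.regs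
  | .ite _ p q => p.regs ++ q.regs
  | .loop _ p => p.regs

/-- The arrays a program may write. -/
def Prog.arrays : Prog → List ℕ
  | .instr (.store m _ _) => [m]
  | .seq p q => p.arrays ++ q.arrays
  | .ite _ p q => p.arrays ++ q.arrays
  | .loop _ p => p.arrays
  | _ => []

/-- The states agree on everything that `p` does not write. -/
structure Frame (p : Prog) (s s' : State) : Prop where
  reg : ∀ r, r ∉ p.regs → s'.reg r = s.reg r
  mem : ∀ m, m ∉ p.arrays → s'.mem m = s.mem m

theorem Frame.refl (p : Prog) (s : State) : Frame p s s := ⟨fun _ _ => rfl, fun _ _ => rfl⟩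

theorem Frame.trans {p : Prog} {s s' s'' : State} (h : Frame p s s') (h' : Frame p s' s'') :
    Frame p s s'' :=
  ⟨fun r hr => (h'.reg r hr).trans (h.reg r hr), fun m hm => (h'.mem m hm).trans (h.mem m hm)⟩

theorem Frame.mono {p q : Prog} {s s' : State} (h : Frame p s s')
    (hr : p.regs ⊆ q.regs) (hm : p.arrays ⊆ q.arrays) : Frame q s s' :=
  ⟨fun r hn => h.reg r fun hx => hn (hr hx), fun m hn => h.mem m fun hx => hn (hm hx)⟩

/-- What a program may write is read off its syntax. For concrete programs the side conditions are
decidable, so later preservation facts follow by `decide`. -/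
theorem Exec.frame {p : Prog} {s s' : State} {t : ℕ} (h : Exec p s s' t) : Frame p s s' := by
  induction h with
  | skip s => exact Frame.refl _ _
  | instr i s =>
    cases i <;> constructor <;> intro r hr <;>
      simp_all [Prog.regs, Prog.arrays, Instr.exec, State.setReg]
  | seq _ _ h h' =>
    exact (h.mono (by simp [Prog.regs]) (by simp [Prog.arrays])).trans
      (h'.mono (by simp [Prog.regs]) (by simp [Prog.arrays]))
  | iteTrue _ _ h => exact h.mono (by simp [Prog.regs]) (by simp [Prog.arrays])
  | iteFalse _ _ h => exact h.mono (by simp [Prog.regs]) (by simp [Prog.arrays])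
  | loopTrue _ _ _ h h' =>
    exact (h.mono (by simp [Prog.regs]) (by simp [Prog.arrays])).trans h'
  | loopFalse _ => exact Frame.refl _ _

namespace Runs

variable {p q : Prog} {s : State} {T T₁ T₂ : ℕ} {Q R : State → Prop}

/-- This consequence rule supplies the frame for free, so postconditions need to mention only what
changes. -/
theorem mono (h : Runs p s T₁ Q) (hT : T₁ ≤ T) (hQ : ∀ s', Q s' → Frame p s s' → R s') :
    Runs p s T R :=
  let ⟨s', t, he, ht, hq⟩ := h
  ⟨s', t, he, ht.trans hT, hQ s' hq he.frame⟩

theorem skip (h : Q s) (hT : 1 ≤ T) : Runs .skip s T Q := ⟨s, 1, .skip s, hT, h⟩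

theorem instr {i : Instr} (h : Q (i.exec s)) (hT : 1 ≤ T) : Runs (.instr i) s T Q :=
  ⟨_, 1, .instr i s, hT, h⟩

theorem seq (h : Runs p s T₁ fun s' => Frame p s s' → Runs q s' T₂ Q) (hT : T₁ + T₂ ≤ T) :
    Runs (.seq p q) s T Q := by
  obtain ⟨s', t, he, ht, h'⟩ := h
  obtain ⟨s'', t', he', ht', hq⟩ := h' he.frame
  exact ⟨s'', t + t', he.seq he', by omega, hq⟩

theorem ite {c : Test} (h₁ : c.Holds s → Runs p s T₁ Q) (h₂ : ¬ c.Holds s → Runs q s T₁ Q)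
    (hT : T₁ + 1 ≤ T) : Runs (.ite c p q) s T Q := by
  by_cases hc : c.Holds s
  · obtain ⟨s', t, he, ht, hq⟩ := h₁ hc
    exact ⟨s', t + 1, .iteTrue hc he, by omega, hq⟩
  · obtain ⟨s', t, he, ht, hq⟩ := h₂ hc
    exact ⟨s', t + 1, .iteFalse hc he, by omega, hq⟩

/-- A loop with an invariant that bounds the number of remaining rounds. -/
theorem loop {c : Test} {B : ℕ} (I : ℕ → State → Prop) {n : ℕ}
    (hstep : ∀ k s', I k s' → Frame p s s' → c.Holds s' →
      Runs p s' B fun s'' => ∃ k' < k, I k' s'')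
    (h0 : I n s) :
    Runs (.loop c p) s (n * (B + 1) + 1) fun s' => (∃ k, I k s') ∧ ¬ c.Holds s' := by
  suffices H : ∀ n s', Frame p s s' → I n s' →
      Runs (.loop c p) s' (n * (B + 1) + 1) fun s' => (∃ k, I k s') ∧ ¬ c.Holds s' from
    H n s (Frame.refl _ _) h0
  intro n
  induction n using Nat.strong_induction_on with
  | _ n ih =>
    intro s' hf hI
    by_cases hc : c.Holds s'
    · obtain ⟨s₁, t, he, ht, k', hk', hI'⟩ := hstep _ s' hI hf hc
      obtain ⟨s₂, t', he', ht', hq⟩ := ih k' hk' s₁ (hf.trans he.frame) hI'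
      refine ⟨s₂, t + t' + 1, .loopTrue hc he he', ?_, hq⟩
      -- The measure drops by at least one, which frees `B + 1` steps: the round just executed and
      -- its test.
      have := Nat.mul_le_mul_right (B + 1) (Nat.succ_le_of_lt hk')
      rw [Nat.succ_mul] at this; omega
    · exact ⟨s', 1, .loopFalse hc, by omega, ⟨_, hI⟩, hc⟩

end Runs

/-- A sequence of elementary instructions. -/
def block : List Instr → Prog
  | [] => .skip
  | i :: is => .seq (.instr i) (block is)

/-- Execution of a sequence of elementary instructions. -/
def execAll : List Instr → State → State
  | [], s => s
  | i :: is, s => execAll is (i.exec s)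

theorem Runs.of_block {is : List Instr} {s : State} {T : ℕ} {Q : State → Prop}
    (h : Q (execAll is s)) (hT : is.length + 1 ≤ T) : Runs (block is) s T Q := by
  induction is generalizing s T with
  | nil => exact .skip h hT
  | cons i is ih =>
    refine Runs.seq (T₁ := 1) (T₂ := is.length + 1) (.instr ?_ le_rfl) ?_
    · exact fun _ => ih h le_rfl
    · simp at hT; omega

/-- `for reg r < reg b do p`, where register `o` holds the increment. -/
def forLoop (r b o : ℕ) (p : Prog) : Prog :=
  .loop (.lt r b) (.seq p (.instr (.add r r o)))

/-- A round costs `B` for the body and two more for increment and test; the last step is the failing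
test. The invariant is indexed by the counter, hence demanded after the increment. -/
theorem Runs.of_forLoop {r b o : ℕ} {p : Prog} {s : State} {B : ℕ} {lo hi : ℤ}
    (I : ℤ → State → Prop) (hle : lo ≤ hi) (hr : r ∉ p.regs) (hb : b ∉ p.regs) (ho : o ∉ p.regs)
    (hbr : b ≠ r) (hor : o ≠ r)
    (h0 : s.reg r = lo) (h1 : s.reg b = hi) (h2 : s.reg o = 1)
    (hI : I lo s)
    (hstep : ∀ j s', lo ≤ j → j < hi → I j s' → s'.reg r = j →
      Frame (forLoop r b o p) s s' →
      Runs p s' B fun s'' => Frame p s' s'' → I (j + 1) ((Instr.add r r o).exec s'')) :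
    Runs (forLoop r b o p) s ((hi - lo).toNat * (B + 2) + 1) fun s' =>
      I hi s' ∧ s'.reg r = hi := by
  have key := Runs.loop (p := .seq p (.instr (.add r r o))) (c := .lt r b) (s := s) (B := B + 1)
    (I := fun k s' => ∃ j, lo ≤ j ∧ j ≤ hi ∧ (hi - j).toNat = k ∧ I j s' ∧ s'.reg r = j)
    (n := (hi - lo).toNat) ?_ ⟨lo, le_rfl, hle, rfl, hI, h0⟩
  · refine key.mono le_rfl fun s' h hf => ?_
    obtain ⟨⟨k, j, hlo, hhi, hk, hIj, hj⟩, hc⟩ := h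
    have hbs : s'.reg b = hi := by
      rw [hf.reg b (by simp [Prog.regs, hb, hbr]), h1]
    have : j = hi := by
      simp only [Test.Holds, hbs, hj] at hc; omega
    subst this; exact ⟨hIj, hj⟩
  · rintro k s' ⟨j, hlo, hhi, hk, hIj, hj⟩ hf hc
    have hbs : s'.reg b = hi := by
      rw [hf.reg b (by simp [Prog.regs, hb, hbr]), h1]
    have hos : s'.reg o = 1 := by
      rw [hf.reg o (by simp [Prog.regs, ho, hor]), h2]
    have hlt : j < hi := by simpa only [Test.Holds, hbs, hj] using hc
    refine Runs.seq (T₂ := 1) ?_ le_rfl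
    refine (hstep j s' hlo hlt hIj hj (hf.mono (by simp [AntiUnif.forLoop, Prog.regs])
      (by simp [AntiUnif.forLoop, Prog.arrays]))).mono le_rfl fun s'' h hf' _ => ?_
    refine Runs.instr ⟨_, ?_, j + 1, by omega, by omega, rfl, h hf', ?_⟩ le_rfl
    · omega
    simp [Instr.exec, State.setReg, hf'.reg r hr, hf'.reg o ho, hj, hos]

end

section

variable {L : Context}

/-! ### Building common generalizations of pairs of records

Registers `3`, `4`, `5` hold the constants `0`, `1`, `2`. A stack in the arrays `13`, `14`, `15`
of height `reg 10` holds triples: the addresses of two records, and the cell of array `3` that is to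
receive the address of their common generalization. Registers `11`, `12`, `13` hold the first
free cell of array `3`, the number of the next fresh variable, and the number of nodes other
than variables built so far. -/

/-- Write a fresh variable. -/
def freshVar : Prog :=
  block [.store 3 11 3, .add 11 11 4, .store 3 11 12, .add 11 11 4, .add 12 12 4]

/-- Push one pair of arguments. -/
def pushOne : Prog :=
  block [.load 25 0 19, .store 13 10 25, .load 25 0 20, .store 14 10 25, .store 15 10 11,
    .add 10 10 4, .add 19 19 4, .add 20 20 4]

/-- Write the arity, reserve the cells for the arguments and push all pairs of arguments. -/
def pushArgs : Prog :=
  .seq (block [.add 19 19 4, .load 23 0 19, .store 3 11 23, .add 11 11 4, .add 19 19 4,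
    .add 20 20 5, .add 24 11 23]) (forLoop 11 24 4 pushOne)

/-- Write a node with the common symbol. -/
def sharedNode : Prog :=
  .seq (block [.add 13 13 4, .store 3 11 17, .add 11 11 4, .store 3 11 21, .add 11 11 4])
    (.ite (.eq 17 4) .skip pushArgs)

/-- Pop a triple and read the heads of the two records. -/
def popHeads : Prog :=
  block [.sub 10 10 4, .load 14 13 10, .load 15 14 10, .load 16 15 10, .store 3 16 11,
    .load 17 0 14, .load 18 0 15, .add 19 14 4, .load 21 0 19, .add 20 15 4, .load 22 0 20]

/-- Process the top of the stack. -/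
def buildStep : Prog :=
  .seq popHeads (.ite (.eq 17 18) (.ite (.eq 17 3) freshVar
    (.ite (.eq 21 22) sharedNode freshVar)) freshVar)

/-- Process the whole stack. -/
def build : Prog := .loop (.lt 3 10) buildStep

/-- The constant registers. -/
structure Ready (s : State) : Prop where
  zero : s.reg 3 = 0
  one : s.reg 4 = 1
  two : s.reg 5 = 2

/-- The top of the stack, at height `p`. -/
structure Item (s : State) (p a b d : ℤ) : Prop where
  nonneg : 0 ≤ p
  sp : s.reg 10 = p + 1
  fst : s.mem 13 p = a
  snd : s.mem 14 p = b
  dest : s.mem 15 p = d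
  lt : d < s.reg 11

/-- The stack below `p` is unchanged. -/
structure Keep (p : ℤ) (s s' : State) : Prop where
  fst : ∀ q < p, s'.mem 13 q = s.mem 13 q
  snd : ∀ q < p, s'.mem 14 q = s.mem 14 q
  dest : ∀ q < p, s'.mem 15 q = s.mem 15 q

/-- The node popped from the stack is written, and its address put into its destination cell. -/
structure Wrote (s s' : State) (d tag sym : ℤ) : Prop where
  heap : ∀ x < s.reg 11, x ≠ d → s'.mem 3 x = s.mem 3 x
  dest : s'.mem 3 d = s.reg 11
  tag : s'.mem 3 (s.reg 11) = tag
  sym : s'.mem 3 (s.reg 11 + 1) = sym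

theorem Runs.popHeads {s : State} {p a b d : ℤ} (hs : Ready s) (hi : Item s p a b d)
    {Q : State → Prop}
    (h : ∀ s', Frame popHeads s s' → s'.reg 10 = p → s'.reg 16 = d →
      s'.reg 17 = s.mem 0 a → s'.reg 18 = s.mem 0 b → s'.reg 19 = a + 1 → s'.reg 20 = b + 1 →
      s'.reg 21 = s.mem 0 (a + 1) → s'.reg 22 = s.mem 0 (b + 1) →
      s'.mem 3 = Function.update (s.mem 3) d (s.reg 11) → Q s') :
    Runs popHeads s 12 Q := by
  have h1 : Runs AntiUnif.popHeads s 12 fun s' => s'.reg 10 = p ∧ s'.reg 16 = d ∧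
      s'.reg 17 = s.mem 0 a ∧ s'.reg 18 = s.mem 0 b ∧ s'.reg 19 = a + 1 ∧ s'.reg 20 = b + 1 ∧
      s'.reg 21 = s.mem 0 (a + 1) ∧ s'.reg 22 = s.mem 0 (b + 1) ∧
      s'.mem 3 = Function.update (s.mem 3) d (s.reg 11) := by
    refine Runs.of_block ?_ le_rfl
    simp [execAll, Instr.exec, State.setReg, hs.one, hi.sp, hi.fst, hi.snd, hi.dest]
  exact h1.mono le_rfl fun s' ⟨a1, a2, a3, a4, a5, a6, a7, a8, a9⟩ hf =>
    h s' hf a1 a2 a3 a4 a5 a6 a7 a8 a9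

/-- Here `s₀` is the state before the pop. The destination cell lies below the allocation pointer,
so the new record cannot overwrite it. -/
theorem Runs.freshVar_of_pop {s s₀ : State} {d : ℤ} (hd : d < s₀.reg 11) (hs : Ready s)
    (h11 : s.reg 11 = s₀.reg 11)
    (h3 : s.mem 3 = Function.update (s₀.mem 3) d (s₀.reg 11)) :
    Runs freshVar s 6 fun s' => s'.reg 11 = s₀.reg 11 + 2 ∧ s'.reg 12 = s.reg 12 + 1 ∧
      Wrote s₀ s' d 0 (s.reg 12) := by
  refine Runs.of_block ⟨?_, ?_, ⟨?_, ?_, ?_, ?_⟩⟩ le_rfl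
  · simp [execAll, Instr.exec, State.setReg, hs.one, h11]; ring
  · simp [execAll, Instr.exec, State.setReg, hs.one]
  · intro x hx hxd
    have h1 : x ≠ s₀.reg 11 + 1 := by omega
    have h2 : x ≠ s₀.reg 11 := by omega
    simp [execAll, Instr.exec, State.setReg, hs.one, h11, h3, Function.update_apply, h1, h2, hxd]
  · have h1 : d ≠ s₀.reg 11 + 1 := by omega
    have h2 : d ≠ s₀.reg 11 := by omega
    simp [execAll, Instr.exec, State.setReg, hs.one, h11, h3, Function.update_apply, h1, h2]
  · simp [execAll, Instr.exec, State.setReg, hs.one, hs.zero, h11, Function.update_apply]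
  · simp [execAll, Instr.exec, State.setReg, hs.one, h11, Function.update_apply]

/-- Records with different heads, or variables, yield a fresh variable. -/
theorem Runs.buildStep_fresh {s : State} {p a b d : ℤ} (hs : Ready s) (hi : Item s p a b d)
    (hne : s.mem 0 a = s.mem 0 b → s.mem 0 a ≠ 0 → s.mem 0 (a + 1) ≠ s.mem 0 (b + 1)) :
    Runs buildStep s 40 fun s' => s'.reg 10 = p ∧ s'.reg 11 = s.reg 11 + 2 ∧
      s'.reg 12 = s.reg 12 + 1 ∧ s'.reg 13 = s.reg 13 ∧ Keep p s s' ∧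
      Wrote s s' d 0 (s.reg 12) := by
  refine Runs.seq (T₁ := 12) (T₂ := 28) (Runs.popHeads hs hi ?_) le_rfl
  intro s₁ hf h10 h16 h17 h18 h19 h20 h21 h22 h3 _
  have hr : Ready s₁ := ⟨by rw [hf.reg 3 (by decide), hs.zero], by rw [hf.reg 4 (by decide), hs.one],
    by rw [hf.reg 5 (by decide), hs.two]⟩
  have fin : Runs freshVar s₁ 6 fun s' => s'.reg 10 = p ∧ s'.reg 11 = s.reg 11 + 2 ∧
      s'.reg 12 = s.reg 12 + 1 ∧ s'.reg 13 = s.reg 13 ∧ Keep p s s' ∧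
      Wrote s s' d 0 (s.reg 12) := by
    refine (Runs.freshVar_of_pop hi.lt hr (hf.reg 11 (by decide)) h3).mono le_rfl ?_
    rintro s' ⟨k11, k12, hw⟩ hf'
    have e12 := hf.reg 12 (by decide)
    rw [e12] at k12 hw
    refine ⟨by rw [hf'.reg 10 (by decide), h10], k11, k12,
      by rw [hf'.reg 13 (by decide), hf.reg 13 (by decide)], ⟨?_, ?_, ?_⟩, hw⟩ <;> intro q _
    · rw [hf'.mem 13 (by decide), hf.mem 13 (by decide)]
    · rw [hf'.mem 14 (by decide), hf.mem 14 (by decide)]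
    · rw [hf'.mem 15 (by decide), hf.mem 15 (by decide)]
  -- Every branch but one ends in `freshVar`; the remaining one, with equal symbols and equal tags
  -- other than 0, contradicts `hne`.
  refine Runs.ite (T₁ := 27) (fun c1 => ?_) (fun _ => fin.mono (by norm_num) fun _ h _ => h) le_rfl
  refine Runs.ite (T₁ := 26) (fun _ => fin.mono (by norm_num) fun _ h _ => h) (fun c2 => ?_) le_rfl
  refine Runs.ite (T₁ := 25) (fun c3 => ?_) (fun _ => fin.mono (by norm_num) fun _ h _ => h) le_rfl
  simp only [Test.Holds, h17, h18, h21, h22, hr.zero] at c1 c2 c3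
  exact absurd c3 (hne c1 c2)

theorem Runs.sharedNode_head {s s₀ : State} {d : ℤ} (hd : d < s₀.reg 11) (hs : Ready s)
    (h11 : s.reg 11 = s₀.reg 11)
    (h3 : s.mem 3 = Function.update (s₀.mem 3) d (s₀.reg 11)) :
    Runs (block [.add 13 13 4, .store 3 11 17, .add 11 11 4, .store 3 11 21, .add 11 11 4]) s 6
      fun s' => s'.reg 11 = s₀.reg 11 + 2 ∧ s'.reg 13 = s.reg 13 + 1 ∧
      Wrote s₀ s' d (s.reg 17) (s.reg 21) := by
  refine Runs.of_block ⟨?_, ?_, ⟨?_, ?_, ?_, ?_⟩⟩ le_rfl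
  · simp [execAll, Instr.exec, State.setReg, hs.one, h11]; ring
  · simp [execAll, Instr.exec, State.setReg, hs.one]
  · intro x hx hxd
    have h1 : x ≠ s₀.reg 11 + 1 := by omega
    have h2 : x ≠ s₀.reg 11 := by omega
    simp [execAll, Instr.exec, State.setReg, hs.one, h11, h3, Function.update_apply, h1, h2, hxd]
  · have h1 : d ≠ s₀.reg 11 + 1 := by omega
    have h2 : d ≠ s₀.reg 11 := by omega
    simp [execAll, Instr.exec, State.setReg, hs.one, h11, h3, Function.update_apply, h1, h2]
  · simp [execAll, Instr.exec, State.setReg, hs.one, h11, Function.update_apply]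
  · simp [execAll, Instr.exec, State.setReg, hs.one, h11, Function.update_apply]

/-- All arguments have been pushed. -/
structure Pushed (s : State) (p X Y D : ℤ) (h : ℤ → ℤ) (n : ℤ) : Prop where
  fst : ∀ k, 0 ≤ k → k < n → s.mem 13 (p + k) = h (X + k)
  snd : ∀ k, 0 ≤ k → k < n → s.mem 14 (p + k) = h (Y + k)
  dest : ∀ k, 0 ≤ k → k < n → s.mem 15 (p + k) = D + k

/-- The loop counter is the allocation pointer itself: pushing a pair also reserves the cell that
will receive the address of its generalization. An argument costs 11 steps, 9 for the push and 2 for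
the loop. -/
theorem Runs.pushArgs {s : State} {p a b n : ℤ} (hs : Ready s) (hn : 0 ≤ n)
    (hsp : s.reg 10 = p) (hx : s.reg 19 = a + 1) (hy : s.reg 20 = b + 1)
    (ha : s.mem 0 (a + 2) = n) :
    Runs pushArgs s (11 * n.toNat + 9) fun s' => s'.reg 10 = p + n ∧
      s'.reg 11 = s.reg 11 + 1 + n ∧
      s'.mem 3 = Function.update (s.mem 3) (s.reg 11) n ∧
      Keep p s s' ∧ Pushed s' p (a + 3) (b + 3) (s.reg 11 + 1) (s.mem 0) n := by
  have hfirst : Runs (block [.add 19 19 4, .load 23 0 19, .store 3 11 23, .add 11 11 4,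
      .add 19 19 4, .add 20 20 5, .add 24 11 23]) s 8 fun s₁ => s₁.reg 19 = a + 3 ∧
      s₁.reg 20 = b + 3 ∧ s₁.reg 11 = s.reg 11 + 1 ∧ s₁.reg 24 = s.reg 11 + 1 + n ∧
      s₁.mem 3 = Function.update (s.mem 3) (s.reg 11) n := by
    have e : a + 1 + 1 = a + 2 := by ring
    have e' : a + 2 + 1 = a + 3 := by ring
    have e'' : b + 1 + 2 = b + 3 := by ring
    refine Runs.of_block ?_ le_rfl
    simp [execAll, Instr.exec, State.setReg, hs.one, hs.two, hx, hy, e, ha, e', e'']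
  refine Runs.seq (T₁ := 8) (T₂ := 11 * n.toNat + 1) (hfirst.mono le_rfl ?_) (by omega)
  rintro s₁ ⟨h19, h20, h11, h24, h3⟩ hf -
  have one₁ : s₁.reg 4 = 1 := by rw [hf.reg 4 (by decide), hs.one]
  have hsp₁ : s₁.reg 10 = p := by rw [hf.reg 10 (by decide), hsp]
  have hloop := Runs.of_forLoop (r := 11) (b := 24) (o := 4) (p := pushOne) (s := s₁) (B := 9)
    (lo := s.reg 11 + 1) (hi := s.reg 11 + 1 + n)
    (fun j s' => s'.reg 10 = p + (j - (s.reg 11 + 1)) ∧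
      s'.reg 19 = a + 3 + (j - (s.reg 11 + 1)) ∧ s'.reg 20 = b + 3 + (j - (s.reg 11 + 1)) ∧
      Keep p s₁ s' ∧
      Pushed s' p (a + 3) (b + 3) (s.reg 11 + 1) (s.mem 0) (j - (s.reg 11 + 1)))
    (by omega) (by decide) (by decide) (by decide) (by decide) (by decide) h11 h24 one₁
    ⟨by simp [hsp₁], by simp [h19], by simp [h20], ⟨fun _ _ => rfl, fun _ _ => rfl, fun _ _ => rfl⟩,
      ⟨fun k _ _ => by omega, fun k _ _ => by omega, fun k _ _ => by omega⟩⟩ ?_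
  · refine hloop.mono (by rw [show s.reg 11 + 1 + n - (s.reg 11 + 1) = n by ring]; omega) ?_
    rintro s' ⟨⟨h10, -, -, hk, hp⟩, h11'⟩ hf'
    rw [show s.reg 11 + 1 + n - (s.reg 11 + 1) = n by ring] at h10 hp
    refine ⟨h10, h11', by rw [hf'.mem 3 (by decide), h3], ⟨?_, ?_, ?_⟩, hp⟩ <;> intro q hq
    · rw [hk.fst q hq, hf.mem 13 (by decide)]
    · rw [hk.snd q hq, hf.mem 14 (by decide)]
    · rw [hk.dest q hq, hf.mem 15 (by decide)]
  · rintro j s' hlo hhi ⟨h10, h19', h20', hk, hp⟩ hj hf'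
    have one' : s'.reg 4 = 1 := by rw [hf'.reg 4 (by decide), one₁]
    have m0 : s'.mem 0 = s.mem 0 := by rw [hf'.mem 0 (by decide), hf.mem 0 (by decide)]
    generalize hi : j - (s.reg 11 + 1) = i at *
    have hi' : j + 1 - (s.reg 11 + 1) = i + 1 := by omega
    refine Runs.of_block ?_ le_rfl
    intro _
    rw [hi']
    refine ⟨?_, ?_, ?_, ⟨?_, ?_, ?_⟩, ⟨?_, ?_, ?_⟩⟩
    · simp [execAll, Instr.exec, State.setReg, one', h10, add_assoc]
    · simp [execAll, Instr.exec, State.setReg, one', h19', add_assoc]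
    · simp [execAll, Instr.exec, State.setReg, one', h20', add_assoc]
    · intro q hq
      have : q ≠ p + i := by omega
      simp [execAll, Instr.exec, State.setReg, h10, Function.update_apply, this, hk.fst q hq]
    · intro q hq
      have : q ≠ p + i := by omega
      simp [execAll, Instr.exec, State.setReg, h10, Function.update_apply, this, hk.snd q hq]
    · intro q hq
      have : q ≠ p + i := by omega
      simp [execAll, Instr.exec, State.setReg, h10, Function.update_apply, this, hk.dest q hq]
    · intro k h0 hk'
      by_cases h : k = i
      · simp [execAll, Instr.exec, State.setReg, h10, Function.update_apply, h, h19', m0]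
      · simp [execAll, Instr.exec, State.setReg, h10, Function.update_apply, h,
          hp.fst k h0 (by omega)]
    · intro k h0 hk'
      by_cases h : k = i
      · simp [execAll, Instr.exec, State.setReg, h10, Function.update_apply, h, h20', m0]
      · simp [execAll, Instr.exec, State.setReg, h10, Function.update_apply, h,
          hp.snd k h0 (by omega)]
    · intro k h0 hk'
      by_cases h : k = i
      · simp [execAll, Instr.exec, State.setReg, h10, Function.update_apply, h, hj]; omega
      · simp [execAll, Instr.exec, State.setReg, h10, Function.update_apply, h,
          hp.dest k h0 (by omega)]

/-- Records with a common constant yield that constant. -/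
theorem Runs.buildStep_const {s : State} {p a b d : ℤ} (hs : Ready s) (hi : Item s p a b d)
    (ha : s.mem 0 a = 1) (hb : s.mem 0 b = 1) (hab : s.mem 0 (a + 1) = s.mem 0 (b + 1)) :
    Runs buildStep s 40 fun s' => s'.reg 10 = p ∧ s'.reg 11 = s.reg 11 + 2 ∧
      s'.reg 12 = s.reg 12 ∧ s'.reg 13 = s.reg 13 + 1 ∧ Keep p s s' ∧
      Wrote s s' d 1 (s.mem 0 (a + 1)) := by
  refine Runs.seq (T₁ := 12) (T₂ := 28) (Runs.popHeads hs hi ?_) le_rfl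
  intro s₁ hf h10 h16 h17 h18 h19 h20 h21 h22 h3 _
  have hr : Ready s₁ := ⟨by rw [hf.reg 3 (by decide), hs.zero], by rw [hf.reg 4 (by decide), hs.one],
    by rw [hf.reg 5 (by decide), hs.two]⟩
  refine Runs.ite (T₁ := 27) (fun c1 => ?_) (fun c => by simp [Test.Holds, *] at c) le_rfl
  refine Runs.ite (T₁ := 26) (fun c => by simp [Test.Holds, *, hr.zero] at c) (fun c2 => ?_) le_rfl
  refine Runs.ite (T₁ := 25) (fun c3 => ?_) (fun c => by simp [Test.Holds, *] at c) le_rfl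
  refine Runs.seq (T₁ := 6) (T₂ := 19)
    ((Runs.sharedNode_head hi.lt hr (hf.reg 11 (by decide)) h3).mono le_rfl ?_) le_rfl
  rintro s₂ ⟨k11, k13, hw⟩ hf₂ -
  have e17 : s₂.reg 17 = 1 := by rw [hf₂.reg 17 (by decide), h17, ha]
  have e4 : s₂.reg 4 = 1 := by rw [hf₂.reg 4 (by decide), hr.one]
  refine Runs.ite (T₁ := 18) (fun _ => Runs.skip ?_ (by norm_num))
    (fun c => by simp [Test.Holds, e17, e4] at c) le_rfl
  rw [h17, h21, ha] at hw
  refine ⟨by rw [hf₂.reg 10 (by decide), h10], k11,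
    by rw [hf₂.reg 12 (by decide), hf.reg 12 (by decide)],
    by rw [k13, hf.reg 13 (by decide)], ⟨?_, ?_, ?_⟩, hw⟩ <;> intro q _
  · rw [hf₂.mem 13 (by decide), hf.mem 13 (by decide)]
  · rw [hf₂.mem 14 (by decide), hf.mem 14 (by decide)]
  · rw [hf₂.mem 15 (by decide), hf.mem 15 (by decide)]

/-- Records with a common function or predicate symbol: the arguments are pushed. -/
theorem Runs.buildStep_node {s : State} {p a b d n tag : ℤ} (hs : Ready s)
    (hi : Item s p a b d) (hn : 0 ≤ n)
    (ha : s.mem 0 a = tag) (hb : s.mem 0 b = tag) (htag : 2 ≤ tag)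
    (hab : s.mem 0 (a + 1) = s.mem 0 (b + 1)) (han : s.mem 0 (a + 2) = n) :
    Runs buildStep s (11 * n.toNat + 40) fun s' => s'.reg 10 = p + n ∧
      s'.reg 11 = s.reg 11 + 3 + n ∧ s'.reg 12 = s.reg 12 ∧ s'.reg 13 = s.reg 13 + 1 ∧
      Keep p s s' ∧ Wrote s s' d tag (s.mem 0 (a + 1)) ∧ s'.mem 3 (s.reg 11 + 2) = n ∧
      Pushed s' p (a + 3) (b + 3) (s.reg 11 + 3) (s.mem 0) n := by
  refine Runs.seq (T₁ := 12) (T₂ := 11 * n.toNat + 28) (Runs.popHeads hs hi ?_) (by omega)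
  intro s₁ hf h10 h16 h17 h18 h19 h20 h21 h22 h3 _
  have hr : Ready s₁ := ⟨by rw [hf.reg 3 (by decide), hs.zero], by rw [hf.reg 4 (by decide), hs.one],
    by rw [hf.reg 5 (by decide), hs.two]⟩
  refine Runs.ite (T₁ := 11 * n.toNat + 27) (fun c1 => ?_)
    (fun c => by simp [Test.Holds, *] at c) (by omega)
  refine Runs.ite (T₁ := 11 * n.toNat + 26)
    (fun c => by simp only [Test.Holds, hr.zero] at c; omega) (fun c2 => ?_) (by omega)
  refine Runs.ite (T₁ := 11 * n.toNat + 25) (fun c3 => ?_)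
    (fun c => by simp [Test.Holds, *] at c) (by omega)
  refine Runs.seq (T₁ := 6) (T₂ := 11 * n.toNat + 19)
    ((Runs.sharedNode_head hi.lt hr (hf.reg 11 (by decide)) h3).mono le_rfl ?_) (by omega)
  rintro s₂ ⟨k11, k13, hw⟩ hf₂ -
  have e17 : s₂.reg 17 = tag := by rw [hf₂.reg 17 (by decide), h17, ha]
  have hr₂ : Ready s₂ := ⟨by rw [hf₂.reg 3 (by decide), hr.zero],
    by rw [hf₂.reg 4 (by decide), hr.one], by rw [hf₂.reg 5 (by decide), hr.two]⟩
  have m0 : s₂.mem 0 = s.mem 0 := by rw [hf₂.mem 0 (by decide), hf.mem 0 (by decide)]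
  refine Runs.ite (T₁ := 11 * n.toNat + 18)
    (fun c => by simp only [Test.Holds, e17, hr₂.one] at c; omega) (fun _ => ?_) (by omega)
  refine (Runs.pushArgs (p := p) (a := a) (b := b) hr₂ hn (by rw [hf₂.reg 10 (by decide), h10])
    (by rw [hf₂.reg 19 (by decide), h19]) (by rw [hf₂.reg 20 (by decide), h20])
    (by rw [m0, han])).mono (by omega) ?_
  rintro s₃ ⟨g10, g11, g3, hk, hp⟩ hf₃
  rw [k11] at g11 g3 hp
  rw [m0] at hp
  rw [h17, h21, ha] at hw
  have hlt := hi.lt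
  refine ⟨g10, by rw [g11]; ring,
    by rw [hf₃.reg 12 (by decide), hf₂.reg 12 (by decide), hf.reg 12 (by decide)],
    by rw [hf₃.reg 13 (by decide), k13, hf.reg 13 (by decide)], ⟨?_, ?_, ?_⟩,
    ⟨?_, ?_, ?_, ?_⟩, by rw [g3]; simp, by rwa [show s.reg 11 + 3 = s.reg 11 + 2 + 1 by ring]⟩
  · intro q hq
    rw [hk.fst q hq, hf₂.mem 13 (by decide), hf.mem 13 (by decide)]
  · intro q hq
    rw [hk.snd q hq, hf₂.mem 14 (by decide), hf.mem 14 (by decide)]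
  · intro q hq
    rw [hk.dest q hq, hf₂.mem 15 (by decide), hf.mem 15 (by decide)]
  · intro x hx hxd
    rw [g3, Function.update_of_ne (by omega), hw.heap x hx hxd]
  · rw [g3, Function.update_of_ne (by omega), hw.dest]
  · rw [g3, Function.update_of_ne (by omega), hw.tag]
  · rw [g3, Function.update_of_ne (by omega), hw.sym]

end

/-! ### Correctness and cost of `build`, by induction on the first term -/

section

variable {L : Context}

/-- Up to `δ` steps of `build` lead from `s` to `s'`. -/
structure Steps (s s' : State) (δ : ℕ) : Prop where
  exec : ∀ s'' T, Exec build s' s'' T → ∃ T', Exec build s s'' T' ∧ T' ≤ T + δ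
  frame : Frame build s s'

theorem Steps.refl (s : State) : Steps s s 0 := ⟨fun _ T h => ⟨T, h, le_rfl⟩, Frame.refl _ _⟩

theorem Steps.trans {s s' s'' : State} {δ δ' : ℕ} (h : Steps s s' δ) (h' : Steps s' s'' δ') :
    Steps s s'' (δ + δ') := by
  refine ⟨fun z T hz => ?_, h.frame.trans h'.frame⟩
  obtain ⟨T₁, e₁, l₁⟩ := h'.exec z T hz
  obtain ⟨T₂, e₂, l₂⟩ := h.exec z T₁ e₁
  exact ⟨T₂, e₂, by omega⟩

/-- The additional step is the loop test, which succeeds on a non-empty stack. As `Steps` only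
prefixes runs of the loop, one stack item can be treated without describing the items beneath it. -/
theorem Runs.steps {s : State} {B : ℕ} {Q : State → Prop} (h : Runs buildStep s B Q)
    (hs : Ready s) (hpos : 0 < s.reg 10) : ∃ s', Steps s s' (B + 1) ∧ Q s' := by
  obtain ⟨s', t, he, ht, hq⟩ := h
  refine ⟨s', ⟨fun z T hz => ⟨t + T + 1, .loopTrue ?_ he hz, by omega⟩,
    ⟨he.frame.reg, he.frame.mem⟩⟩, hq⟩
  simpa [Test.Holds, hs.zero] using hpos

theorem Frame.ready {s s' : State} (hf : Frame build s s') (hs : Ready s) : Ready s' :=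
  ⟨by rw [hf.reg 3 (by decide), hs.zero], by rw [hf.reg 4 (by decide), hs.one],
    by rw [hf.reg 5 (by decide), hs.two]⟩

theorem Keep.refl (p : ℤ) (s : State) : Keep p s s :=
  ⟨fun _ _ => rfl, fun _ _ => rfl, fun _ _ => rfl⟩

theorem Keep.trans {p q r : ℤ} {s s' s'' : State} (h : Keep p s s') (h' : Keep q s' s'')
    (hp : r ≤ p) (hq : r ≤ q) : Keep r s s'' :=
  ⟨fun x hx => (h'.fst x (by omega)).trans (h.fst x (by omega)),
    fun x hx => (h'.snd x (by omega)).trans (h.snd x (by omega)),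
    fun x hx => (h'.dest x (by omega)).trans (h.dest x (by omega))⟩

/-- `θ'` extends `θ` beyond the first `k` variables. -/
def Extends (ν : Numbering L) (k : ℕ) (θ θ' : L.V → Term L) : Prop :=
  ∀ i < k, θ' (ν.var i) = θ (ν.var i)

theorem Extends.trans {ν : Numbering L} {k k' : ℕ} {θ θ' θ'' : L.V → Term L}
    (h : Extends ν k θ θ') (h' : Extends ν k' θ' θ'') (hle : k ≤ k') : Extends ν k θ θ'' :=
  fun i hi => (h' i (by omega)).trans (h i hi)

/-- The variables of the term are among the first `k`. -/
def Term.VarsBelow (ν : Numbering L) (k : ℕ) : Term L → Prop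
  | .const _ => True
  | .var v => ∃ i < k, ν.var i = v
  | .app _ ts => ∀ i, (ts i).VarsBelow ν k

theorem Term.VarsBelow.mono {ν : Numbering L} {k k' : ℕ} (hle : k ≤ k') {t : Term L}
    (h : t.VarsBelow ν k) : t.VarsBelow ν k' := by
  induction t with
  | const x => trivial
  | var v => exact h.imp fun i hi => ⟨by omega, hi.2⟩
  | app f ts ih => exact fun i => ih i (h i)

/-- Values are assigned only to variables not yet in use, so instances of terms built earlier stay
the same. -/
theorem Term.subst_eq_of_extends {ν : Numbering L} {k : ℕ} {θ θ' : L.V → Term L}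
    (hθ : Extends ν k θ θ') {t : Term L} (h : t.VarsBelow ν k) : t.subst θ' = t.subst θ := by
  induction t with
  | const x => rfl
  | var v => obtain ⟨i, hi, rfl⟩ := h; exact hθ i hi
  | app f ts ih => simp only [Term.subst]; congr; funext i; exact ih i (h i)

/-- `c` has its variables among the first `k`, `θ₁` and `θ₂` instantiate it to `t` and `u`, and it
has as many nodes other than variables as possible. -/
structure Joins (ν : Numbering L) (k : ℕ) (θ₁ θ₂ : L.V → Term L) (c t u : Term L) : Prop where
  vars : c.VarsBelow ν k
  fst : c.subst θ₁ = t
  snd : c.subst θ₂ = u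
  card : c.tau.card = t.common u

theorem Joins.mono {ν : Numbering L} {k k' : ℕ} {θ₁ θ₂ θ₁' θ₂' : L.V → Term L} {c t u : Term L}
    (h : Joins ν k θ₁ θ₂ c t u) (hle : k ≤ k') (h₁ : Extends ν k θ₁ θ₁')
    (h₂ : Extends ν k θ₂ θ₂') : Joins ν k' θ₁' θ₂' c t u :=
  ⟨h.vars.mono hle, (Term.subst_eq_of_extends h₁ h.vars).trans h.fst,
    (Term.subst_eq_of_extends h₂ h.vars).trans h.snd, h.card⟩

/-- `c` is stored at `x`, using only the cells from `lo` up to `hi`. -/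
def Term.StoredWithin (ν : Numbering L) (h : ℤ → ℤ) (lo hi : ℤ) (c : Term L) (x : ℤ) : Prop :=
  ∀ h' : ℤ → ℤ, (∀ y, lo ≤ y → y < hi → h' y = h y) → c.StoredAt ν h' x

/-- Progress of `build`: the stack has height `p` and is unchanged, memory is allocated
upwards, and the next fresh variable has number `k'`. -/
structure Progress (s s' : State) (p : ℤ) (k k' : ℕ) : Prop where
  sp : s'.reg 10 = p
  keep : Keep p s s'
  alloc : s.reg 11 ≤ s'.reg 11
  fresh : s'.reg 12 = k'
  le : k ≤ k'

/-- The effect of processing a pair `t`, `u` of terms on top of the stack at height `p`, with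
destination cell `d`. -/
structure BuiltTerm (ν : Numbering L) (s s' : State) (p d : ℤ) (k k' : ℕ)
    (θ₁ θ₂ θ₁' θ₂' : L.V → Term L) (c t u : Term L) : Prop extends
    Progress s s' p k k' where
  ext₁ : Extends ν k θ₁ θ₁'
  ext₂ : Extends ν k θ₂ θ₂'
  joins : Joins ν k' θ₁' θ₂' c t u
  heap : ∀ x < s.reg 11, x ≠ d → s'.mem 3 x = s.mem 3 x
  dest : s'.mem 3 d = s.reg 11
  stored : c.StoredWithin ν (s'.mem 3) (s.reg 11) (s'.reg 11) (s.reg 11)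
  count : s'.reg 13 = s.reg 13 + t.common u

/-- `build` processes every pair of terms with first component `t` correctly. -/
def Builds (ν : Numbering L) (t : Term L) : Prop :=
  ∀ (u : Term L) (s : State) (p a b d : ℤ) (k : ℕ) (θ₁ θ₂ : L.V → Term L),
    Ready s → Item s p a b d → s.reg 12 = k → t.StoredAt ν (s.mem 0) a →
    u.StoredAt ν (s.mem 0) b →
    ∃ s' δ k' θ₁' θ₂' c, Steps s s' δ ∧ δ + 11 ≤ 60 * t.ter.card ∧
      BuiltTerm ν s s' p d k k' θ₁ θ₂ θ₁' θ₂' c t u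

/-- The effect of processing `m` pairs of arguments. -/
structure BuiltArgs (ν : Numbering L) (s s' : State) (p D : ℤ) (k k' : ℕ)
    (θ₁ θ₂ θ₁' θ₂' : L.V → Term L) {m : ℕ} (cs ts us : Fin m → Term L) : Prop extends
    Progress s s' p k k' where
  ext₁ : Extends ν k θ₁ θ₁'
  ext₂ : Extends ν k θ₂ θ₂'
  joins : ∀ i, Joins ν k' θ₁' θ₂' (cs i) (ts i) (us i)
  heap : ∀ x < s.reg 11, x < D ∨ D + m ≤ x → s'.mem 3 x = s.mem 3 x
  stored : ∀ i : Fin m, (cs i).StoredWithin ν (s'.mem 3) (s.reg 11) (s'.reg 11)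
    (s'.mem 3 (D + (i : ℕ)))
  count : s'.reg 13 = s.reg 13 + ∑ i, (ts i).common (us i)

/-- The pair pushed last is processed first, so the induction splits off the last argument. The
surplus of 11 in `Builds` is the cost of pushing one pair; summed over the arguments it repays the
loop that pushed them. -/
theorem builds_args {ν : Numbering L} {m : ℕ} (ts us : Fin m → Term L)
    (ih : ∀ i, Builds ν (ts i)) (s : State) (p X Y D : ℤ) (k : ℕ) (θ₁ θ₂ : L.V → Term L)
    (hs : Ready s) (hp : 0 ≤ p) (hsp : s.reg 10 = p + m) (hk : s.reg 12 = k)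
    (hpush : Pushed s p X Y D (s.mem 0) m) (hD : D + m ≤ s.reg 11)
    (ht : ∀ i : Fin m, (ts i).StoredAt ν (s.mem 0) (s.mem 0 (X + (i : ℕ))))
    (hu : ∀ i : Fin m, (us i).StoredAt ν (s.mem 0) (s.mem 0 (Y + (i : ℕ)))) :
    ∃ s' δ k' θ₁' θ₂' cs, Steps s s' δ ∧ δ + 11 * m ≤ 60 * ∑ i, (ts i).ter.card ∧
      BuiltArgs ν s s' p D k k' θ₁ θ₂ θ₁' θ₂' cs ts us := by
  induction m generalizing s k θ₁ θ₂ with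
  | zero =>
    refine ⟨s, 0, k, θ₁, θ₂, Fin.elim0, Steps.refl s, by simp, ?_⟩
    exact ⟨⟨by simpa using hsp, Keep.refl p s, le_rfl, hk, le_rfl⟩, fun _ _ => rfl, fun _ _ => rfl,
      fun i => i.elim0, fun _ _ _ => rfl, fun i => i.elim0, by simp⟩
  | succ m IH =>
    push_cast at hsp hpush hD
    obtain ⟨s₁, δ₁, k₁, η₁, η₂, c, hst₁, hδ₁, hb⟩ := ih (Fin.last m) (us (Fin.last m)) s
      (p + m) (s.mem 0 (X + m)) (s.mem 0 (Y + m)) (D + m) k θ₁ θ₂ hs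
      ⟨by omega, by omega, hpush.fst _ (by omega) (by omega), hpush.snd _ (by omega) (by omega),
        hpush.dest _ (by omega) (by omega), by omega⟩ hk (by simpa using ht (Fin.last m))
      (by simpa using hu (Fin.last m))
    have m0 : s₁.mem 0 = s.mem 0 := hst₁.frame.mem 0 (by decide)
    have hal := hb.alloc
    obtain ⟨s₂, δ₂, k₂, ζ₁, ζ₂, cs, hst₂, hδ₂, hbs⟩ := IH (fun i => ts i.castSucc)
      (fun i => us i.castSucc) (fun i => ih _) s₁ k₁ η₁ η₂ (hst₁.frame.ready hs)
      hb.sp hb.fresh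
      ⟨fun i h0 h1 => by rw [hb.keep.fst _ (by omega), m0, hpush.fst _ h0 (by omega)],
        fun i h0 h1 => by rw [hb.keep.snd _ (by omega), m0, hpush.snd _ h0 (by omega)],
        fun i h0 h1 => by rw [hb.keep.dest _ (by omega), hpush.dest _ h0 (by omega)]⟩
      (by omega) (fun i => by simpa [m0] using ht i.castSucc)
      (fun i => by simpa [m0] using hu i.castSucc)
    have hal₂ := hbs.alloc
    refine ⟨s₂, δ₁ + δ₂, k₂, ζ₁, ζ₂, Fin.lastCases c cs, hst₁.trans hst₂, ?_, ?_⟩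
    · rw [Fin.sum_univ_castSucc]; omega
    · refine ⟨⟨hbs.sp, hb.keep.trans hbs.keep (by omega) le_rfl, by omega, hbs.fresh,
        hb.le.trans hbs.le⟩, hb.ext₁.trans hbs.ext₁ hb.le, hb.ext₂.trans hbs.ext₂ hb.le,
        ?_, ?_, ?_, ?_⟩
      · intro i
        refine Fin.lastCases ?_ (fun i => ?_) i
        · simpa using hb.joins.mono hbs.le hbs.ext₁ hbs.ext₂
        · simpa using hbs.joins i
      · intro x hx hxD
        push_cast at hxD
        rw [hbs.heap x (by omega) (by omega), hb.heap x hx (by omega)]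
      · intro i
        refine Fin.lastCases ?_ (fun i => ?_) i
        · intro h' hh'
          simp only [Fin.lastCases_last, Fin.val_last]
          -- The cell `D + m` is not a destination of the remaining pairs, so it still points to the
          -- record of the last argument.
          rw [hbs.heap (D + m) (by omega) (by omega), hb.dest]
          refine hb.stored h' fun y h1 h2 => ?_
          rw [hh' y h1 (by omega), hbs.heap y h2 (by omega)]
        · intro h' hh'
          simp only [Fin.lastCases_castSucc, Fin.val_castSucc]
          exact hbs.stored i h' fun y h1 h2 => hh' y (by omega) h2
      · rw [hbs.count, hb.count, Fin.sum_univ_castSucc]; push_cast; ring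

/-- Processing two records with a common symbol and their arguments. -/
theorem builds_node {ν : Numbering L} {m : ℕ} (ts us : Fin m → Term L)
    (ih : ∀ i, Builds ν (ts i)) (s : State) (p a b d tag : ℤ) (k : ℕ) (θ₁ θ₂ : L.V → Term L)
    (hs : Ready s) (hi : Item s p a b d) (hk : s.reg 12 = k)
    (ha : s.mem 0 a = tag) (hb : s.mem 0 b = tag) (htag : 2 ≤ tag)
    (hab : s.mem 0 (a + 1) = s.mem 0 (b + 1)) (ham : s.mem 0 (a + 2) = m)
    (ht : ∀ i : Fin m, (ts i).StoredAt ν (s.mem 0) (s.mem 0 (a + 3 + (i : ℕ))))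
    (hu : ∀ i : Fin m, (us i).StoredAt ν (s.mem 0) (s.mem 0 (b + 3 + (i : ℕ)))) :
    ∃ s' δ k' θ₁' θ₂', ∃ cs : Fin m → Term L, Steps s s' δ ∧ δ + 11 ≤ 60 * (1 + ∑ i, (ts i).ter.card) ∧
      Progress s s' p k k' ∧ Extends ν k θ₁ θ₁' ∧ Extends ν k θ₂ θ₂' ∧
      (∀ i, Joins ν k' θ₁' θ₂' (cs i) (ts i) (us i)) ∧
      (∀ x < s.reg 11, x ≠ d → s'.mem 3 x = s.mem 3 x) ∧ s'.mem 3 d = s.reg 11 ∧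
      (∀ h' : ℤ → ℤ, (∀ y, s.reg 11 ≤ y → y < s'.reg 11 → h' y = s'.mem 3 y) →
        h' (s.reg 11) = tag ∧ h' (s.reg 11 + 1) = s.mem 0 (a + 1) ∧ h' (s.reg 11 + 2) = m ∧
        ∀ i : Fin m, (cs i).StoredAt ν h' (h' (s.reg 11 + 3 + (i : ℕ)))) ∧
      s'.reg 13 = s.reg 13 + ↑(1 + ∑ i, (ts i).common (us i)) := by
  obtain ⟨s₁, hst₁, h10, h11, h12, h13, hkeep, hw, hm, hpush⟩ :=
    (Runs.buildStep_node hs hi (Int.natCast_nonneg m) ha hb htag hab ham).steps hs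
      (by have := hi.sp; have := hi.nonneg; omega)
  have m0 : s₁.mem 0 = s.mem 0 := hst₁.frame.mem 0 (by decide)
  obtain ⟨s₂, δ₂, k₂, ζ₁, ζ₂, cs, hst₂, hδ₂, hbs⟩ := builds_args ts us ih s₁ p (a + 3) (b + 3)
    (s.reg 11 + 3) k θ₁ θ₂ (hst₁.frame.ready hs) hi.nonneg h10 (by rw [h12, hk])
    (by rwa [m0]) (by omega) (by rwa [m0]) (by rwa [m0])
  have hal := hbs.alloc
  have hd := hi.lt
  -- The round for the node costs 11m + 41 steps. The surplus of the arguments pays 11m, and 41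
  -- together with the surplus 11 of this node fits into its share of 60.
  refine ⟨s₂, _, k₂, ζ₁, ζ₂, cs, hst₁.trans hst₂, by simp only [Int.toNat_natCast]; omega,
    ⟨hbs.sp, hkeep.trans hbs.keep le_rfl le_rfl, by omega, hbs.fresh, hbs.le⟩, hbs.ext₁, hbs.ext₂,
    hbs.joins, ?_, ?_, ?_, ?_⟩
  · intro x hx hxd
    rw [hbs.heap x (by omega) (by omega), hw.heap x hx hxd]
  · rw [hbs.heap d (by omega) (by omega), hw.dest]
  · intro h' hh'
    refine ⟨?_, ?_, ?_, fun i => ?_⟩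
    · rw [hh' _ (by omega) (by omega), hbs.heap _ (by omega) (by omega), hw.tag]
    · rw [hh' _ (by omega) (by omega), hbs.heap _ (by omega) (by omega), hw.sym]
    · rw [hh' _ (by omega) (by omega), hbs.heap _ (by omega) (by omega), hm]
    · have := i.2
      rw [hh' _ (by omega) (by omega)]
      exact hbs.stored i h' fun y h1 h2 => hh' y (by omega) h2
  · rw [hbs.count, h13]; push_cast; ring

/-- A pair without common symbol yields a fresh variable. -/
theorem builds_fresh {ν : Numbering L} {t u : Term L} {s : State} {p a b d : ℤ} {k : ℕ}
    (θ₁ θ₂ : L.V → Term L) (hs : Ready s) (hi : Item s p a b d) (hk : s.reg 12 = k)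
    (hne : s.mem 0 a = s.mem 0 b → s.mem 0 a ≠ 0 → s.mem 0 (a + 1) ≠ s.mem 0 (b + 1))
    (h0 : t.common u = 0) :
    ∃ s' k' θ₁' θ₂' c, Steps s s' 41 ∧ BuiltTerm ν s s' p d k k' θ₁ θ₂ θ₁' θ₂' c t u := by
  classical
  obtain ⟨s₁, hst₁, h10, h11, h12, h13, hkeep, hw⟩ :=
    (Runs.buildStep_fresh hs hi hne).steps hs (by have := hi.sp; have := hi.nonneg; omega)
  -- Variable number `k` occurs in nothing built so far, so its value is free in both substitutions.
  -- It may occur in the input, which does no harm.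
  refine ⟨s₁, k + 1, Function.update θ₁ (ν.var k) t, Function.update θ₂ (ν.var k) u,
    .var (ν.var k), hst₁,
    ⟨⟨h10, hkeep, by omega, by rw [h12, hk]; push_cast; ring, by omega⟩, ?_, ?_,
      ⟨⟨k, by omega, rfl⟩, by simp [Term.subst], by simp [Term.subst], by simp [Term.tau, h0]⟩,
      hw.heap, hw.dest, ?_, by simp [h13, h0]⟩⟩
  · intro i hik
    exact Function.update_of_ne (fun h => by have := ν.var.injective h; omega) _ _
  · intro i hik
    exact Function.update_of_ne (fun h => by have := ν.var.injective h; omega) _ _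
  · intro h' hh'
    refine ⟨by rw [hh' _ (by omega) (by omega), hw.tag], k, rfl, ?_⟩
    rw [hh' _ (by omega) (by omega), hw.sym, hk]

/-- The cases are those of `Term.common`. Comparing numbers amounts to comparing symbols, because
each kind of symbol is numbered by a partial bijection. Time is charged to `t` alone, since no
position outside `t` is visited. -/
theorem builds (ν : Numbering L) (t : Term L) : Builds ν t := by
  induction t with
  | const x =>
    intro u s p a b d k θ₁ θ₂ hs hi hk ht hu
    obtain ⟨ha, i, hix, ha1⟩ := ht
    by_cases hux : u = .const x
    · subst hux
      obtain ⟨hb, j, hjx, hb1⟩ := hu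
      obtain rfl : i = j := ν.const.inj hix hjx
      obtain ⟨s₁, hst₁, h10, h11, h12, h13, hkeep, hw⟩ :=
        (Runs.buildStep_const hs hi ha hb (ha1.trans hb1.symm)).steps hs
          (by have := hi.sp; have := hi.nonneg; omega)
      refine ⟨s₁, 41, k, θ₁, θ₂, .const x, hst₁, by simp [Term.ter],
        ⟨⟨h10, hkeep, by omega, by rw [h12, hk], le_rfl⟩, fun _ _ => rfl, fun _ _ => rfl,
          ⟨trivial, rfl, rfl, by simp [Term.tau, Term.common]⟩, hw.heap, hw.dest, ?_,
          by simp [h13, Term.common]⟩⟩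
      intro h' hh'
      refine ⟨by rw [hh' _ (by omega) (by omega), hw.tag], i, hix, ?_⟩
      rw [hh' _ (by omega) (by omega), hw.sym, ha1]
    · obtain ⟨s', k', η₁, η₂, c, hst, hb⟩ := builds_fresh (ν := ν) (t := .const x) (u := u)
        θ₁ θ₂ hs hi hk (by
          intro h1 h2 h3
          cases u with
          | const y =>
            obtain ⟨hb, j, hjx, hb1⟩ := hu
            obtain rfl : i = j := by rw [ha1, hb1] at h3; exact_mod_cast h3
            exact hux (by rw [Option.some.inj (hix.symm.trans hjx)])
          | var v => rw [ha, hu.1] at h1; omega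
          | app g us => rw [ha, hu.1] at h1; omega)
        (by
          cases u with
          | const y => simp only [Term.common]; rw [if_neg fun h => hux (by rw [h])]
          | var v => rfl
          | app g us => rfl)
      exact ⟨s', 41, k', η₁, η₂, c, hst, by simp [Term.ter], hb⟩
  | var v =>
    intro u s p a b d k θ₁ θ₂ hs hi hk ht hu
    obtain ⟨s', k', η₁, η₂, c, hst, hb⟩ := builds_fresh (ν := ν) (t := .var v) (u := u)
      θ₁ θ₂ hs hi hk (fun _ h2 => absurd ht.1 h2) (by cases u <;> rfl)
    exact ⟨s', 41, k', η₁, η₂, c, hst, by simp [Term.ter], hb⟩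
  | app f ts ih =>
    intro u s p a b d k θ₁ θ₂ hs hi hk ht hu
    obtain ⟨ha, ⟨i, hif, ha1⟩, ha2, hts⟩ := ht
    by_cases hux : ∃ us, u = .app f us
    · obtain ⟨us, rfl⟩ := hux
      obtain ⟨hb, ⟨j, hjf, hb1⟩, hb2, hus⟩ := hu
      obtain rfl : i = j := ν.func.inj hif hjf
      obtain ⟨s', δ, k', η₁, η₂, cs, hst, hδ, hpr, e₁, e₂, hj, hheap, hdest, hstore, hcount⟩ :=
        builds_node ts us ih s p a b d 2 k θ₁ θ₂ hs hi hk ha hb le_rfl (ha1.trans hb1.symm) ha2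
          hts hus
      refine ⟨s', δ, k', η₁, η₂, .app f cs, hst, by rw [Term.card_ter_app]; exact hδ, ⟨hpr, e₁, e₂,
        ⟨fun i => (hj i).vars, ?_, ?_, ?_⟩, hheap, hdest, ?_, by rw [hcount, Term.common_app]⟩⟩
      · simp only [Term.subst, (hj _).fst]
      · simp only [Term.subst, (hj _).snd]
      · rw [Term.card_tau_app, Term.common_app]; simp only [(hj _).card]
      · intro h' hh'
        obtain ⟨g0, g1, g2, g3⟩ := hstore h' hh'
        exact ⟨g0, ⟨i, hif, by rw [g1, ha1]⟩, g2, g3⟩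
    · obtain ⟨s', k', η₁, η₂, c, hst, hb⟩ := builds_fresh (ν := ν) (t := .app f ts) (u := u)
        θ₁ θ₂ hs hi hk (by
          intro h1 h2 h3
          cases u with
          | const y => rw [ha, hu.1] at h1; omega
          | var v => rw [ha, hu.1] at h1; omega
          | app g us =>
            obtain ⟨hb, ⟨j, hjx, hb1⟩, -⟩ := hu
            obtain rfl : i = j := by rw [ha1, hb1] at h3; exact_mod_cast h3
            obtain rfl := Option.some.inj (hif.symm.trans hjx)
            exact hux ⟨us, rfl⟩)
        (by
          cases u with
          | const y => rfl
          | var v => rfl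
          | app g us =>
            simp only [Term.common]
            refine dif_neg fun h => hux ?_
            subst h
            exact ⟨us, rfl⟩)
      exact ⟨s', 41, k', η₁, η₂, c, hst, by rw [Term.card_ter_app]; omega, hb⟩

end

/-! ### Generalizing a pair of atoms -/

section

variable {L : Context}

/-- Build the common generalization of the atoms at `reg 30` and `reg 31`. Its address is left in
`reg 32`, the old value of the node counter in `reg 33`. -/
def buildPair : Prog :=
  .seq (block [.copy 10 3, .store 13 10 30, .store 14 10 31, .store 15 10 11, .add 11 11 4,
    .copy 32 11, .copy 33 13, .add 10 10 4]) build

/-- `C` has its variables among the first `k`, `θ₁` and `θ₂` instantiate it to `A` and `B`, and it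
has as many nodes other than variables as possible. -/
structure JoinsAtom (ν : Numbering L) (k : ℕ) (θ₁ θ₂ : L.V → Term L) (C A B : Atom L) : Prop where
  vars : ∀ i, (C.args i).VarsBelow ν k
  fst : C.subst θ₁ = A
  snd : C.subst θ₂ = B
  card : C.tau.card = A.common B

theorem JoinsAtom.mono {ν : Numbering L} {k k' : ℕ} {θ₁ θ₂ θ₁' θ₂' : L.V → Term L}
    {C A B : Atom L} (h : JoinsAtom ν k θ₁ θ₂ C A B) (hle : k ≤ k') (h₁ : Extends ν k θ₁ θ₁')
    (h₂ : Extends ν k θ₂ θ₂') : JoinsAtom ν k' θ₁' θ₂' C A B := by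
  refine ⟨fun i => (h.vars i).mono hle, ?_, ?_, h.card⟩
  · rw [← h.fst]
    simp only [Atom.subst, Term.subst_eq_of_extends h₁ (h.vars _)]
  · rw [← h.snd]
    simp only [Atom.subst, Term.subst_eq_of_extends h₂ (h.vars _)]

/-- The effect of `buildPair`. -/
structure BuiltPair (ν : Numbering L) (s s' : State) (k k' : ℕ)
    (θ₁ θ₂ θ₁' θ₂' : L.V → Term L) (A B : Atom L) : Prop where
  alloc : s.reg 11 ≤ s'.reg 11
  fresh : s'.reg 12 = k'
  le : k ≤ k'
  ext₁ : Extends ν k θ₁ θ₁'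
  ext₂ : Extends ν k θ₂ θ₂'
  heap : ∀ x < s.reg 11, s'.mem 3 x = s.mem 3 x
  count : s'.reg 13 - s'.reg 33 = A.common B
  total : s'.reg 13 = s.reg 13 + A.common B
  atom : A.pred = B.pred → ∃ C, JoinsAtom ν k' θ₁' θ₂' C A B ∧
    ∀ h' : ℤ → ℤ, (∀ y < s'.reg 11, h' y = s'.mem 3 y) → C.StoredAt ν h' (s'.reg 32)

/-- One cell is reserved as destination of the root, so that the root is an ordinary stack item.
Atoms differ from compound terms only in their tag. -/
theorem Runs.buildPair {ν : Numbering L} {s : State} {k : ℕ} (θ₁ θ₂ : L.V → Term L)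
    {A B : Atom L} (hs : Ready s) (hk : s.reg 12 = k) (hA : A.StoredAt ν (s.mem 0) (s.reg 30))
    (hB : B.StoredAt ν (s.mem 0) (s.reg 31)) :
    Runs buildPair s (60 * A.ter.card + 10) fun s' => ∃ k' θ₁' θ₂',
      BuiltPair ν s s' k k' θ₁ θ₂ θ₁' θ₂' A B := by
  have hfirst : Runs (block [.copy 10 3, .store 13 10 30, .store 14 10 31, .store 15 10 11,
      .add 11 11 4, .copy 32 11, .copy 33 13, .add 10 10 4]) s 9 fun s₁ =>
      Item s₁ 0 (s.reg 30) (s.reg 31) (s.reg 11) ∧ s₁.reg 11 = s.reg 11 + 1 ∧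
      s₁.reg 32 = s.reg 11 + 1 ∧ s₁.reg 33 = s.reg 13 := by
    refine Runs.of_block ⟨⟨le_rfl, ?_, ?_, ?_, ?_, ?_⟩, ?_⟩ le_rfl <;>
      simp [execAll, Instr.exec, State.setReg, hs.one, hs.zero]
  refine Runs.seq (hfirst.mono le_rfl ?_) (T₂ := 60 * A.ter.card + 1) (by omega)
  rintro s₁ ⟨hi, h11, h32, h33⟩ hf -
  have hs₁ : Ready s₁ := ⟨by rw [hf.reg 3 (by decide), hs.zero],
    by rw [hf.reg 4 (by decide), hs.one], by rw [hf.reg 5 (by decide), hs.two]⟩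
  have m0 : s₁.mem 0 = s.mem 0 := hf.mem 0 (by decide)
  have m3 : s₁.mem 3 = s.mem 3 := hf.mem 3 (by decide)
  have h12 : s₁.reg 12 = k := by rw [hf.reg 12 (by decide), hk]
  have h13 : s₁.reg 13 = s.reg 13 := hf.reg 13 (by decide)
  have finish : ∀ s' δ, Steps s₁ s' δ → s'.reg 10 = 0 → δ ≤ 60 * A.ter.card →
      ∀ Q : State → Prop, Q s' → Runs build s₁ (60 * A.ter.card + 1) Q := by
    intro s' δ hst h10 hδ Q hQ
    obtain ⟨T', e, l⟩ := hst.exec s' 1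
      (.loopFalse (by simp [Test.Holds, h10, (hst.frame.ready hs₁).zero]))
    exact ⟨s', T', e, by omega, hQ⟩
  obtain ⟨hA0, ⟨i, hi1, hA1⟩, hA2, hA3⟩ := hA
  obtain ⟨hB0, ⟨j, hj1, hB1⟩, hB2, hB3⟩ := hB
  rw [← m0] at hA0 hA1 hA2 hA3 hB0 hB1 hB2 hB3
  by_cases hp : A.pred = B.pred
  · obtain ⟨q, ts⟩ := A
    obtain ⟨q', us⟩ := B
    obtain rfl : q = q' := hp
    obtain rfl : i = j := ν.pred.inj hi1 hj1
    obtain ⟨s', δ, k', η₁, η₂, cs, hst, hδ, hpr, e₁, e₂, hj, hheap, hdest, hstore, hcount⟩ :=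
      builds_node ts us (fun i => builds ν (ts i)) s₁ 0 _ _ _ 3 k θ₁ θ₂ hs₁ hi h12 hA0 hB0
        (by norm_num) (hA1.trans hB1.symm) hA2 hA3 hB3
    have hal := hpr.alloc
    refine finish s' δ hst hpr.sp
      (by rw [Atom.card_ter]; exact (by omega : δ ≤ 60 * (1 + ∑ i, (ts i).ter.card))) _
      ⟨k', η₁, η₂, by omega, hpr.fresh, hpr.le, e₁, e₂, ?_, ?_, ?_,
        fun _ => ⟨⟨q, cs⟩, ⟨?_, ?_, ?_, ?_⟩, ?_⟩⟩
    · intro x hx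
      rw [hheap x (by omega) (by omega), m3]
    · rw [hst.frame.reg 33 (by decide), hcount, h33, h13, Atom.common_mk]; ring
    · rw [hcount, h13, Atom.common_mk]
    · exact fun i => (hj i).vars
    · simp only [Atom.subst, (hj _).fst]
    · simp only [Atom.subst, (hj _).snd]
    · rw [Atom.card_tau, Atom.common_mk]; simp only [(hj _).card]
    · intro h' hh'
      rw [hst.frame.reg 32 (by decide), h32, ← h11]
      obtain ⟨g0, g1, g2, g3⟩ := hstore h' fun y _ hy => hh' y hy
      exact ⟨g0, ⟨i, hi1, by rw [g1, hA1]⟩, g2, g3⟩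
  -- With different predicate symbols a variable record is written that stands for no atom. Its
  -- number is used up, but the substitutions are not changed.
  · obtain ⟨s', hst, g10, g11, g12, g13, -, hw⟩ :=
      (Runs.buildStep_fresh hs₁ hi (by
        intro _ _ h3
        rw [hA1, hB1] at h3
        obtain rfl : i = j := by exact_mod_cast h3
        exact hp (Option.some.inj (hi1.symm.trans hj1)))).steps hs₁ (by rw [hi.sp]; norm_num)
    refine finish s' _ hst g10 (by rw [Atom.card_ter]; omega) _
      ⟨k + 1, θ₁, θ₂, by omega, by rw [g12, h12]; push_cast; ring, by omega, fun _ _ => rfl, fun _ _ => rfl, ?_, ?_, ?_,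
        fun h => absurd h hp⟩
    · intro x hx
      rw [hw.heap x (by omega) (by omega), m3]
    · rw [hst.frame.reg 33 (by decide), g13, h33, h13, Atom.common_of_ne hp]; simp
    · rw [g13, h13, Atom.common_of_ne hp]; simp

end

section

/-! ### The Hungarian method

Rows are the integers in `[0, n)`, columns those in `[0, m)`, and `m` is a virtual column that
holds the row being added. `p j` is the row matched with column `j`, and `-1` if there is none;
`u` and `v` are the dual variables of rows and columns. -/

/-- The rows below `i` are matched, and the dual variables certify that this is optimal. -/
structure Stage (W : ℤ → ℤ → ℤ) (n m i : ℤ) (u v p : ℤ → ℤ) : Prop where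
  feasible : ∀ r j, 0 ≤ r → r < n → 0 ≤ j → j < m → W r j ≤ u r + v j
  nonneg : ∀ j, 0 ≤ j → j < m → 0 ≤ v j
  tight : ∀ j, 0 ≤ j → j < m →
    p j = -1 ∧ v j = 0 ∨ 0 ≤ p j ∧ p j < i ∧ u (p j) + v j = W (p j) j
  inj : ∀ j k, 0 ≤ j → j < m → 0 ≤ k → k < m → 0 ≤ p j → p j = p k → j = k
  surj : ∀ r, 0 ≤ r → r < i → ∃ j, 0 ≤ j ∧ j < m ∧ p j = r

/-- Needed because entering the new row in the virtual column changes `p` outside the proper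
columns. -/
theorem Stage.congr {W : ℤ → ℤ → ℤ} {n m i : ℤ} {u v p u' v' p' : ℤ → ℤ}
    (h : Stage W n m i u v p) (hi : i ≤ n) (hu : ∀ r, 0 ≤ r → r < n → u' r = u r)
    (hv : ∀ j, 0 ≤ j → j < m → v' j = v j) (hp : ∀ j, 0 ≤ j → j < m → p' j = p j) :
    Stage W n m i u' v' p' := by
  refine ⟨?_, ?_, ?_, ?_, ?_⟩
  · intro r j h0 h1 h2 h3
    rw [hu r h0 h1, hv j h2 h3]; exact h.feasible r j h0 h1 h2 h3
  · intro j h2 h3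
    rw [hv j h2 h3]; exact h.nonneg j h2 h3
  · intro j h2 h3
    rw [hv j h2 h3, hp j h2 h3]
    rcases h.tight j h2 h3 with h4 | ⟨h4, h5, h6⟩
    · exact Or.inl h4
    · exact Or.inr ⟨h4, h5, by rw [hu _ h4 (by omega)]; exact h6⟩
  · intro j k h0 h1 h2 h3
    rw [hp j h0 h1, hp k h2 h3]; exact h.inj j k h0 h1 h2 h3
  · intro r h0 h1
    obtain ⟨j, h2, h3, h4⟩ := h.surj r h0 h1
    exact ⟨j, h2, h3, by rw [hp j h2 h3, h4]⟩

/-- The search for an augmenting path from row `i` has reached the columns in `S`. -/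
structure Search (W : ℤ → ℤ → ℤ) (n m i : ℤ) (S : Finset ℤ) (u v p way minv : ℤ → ℤ)
    (ord : ℤ → ℕ) : Prop where
  stage : Stage W n m i u v p
  row : 0 ≤ i ∧ i < n
  virt : p m = i
  mem : m ∈ S
  range : ∀ k ∈ S, 0 ≤ k ∧ k ≤ m
  tree : ∀ k ∈ S, k ≠ m → 0 ≤ p k ∧ way k ∈ S ∧ ord (way k) < ord k ∧
    u (p (way k)) + v k = W (p (way k)) k
  ord_lt : ∀ k ∈ S, ord k < S.card
  slack : ∀ j, j ∉ S → 0 ≤ j → j < m → way j ∈ S ∧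
    minv j = u (p (way j)) + v j - W (p (way j)) j ∧
    ∀ k ∈ S, minv j ≤ u (p k) + v j - W (p k) j

namespace Search

variable {W : ℤ → ℤ → ℤ} {n m i : ℤ} {S : Finset ℤ} {u v p way minv : ℤ → ℤ} {ord : ℤ → ℕ}

theorem row_mem (h : Search W n m i S u v p way minv ord) {k : ℤ} (hk : k ∈ S) :
    0 ≤ p k ∧ p k ≤ i := by
  by_cases hkm : k = m
  · subst hkm; rw [h.virt]; exact ⟨h.row.1, le_rfl⟩
  · have h1 := h.range k hk
    have h2 := (h.tree k hk hkm).1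
    rcases h.stage.tight k h1.1 (by omega) with h3 | h3 <;> omega

/-- The virtual column holds row `i` and the proper columns hold only rows below `i`, so injectivity
extends to it. -/
theorem inj (h : Search W n m i S u v p way minv ord) {j k : ℤ} (hj0 : 0 ≤ j) (hj : j ≤ m)
    (hk0 : 0 ≤ k) (hk : k ≤ m) (hp : 0 ≤ p j) (he : p j = p k) : j = k := by
  have hlt : ∀ k, 0 ≤ k → k < m → p k < i := fun k h0 h1 => by
    have := h.row
    rcases h.stage.tight k h0 h1 with h3 | h3 <;> omega
  by_cases hjm : j = m
  · by_cases hkm : k = m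
    · omega
    · have := hlt k hk0 (by omega)
      rw [← he, hjm, h.virt] at this; omega
  · by_cases hkm : k = m
    · have := hlt j hj0 (by omega)
      rw [he, hkm, h.virt] at this; omega
    · exact h.stage.inj j k hj0 (by omega) hk0 (by omega) hp he

/-- As there are more columns than rows, the search has not reached all columns. -/
theorem exists_not_mem (h : Search W n m i S u v p way minv ord) (hnm : n < m) :
    ∃ j, 0 ≤ j ∧ j < m ∧ j ∉ S := by
  by_contra! hc
  have hsub : Finset.image p (Finset.Ico 0 m) ⊆ Finset.Ico 0 i := by
    intro r hr
    obtain ⟨j, hj, rfl⟩ := Finset.mem_image.1 hr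
    rw [Finset.mem_Ico] at hj
    have h1 := (h.tree j (hc j hj.1 hj.2) (by omega)).1
    rw [Finset.mem_Ico]
    rcases h.stage.tight j hj.1 hj.2 with h3 | h3 <;> omega
  have hcard := Finset.card_le_card hsub
  rw [Finset.card_image_of_injOn] at hcard
  · simp only [Int.card_Ico] at hcard
    have := h.row; omega
  · intro j hj k hk he
    rw [Finset.mem_coe, Finset.mem_Ico] at hj hk
    exact h.stage.inj j k hj.1 hj.2 hk.1 hk.2 (h.tree j (hc j hj.1 hj.2) (by omega)).1 he

theorem init (hst : Stage W n m i u v p) (hi : 0 ≤ i ∧ i < n) (hm : 0 ≤ m)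
    (hp : p m = i) (hway : ∀ j, 0 ≤ j → j < m → way j = m)
    (hmin : ∀ j, 0 ≤ j → j < m → minv j = u i + v j - W i j) :
    Search W n m i {m} u v p way minv fun _ => 0 := by
  refine ⟨hst, hi, hp, by simp, by simp [hm], by simp, by simp, ?_⟩
  intro j _ h0 h1
  rw [hway j h0 h1, hmin j h0 h1]
  simp [hp]

/-- A dual update makes an edge to a new column tight. -/
theorem relax (h : Search W n m i S u v p way minv ord) {u' v' minv' : ℤ → ℤ} {δ j₁ : ℤ}
    (hj₁ : j₁ ∉ S) (h0 : 0 ≤ j₁) (h1 : j₁ < m) (hδ : minv j₁ = δ)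
    (hle : ∀ j, j ∉ S → 0 ≤ j → j < m → δ ≤ minv j)
    (hu : ∀ k ∈ S, u' (p k) = u (p k) - δ) (hu' : ∀ r, (∀ k ∈ S, p k ≠ r) → u' r = u r)
    (hv : ∀ k ∈ S, k ≠ m → v' k = v k + δ)
    (hv' : ∀ j, j ∉ S → 0 ≤ j → j < m → v' j = v j)
    (hm : ∀ j, j ∉ S → 0 ≤ j → j < m → minv' j = minv j - δ) :
    Search W n m i S u' v' p way minv' ord := by
  -- The amount is the slack of an edge, which feasibility makes nonnegative. Hence column duals
  -- only grow, and edges into reached columns from unreached rows stay feasible.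
  have hδ0 : 0 ≤ δ := by
    obtain ⟨h2, h3, -⟩ := h.slack j₁ hj₁ h0 h1
    have h4 := h.row_mem h2
    have h5 := h.stage.feasible (p (way j₁)) j₁ h4.1 (by have := h.row; omega) h0 h1
    omega
  refine ⟨⟨?_, ?_, ?_, h.stage.inj, h.stage.surj⟩, h.row, h.virt, h.mem, h.range, ?_, h.ord_lt, ?_⟩
  · intro r j hr0 hr1 hj0 hj1
    have hf := h.stage.feasible r j hr0 hr1 hj0 hj1
    by_cases hr : ∃ k ∈ S, p k = r
    · obtain ⟨k, hk, rfl⟩ := hr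
      rw [hu k hk]
      by_cases hj : j ∈ S
      · rw [hv j hj (by omega)]; omega
      · rw [hv' j hj hj0 hj1]
        have h2 := (h.slack j hj hj0 hj1).2.2 k hk
        have h3 := hle j hj hj0 hj1
        omega
    · push Not at hr
      rw [hu' r hr]
      by_cases hj : j ∈ S
      · rw [hv j hj (by omega)]; omega
      · rw [hv' j hj hj0 hj1]; omega
  · intro j hj0 hj1
    have h2 := h.stage.nonneg j hj0 hj1
    by_cases hj : j ∈ S
    · rw [hv j hj (by omega)]; omega
    · rw [hv' j hj hj0 hj1]; omega
  · intro j hj0 hj1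
    by_cases hj : j ∈ S
    · have h2 := (h.tree j hj (by omega)).1
      rcases h.stage.tight j hj0 hj1 with h3 | ⟨h3, h4, h5⟩
      · omega
      · rw [hv j hj (by omega), hu j hj]; exact Or.inr ⟨h3, h4, by omega⟩
    · rw [hv' j hj hj0 hj1]
      rcases h.stage.tight j hj0 hj1 with h3 | ⟨h3, h4, h5⟩
      · exact Or.inl h3
      · refine Or.inr ⟨h3, h4, ?_⟩
        -- A matched edge at an unreached column keeps both duals: by injectivity its row is not the
        -- row of a reached column.
        rw [hu' (p j) fun k hk he => hj ?_, h5]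
        have h6 := h.range k hk
        rwa [h.inj hj0 hj1.le h6.1 h6.2 h3 he.symm]
  · intro k hk hkm
    obtain ⟨h2, h3, h4, h5⟩ := h.tree k hk hkm
    refine ⟨h2, h3, h4, ?_⟩
    rw [hu _ h3, hv k hk hkm]; omega
  · intro j hj hj0 hj1
    obtain ⟨h2, h3, h4⟩ := h.slack j hj hj0 hj1
    refine ⟨h2, ?_, fun k hk => ?_⟩
    · rw [hm j hj hj0 hj1, hu _ h2, hv' j hj hj0 hj1]; omega
    · have := h4 k hk
      rw [hm j hj hj0 hj1, hu _ hk, hv' j hj hj0 hj1]; omega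

/-- A matched column reached by a tight edge is added, and the slacks are updated. -/
theorem grow (h : Search W n m i S u v p way minv ord) {way' minv' : ℤ → ℤ} {j₁ : ℤ}
    (hj₁ : j₁ ∉ S) (h0 : 0 ≤ j₁) (h1 : j₁ < m) (hz : minv j₁ = 0) (hp : 0 ≤ p j₁)
    (hway : ∀ k ∈ insert j₁ S, k ≠ m → way' k = way k)
    (hnew : ∀ j, j ∉ insert j₁ S → 0 ≤ j → j < m →
      (u (p j₁) + v j - W (p j₁) j < minv j ∧ minv' j = u (p j₁) + v j - W (p j₁) j ∧
        way' j = j₁) ∨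
      (minv j ≤ u (p j₁) + v j - W (p j₁) j ∧ minv' j = minv j ∧ way' j = way j)) :
    Search W n m i (insert j₁ S) u v p way' minv' (Function.update ord j₁ S.card) := by
  have hne : ∀ k ∈ S, k ≠ j₁ := fun k hk he => hj₁ (he ▸ hk)
  have hcard : (insert j₁ S).card = S.card + 1 := Finset.card_insert_of_notMem hj₁
  refine ⟨h.stage, h.row, h.virt, Finset.mem_insert_of_mem h.mem, ?_, ?_, ?_, ?_⟩
  · intro k hk
    rcases Finset.mem_insert.1 hk with rfl | hk
    · omega
    · exact h.range k hk
  · intro k hk hkm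
    rw [hway k hk hkm]
    rcases Finset.mem_insert.1 hk with rfl | hk
    · obtain ⟨h2, h3, h4⟩ := h.slack k hj₁ h0 h1
      refine ⟨hp, Finset.mem_insert_of_mem h2, ?_, by omega⟩
      rw [Function.update_self, Function.update_of_ne (hne _ h2)]
      -- The order of the new column is the old size of `S`, larger than all orders given before.
      exact h.ord_lt _ h2
    · obtain ⟨h2, h3, h4, h5⟩ := h.tree k hk hkm
      refine ⟨h2, Finset.mem_insert_of_mem h3, ?_, h5⟩
      rwa [Function.update_of_ne (hne _ h3), Function.update_of_ne (hne _ hk)]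
  · intro k hk
    rw [hcard]
    rcases Finset.mem_insert.1 hk with rfl | hk
    · rw [Function.update_self]; omega
    · rw [Function.update_of_ne (hne _ hk)]
      have := h.ord_lt k hk; omega
  · intro j hj hj0 hj1
    have hjS : j ∉ S := fun hx => hj (Finset.mem_insert_of_mem hx)
    obtain ⟨h2, h3, h4⟩ := h.slack j hjS hj0 hj1
    rcases hnew j hj hj0 hj1 with ⟨g1, g2, g3⟩ | ⟨g1, g2, g3⟩
    · rw [g2, g3]
      refine ⟨Finset.mem_insert_self _ _, rfl, fun k hk => ?_⟩
      rcases Finset.mem_insert.1 hk with rfl | hk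
      · exact le_rfl
      · have := h4 k hk; omega
    · rw [g2, g3]
      refine ⟨Finset.mem_insert_of_mem h2, h3, fun k hk => ?_⟩
      rcases Finset.mem_insert.1 hk with rfl | hk
      · exact g1
      · exact h4 k hk

end Search

/-- During augmentation, all columns but the hole `j` are matched correctly; the path from `j`
back to the virtual column runs through columns of order below `R`. -/
structure Augment (W : ℤ → ℤ → ℤ) (m i : ℤ) (S : Finset ℤ) (u v way : ℤ → ℤ) (ord : ℤ → ℕ)
    (p₀ p : ℤ → ℤ) (R : ℕ) (j : ℤ) : Prop where
  range : 0 ≤ j ∧ j ≤ m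
  same : ∀ k ∈ S, ord k < R → p k = p₀ k
  fresh : j ∉ S ∨ R ≤ ord j
  path : j ≠ m → way j ∈ S ∧ ord (way j) < R ∧ u (p₀ (way j)) + v j = W (p₀ (way j)) j
  tight : ∀ k, 0 ≤ k → k < m → k ≠ j →
    p k = -1 ∧ v k = 0 ∨ 0 ≤ p k ∧ p k < i + 1 ∧ u (p k) + v k = W (p k) k
  inj : ∀ k l, 0 ≤ k → k ≤ m → k ≠ j → 0 ≤ l → l ≤ m → l ≠ j → 0 ≤ p k → p k = p l → k = l
  surj : ∀ r, 0 ≤ r → r < i + 1 → ∃ k, 0 ≤ k ∧ k ≤ m ∧ k ≠ j ∧ p k = r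

section

variable {W : ℤ → ℤ → ℤ} {n m i : ℤ} {S : Finset ℤ} {u v p way minv : ℤ → ℤ} {ord : ℤ → ℕ}

/-- Counting the virtual column, the rows up to `i` are all matched already. It remains to move the
hole from the free column to the virtual one. -/
theorem Search.augment (h : Search W n m i S u v p way minv ord) {j₁ : ℤ}
    (hj₁ : j₁ ∉ S) (h0 : 0 ≤ j₁) (h1 : j₁ < m) (hz : minv j₁ = 0) (hp : p j₁ < 0) :
    Augment W m i S u v way ord p p S.card j₁ := by
  obtain ⟨h2, h3, h4⟩ := h.slack j₁ hj₁ h0 h1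
  refine ⟨⟨h0, h1.le⟩, fun _ _ _ => rfl, Or.inl hj₁,
    fun _ => ⟨h2, h.ord_lt _ h2, by omega⟩, ?_, ?_, ?_⟩
  · intro k hk0 hk1 _
    rcases h.stage.tight k hk0 hk1 with h5 | ⟨h5, h6, h7⟩
    · exact Or.inl h5
    · exact Or.inr ⟨h5, by omega, h7⟩
  · intro k l hk0 hk1 _ hl0 hl1 _ hpk he
    exact h.inj hk0 hk1 hl0 hl1 hpk he
  · intro r hr0 hr1
    by_cases hr : r = i
    · exact ⟨m, by omega, le_rfl, by omega, by rw [h.virt, hr]⟩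
    · obtain ⟨k, hk0, hk1, rfl⟩ := h.stage.surj r hr0 (by omega)
      exact ⟨k, hk0, hk1.le, fun he => by subst he; omega, rfl⟩

/-- The hole receives the row of its predecessor, which becomes the hole. Orders fall along the
path, so the predecessor still has its original row, and the edge from that row to the hole is tight
by the invariant. -/
theorem Augment.step (h : Search W n m i S u v p way minv ord) {q : ℤ → ℤ} {R : ℕ} {j : ℤ}
    (ha : Augment W m i S u v way ord p q R j) (hj : j ≠ m) :
    ord (way j) < R ∧
      Augment W m i S u v way ord p (Function.update q j (q (way j))) (ord (way j)) (way j) := by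
  obtain ⟨hw, hR, ht⟩ := ha.path hj
  have hr := h.range _ hw
  have hne : way j ≠ j := by
    intro he
    rcases ha.fresh with h1 | h1
    · exact h1 (he ▸ hw)
    · rw [he] at hR; omega
  have hq : q (way j) = p (way j) := ha.same _ hw hR
  have hrow := h.row_mem hw
  refine ⟨hR, hr, ?_, Or.inr le_rfl, ?_, ?_, ?_, ?_⟩
  · intro k hk hko
    have hkj : k ≠ j := by
      rintro rfl
      rcases ha.fresh with h1 | h1
      · exact h1 hk
      · omega
    rw [Function.update_of_ne hkj]
    exact ha.same k hk (by omega)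
  · intro hwm
    obtain ⟨-, h2, h3, h4⟩ := h.tree _ hw hwm
    exact ⟨h2, h3, h4⟩
  · intro k hk0 hk1 hkw
    by_cases hkj : k = j
    · subst hkj
      rw [Function.update_self, hq]
      exact Or.inr ⟨hrow.1, by omega, ht⟩
    · rw [Function.update_of_ne hkj]
      exact ha.tight k hk0 hk1 hkj
  · intro k l hk0 hk1 hkw hl0 hl1 hlw hpk he
    by_cases hkj : k = j
    · by_cases hlj : l = j
      · omega
      · subst hkj
        rw [Function.update_self] at hpk he
        rw [Function.update_of_ne hlj] at he
        exact absurd (ha.inj _ l hr.1 hr.2 hne hl0 hl1 hlj hpk he).symm hlw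
    · rw [Function.update_of_ne hkj] at hpk he
      by_cases hlj : l = j
      · subst hlj
        rw [Function.update_self] at he
        exact absurd (ha.inj k _ hk0 hk1 hkj hr.1 hr.2 hne hpk he) hkw
      · rw [Function.update_of_ne hlj] at he
        exact ha.inj k l hk0 hk1 hkj hl0 hl1 hlj hpk he
  · intro r hr0 hr1
    obtain ⟨k, hk0, hk1, hkj, hkr⟩ := ha.surj r hr0 hr1
    by_cases hkw : k = way j
    · exact ⟨j, ha.range.1, ha.range.2, hne.symm, by rw [Function.update_self, ← hkw, hkr]⟩
    · exact ⟨k, hk0, hk1, hkw, by rw [Function.update_of_ne hkj, hkr]⟩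

theorem Augment.stage (h : Search W n m i S u v p way minv ord) {q : ℤ → ℤ} {R : ℕ}
    (ha : Augment W m i S u v way ord p q R m) : Stage W n m (i + 1) u v q := by
  refine ⟨h.stage.feasible, h.stage.nonneg, fun j h0 h1 => ha.tight j h0 h1 h1.ne, ?_, ?_⟩
  · intro j k h0 h1 h2 h3 h4 h5
    exact ha.inj j k h0 h1.le h1.ne h2 h3.le h3.ne h4 h5
  · intro r h0 h1
    obtain ⟨k, h2, h3, h4, h5⟩ := ha.surj r h0 h1
    exact ⟨k, h2, by omega, h5⟩

end

end

section

/-! ### The Hungarian method as a program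

Registers `0`, `8`, `9` hold the numbers `n`, `m`, `m + 1`, registers `3`, `4`, `7` the constants
`0`, `1`, `-1`, and `reg 13` a bound on the weights. Array `5` holds the matrix, array `16` the
offsets of its rows. Arrays `7`, `8`, `9`, `10`, `11`, `12` hold the dual variables of the rows and of the
columns, the matching, the search tree, the slacks, and the marks of the columns reached. -/

/-- Initial dual variables and empty matching. -/
def dualInit : Prog :=
  .seq (.seq (block [.copy 41 3]) (forLoop 41 8 4 (block [.store 8 41 3, .store 9 41 7])))
    (.seq (block [.copy 41 3]) (forLoop 41 0 4 (block [.store 7 41 13])))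

/-- Initial slacks for the row in `reg 40`. -/
def searchInit : Prog :=
  .seq (block [.store 9 8 40, .load 46 16 40, .load 47 7 40, .copy 41 3])
    (.seq (forLoop 41 8 4 (block [.load 48 8 41, .add 48 47 48, .add 49 46 41, .load 49 5 49,
      .sub 48 48 49, .store 11 41 48, .store 10 41 8, .store 12 41 3]))
      (block [.store 12 8 4]))

/-- Record the column in `reg 41` as the best one. -/
def recordBest : Prog := block [.copy 42 41, .copy 43 48]

/-- Find an unmarked column of least slack. -/
def argmin : Prog :=
  .seq (block [.copy 42 7, .copy 41 3])
    (forLoop 41 8 4 (.seq (block [.load 47 12 41, .load 48 11 41])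
      (.ite (.eq 47 3) (.ite (.lt 42 3) recordBest (.ite (.lt 48 43) recordBest .skip)) .skip)))

/-- Change the dual variables by the amount in `reg 43`. -/
def dualStep : Prog :=
  .seq (block [.copy 41 3])
    (forLoop 41 9 4 (.seq (block [.load 47 12 41])
      (.ite (.eq 47 4)
        (block [.load 48 9 41, .load 49 7 48, .sub 49 49 43, .store 7 48 49, .load 50 8 41,
          .add 50 50 43, .store 8 41 50])
        (block [.load 50 11 41, .sub 50 50 43, .store 11 41 50]))))

/-- Find the next column, and the row matched with it. -/
def relax : Prog := .seq argmin (.seq dualStep (block [.load 44 9 42]))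

/-- Mark the column in `reg 42` and scan the row in `reg 44`. -/
def scan : Prog :=
  .seq (block [.store 12 42 4, .load 46 16 44, .load 47 7 44, .copy 41 3])
    (forLoop 41 8 4 (.seq (block [.load 51 12 41, .load 48 8 41, .add 48 47 48, .add 49 46 41,
        .load 49 5 49, .sub 48 48 49, .load 49 11 41])
      (.ite (.eq 51 3) (.ite (.lt 48 49) (block [.store 11 41 48, .store 10 41 42]) .skip) .skip)))

/-- Shift the matching along the path found. -/
def shiftPath : Prog :=
  .loop (.lt 42 8) (block [.load 47 10 42, .load 48 9 47, .store 9 42 48, .copy 42 47])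

/-- Find an augmenting path. -/
def search : Prog := .seq relax (.loop (.lt 7 44) (.seq scan relax))

/-- Match the row in `reg 40`. -/
def addRow : Prog :=
  .seq searchInit (.seq search shiftPath)

/-- The Hungarian method. -/
def hungarian : Prog := .seq dualInit (.seq (block [.copy 40 3]) (forLoop 40 0 4 addRow))

/-- The constant registers of the Hungarian method. -/
structure Consts (n m : ℤ) (s : State) : Prop where
  rows : s.reg 0 = n
  zero : s.reg 3 = 0
  one : s.reg 4 = 1
  neg : s.reg 7 = -1
  cols : s.reg 8 = m
  cols' : s.reg 9 = m + 1

theorem Consts.of_frame {n m : ℤ} {s s' : State} {p : Prog} (h : Consts n m s) (hf : Frame p s s')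
    (hp : ∀ r ∈ [0, 3, 4, 7, 8, 9], r ∉ p.regs) : Consts n m s' := by
  refine ⟨?_, ?_, ?_, ?_, ?_, ?_⟩
  · rw [hf.reg _ (hp _ (by simp)), h.rows]
  · rw [hf.reg _ (hp _ (by simp)), h.zero]
  · rw [hf.reg _ (hp _ (by simp)), h.one]
  · rw [hf.reg _ (hp _ (by simp)), h.neg]
  · rw [hf.reg _ (hp _ (by simp)), h.cols]
  · rw [hf.reg _ (hp _ (by simp)), h.cols']

/-- The matrix is stored in arrays `5` and `16`. -/
def HasMatrix (W : ℤ → ℤ → ℤ) (n m : ℤ) (s : State) : Prop :=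
  ∀ r j, 0 ≤ r → r < n → 0 ≤ j → j < m → s.mem 5 (s.mem 16 r + j) = W r j

theorem HasMatrix.of_frame {W : ℤ → ℤ → ℤ} {n m : ℤ} {s s' : State} {p : Prog}
    (h : HasMatrix W n m s) (hf : Frame p s s') (h5 : 5 ∉ p.arrays) (h16 : 16 ∉ p.arrays) :
    HasMatrix W n m s' := by
  intro r j
  rw [hf.mem 5 h5, hf.mem 16 h16]; exact h r j

variable {W : ℤ → ℤ → ℤ} {n m i : ℤ} {S : Finset ℤ} {ord : ℤ → ℕ} {s : State}

/-- Any upper bound on the weights, taken as the dual of every row, is feasible with zero column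
duals. -/
theorem Runs.dualInit (hs : Consts n m s) (hn : 0 ≤ n) (hm : 0 ≤ m)
    (hW : ∀ r j, 0 ≤ r → r < n → 0 ≤ j → j < m → W r j ≤ s.reg 13) :
    Runs dualInit s (5 * (n.toNat + m.toNat) + 6) fun s' =>
      Stage W n m 0 (s'.mem 7) (s'.mem 8) (s'.mem 9) := by
  refine Runs.seq (T₁ := 5 * m.toNat + 3) (T₂ := 5 * n.toNat + 3) ?_ (by omega)
  refine Runs.seq (T₁ := 2) (T₂ := 5 * m.toNat + 1)
    (Runs.of_block (Q := fun s' => _) ?_ le_rfl) (by omega)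
  intro hf
  refine (Runs.of_forLoop (B := 3) (lo := 0) (hi := m)
    (fun j s' => ∀ k, 0 ≤ k → k < j → s'.mem 8 k = 0 ∧ s'.mem 9 k = -1)
    hm (by decide) (by decide) (by decide) (by decide) (by decide)
    (by simp [execAll, Instr.exec, State.setReg, hs.zero]) (hs.of_frame hf (by decide)).cols
    (hs.of_frame hf (by decide)).one (fun k _ _ => by omega) ?_).mono (by simp; omega) ?_
  · intro j s' h0 h1 hI hj hf'
    have hc := (hs.of_frame hf (by decide)).of_frame hf' (by decide)
    refine Runs.of_block (fun _ k hk0 hk1 => ?_) le_rfl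
    by_cases h : k = j
    · simp [execAll, Instr.exec, State.setReg, hj, h, hc.zero, hc.neg]
    · simp [execAll, Instr.exec, State.setReg, hj, h, hI k hk0 (by omega)]
  rintro s₁ ⟨hI, -⟩ hf₁ hF
  have hc₁ := hs.of_frame hF (by decide)
  refine Runs.seq (T₁ := 2) (T₂ := 5 * n.toNat + 1)
    (Runs.of_block (Q := fun s' => _) ?_ le_rfl) (by omega)
  intro hf₂
  refine (Runs.of_forLoop (B := 2) (lo := 0) (hi := n)
    (fun j s' => ∀ k, 0 ≤ k → k < j → s'.mem 7 k = s.reg 13)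
    hn (by decide) (by decide) (by decide) (by decide) (by decide)
    (by simp [execAll, Instr.exec, State.setReg, hc₁.zero]) (hc₁.of_frame hf₂ (by decide)).rows
    (hc₁.of_frame hf₂ (by decide)).one (fun k _ _ => by omega) ?_).mono (by simp; omega) ?_
  · intro j s' h0 h1 hI hj hf'
    refine Runs.of_block (fun _ k hk0 hk1 => ?_) le_rfl
    have h13 : s'.reg 13 = s.reg 13 := by
      rw [hf'.reg 13 (by decide), hf₂.reg 13 (by decide), hF.reg 13 (by decide)]
    by_cases h : k = j
    · simp [execAll, Instr.exec, State.setReg, hj, h, h13]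
    · simp [execAll, Instr.exec, State.setReg, hj, h, hI k hk0 (by omega)]
  rintro s₂ ⟨hI₂, -⟩ hf₃
  have e8 : s₂.mem 8 = s₁.mem 8 := by rw [hf₃.mem 8 (by decide), hf₂.mem 8 (by decide)]
  have e9 : s₂.mem 9 = s₁.mem 9 := by rw [hf₃.mem 9 (by decide), hf₂.mem 9 (by decide)]
  rw [e8, e9]
  refine ⟨?_, ?_, ?_, ?_, ?_⟩
  · intro r j h0 h1 h2 h3
    rw [hI₂ r h0 h1, (hI j h2 h3).1]
    simpa using hW r j h0 h1 h2 h3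
  · intro j h2 h3
    rw [(hI j h2 h3).1]
  · intro j h2 h3
    exact Or.inl (hI j h2 h3).symm
  · intro j k h2 h3 _ _ h4
    rw [(hI j h2 h3).2] at h4; omega
  · intro r h0 h1; omega

/-- The state of the search in memory. -/
structure Searching (W : ℤ → ℤ → ℤ) (n m i : ℤ) (S : Finset ℤ) (ord : ℤ → ℕ) (s : State) :
    Prop where
  search : Search W n m i S (s.mem 7) (s.mem 8) (s.mem 9) (s.mem 10) (s.mem 11) ord
  marks : ∀ k, 0 ≤ k → k ≤ m → s.mem 12 k = if k ∈ S then 1 else 0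

/-- The new row is entered in the virtual column, the root of the search tree; all initial slacks
come from this row. -/
theorem Runs.searchInit (hs : Consts n m s) (hmat : HasMatrix W n m s) (hm : 0 ≤ m)
    (hi : 0 ≤ i ∧ i < n) (h40 : s.reg 40 = i)
    (hst : Stage W n m i (s.mem 7) (s.mem 8) (s.mem 9)) :
    Runs searchInit s (11 * m.toNat + 8) fun s' => Searching W n m i {m} (fun _ => 0) s' := by
  refine Runs.seq (T₁ := 5) (T₂ := 11 * m.toNat + 3)
    (Runs.of_block (Q := fun s' => _) ?_ le_rfl) (by omega)
  generalize hs₁ : execAll _ s = s₁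
  intro hf
  have hc₁ := hs.of_frame hf (by decide)
  have h46 : s₁.reg 46 = s.mem 16 i := by
    simp [← hs₁, execAll, Instr.exec, State.setReg, h40]
  have h47 : s₁.reg 47 = s.mem 7 i := by
    simp [← hs₁, execAll, Instr.exec, State.setReg, h40]
  have h41 : s₁.reg 41 = 0 := by
    simp [← hs₁, execAll, Instr.exec, State.setReg, hs.zero]
  have m9 : s₁.mem 9 = Function.update (s.mem 9) m i := by
    simp [← hs₁, execAll, Instr.exec, State.setReg, h40, hs.cols]
  refine Runs.seq (T₁ := 11 * m.toNat + 1) (T₂ := 2) ?_ (by omega)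
  refine (Runs.of_forLoop (B := 9) (lo := 0) (hi := m)
    (fun j s' => ∀ k, 0 ≤ k → k < j → s'.mem 11 k = s.mem 7 i + s.mem 8 k - W i k ∧
      s'.mem 10 k = m ∧ s'.mem 12 k = 0)
    hm (by decide) (by decide) (by decide) (by decide) (by decide) h41 hc₁.cols hc₁.one
    (fun k _ _ => by omega) ?_).mono (by simp; omega) ?_
  · intro j s' h0 h1 hI hj hf'
    have hc := hc₁.of_frame hf' (by decide)
    have e46 : s'.reg 46 = s.mem 16 i := by rw [hf'.reg 46 (by decide), h46]
    have e47 : s'.reg 47 = s.mem 7 i := by rw [hf'.reg 47 (by decide), h47]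
    have e8 : s'.mem 8 = s.mem 8 := by rw [hf'.mem 8 (by decide), hf.mem 8 (by decide)]
    have e5 : s'.mem 5 = s.mem 5 := by rw [hf'.mem 5 (by decide), hf.mem 5 (by decide)]
    refine Runs.of_block (fun _ k hk0 hk1 => ?_) le_rfl
    by_cases h : k = j
    · subst h
      simp [execAll, Instr.exec, State.setReg, hj, e46, e47, e8, e5, hc.zero, hc.cols,
        hmat i k hi.1 hi.2 h0 h1]
    · simp [execAll, Instr.exec, State.setReg, hj, h, hI k hk0 (by omega)]
  rintro s₂ ⟨hI, -⟩ hf₂ -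
  have hc₂ := hc₁.of_frame hf₂ (by decide)
  refine Runs.of_block ?_ le_rfl
  have e7 : s₂.mem 7 = s.mem 7 := by rw [hf₂.mem 7 (by decide), hf.mem 7 (by decide)]
  have e8 : s₂.mem 8 = s.mem 8 := by rw [hf₂.mem 8 (by decide), hf.mem 8 (by decide)]
  have e9 : s₂.mem 9 = Function.update (s.mem 9) m i := by rw [hf₂.mem 9 (by decide), m9]
  constructor
  · simp only [execAll, Instr.exec]
    rw [Function.update_of_ne (by decide), Function.update_of_ne (by decide),
      Function.update_of_ne (by decide), Function.update_of_ne (by decide),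
      Function.update_of_ne (by decide), e7, e8, e9]
    refine Search.init (hst.congr hi.2.le (fun _ _ _ => rfl) (fun _ _ _ => rfl) ?_) hi hm
      (by simp) (fun j h0 h1 => (hI j h0 h1).2.1) (fun j h0 h1 => (hI j h0 h1).1)
    intro j h0 h1
    exact Function.update_of_ne h1.ne _ _
  · intro k hk0 hk1
    by_cases h : k = m
    · simp [execAll, Instr.exec, h, hc₂.cols, hc₂.one]
    · simp [execAll, Instr.exec, h, hc₂.cols, hI k hk0 (by omega)]

theorem Runs.argmin (hs : Consts n m s) (hS : Searching W n m i S ord s) (hnm : n < m)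
    (hm : 0 ≤ m) :
    Runs argmin s (12 * m.toNat + 4) fun s' => s'.reg 42 ∉ S ∧ 0 ≤ s'.reg 42 ∧
      s'.reg 42 < m ∧ s.mem 11 (s'.reg 42) = s'.reg 43 ∧
      ∀ j, j ∉ S → 0 ≤ j → j < m → s'.reg 43 ≤ s.mem 11 j := by
  refine Runs.seq (T₁ := 3) (T₂ := 12 * m.toNat + 1)
    (Runs.of_block (Q := fun s' => _) ?_ le_rfl) (by omega)
  generalize hs₁ : execAll _ s = s₁
  intro hf
  have hc₁ := hs.of_frame hf (by decide)
  have h42 : s₁.reg 42 = -1 := by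
    simp [← hs₁, execAll, Instr.exec, State.setReg, hs.neg]
  have h41 : s₁.reg 41 = 0 := by
    simp [← hs₁, execAll, Instr.exec, State.setReg, hs.zero]
  refine (Runs.of_forLoop (B := 10) (lo := 0) (hi := m)
    -- The value -1 means that no unreached column has been seen; `Search.exists_not_mem` rules this
    -- out at the end.
    (fun j s' => (s'.reg 42 = -1 ∧ ∀ k, 0 ≤ k → k < j → k ∈ S) ∨
      (s'.reg 42 ∉ S ∧ 0 ≤ s'.reg 42 ∧ s'.reg 42 < j ∧ s.mem 11 (s'.reg 42) = s'.reg 43 ∧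
        ∀ k, k ∉ S → 0 ≤ k → k < j → s'.reg 43 ≤ s.mem 11 k))
    hm (by decide) (by decide) (by decide) (by decide) (by decide) h41 hc₁.cols hc₁.one
    (Or.inl ⟨h42, fun k _ _ => by omega⟩) ?_).mono (by simp; omega) ?_
  · intro j s' h0 h1 hI hj hf'
    have hc := hc₁.of_frame hf' (by decide)
    have e11 : s'.mem 11 = s.mem 11 := by rw [hf'.mem 11 (by decide), hf.mem 11 (by decide)]
    have e12 : s'.mem 12 = s.mem 12 := by rw [hf'.mem 12 (by decide), hf.mem 12 (by decide)]
    refine Runs.seq (T₁ := 3) (T₂ := 7) (Runs.of_block (Q := fun s' => _) ?_ le_rfl) le_rfl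
    generalize hs₂ : execAll _ s' = s₂
    intro hf₂
    have g47 : s₂.reg 47 = if j ∈ S then 1 else 0 := by
      simp [← hs₂, execAll, Instr.exec, State.setReg, hj, e12, hS.marks j h0 h1.le]
    have g48 : s₂.reg 48 = s.mem 11 j := by
      simp [← hs₂, execAll, Instr.exec, State.setReg, hj, e11]
    have g41 : s₂.reg 41 = j := by rw [hf₂.reg 41 (by decide), hj]
    have hc₂ := hc.of_frame hf₂ (by decide)
    have g42 : s₂.reg 42 = s'.reg 42 := hf₂.reg 42 (by decide)
    have g43 : s₂.reg 43 = s'.reg 43 := hf₂.reg 43 (by decide)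
    rw [← g42, ← g43] at hI
    have hrec : j ∉ S → (∀ k, k ∉ S → 0 ≤ k → k < j → s.mem 11 j ≤ s.mem 11 k) →
        ∀ Q : State → Prop, (∀ s'', s''.reg 42 = j → s''.reg 43 = s.mem 11 j → j ∉ S →
          (∀ k, k ∉ S → 0 ≤ k → k < j + 1 → s.mem 11 j ≤ s.mem 11 k) → Q s'') →
        Runs recordBest s₂ 4 Q := by
      intro hjS hmin Q hQ
      refine Runs.of_block (hQ _ ?_ ?_ hjS fun k hk h0 h1 => ?_) (by norm_num [List.length])
      · simp [execAll, Instr.exec, State.setReg, g41]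
      · simp [execAll, Instr.exec, State.setReg, g48]
      · by_cases hkj : k = j
        · rw [hkj]
        · exact hmin k hk h0 (by omega)
    refine Runs.ite (T₁ := 6) (fun c1 => ?_) (fun c1 => Runs.skip ?_ (by norm_num)) (by norm_num)
    · have hjS : j ∉ S := by
        intro h
        simp [Test.Holds, g47, h, hc₂.zero] at c1
      refine Runs.ite (T₁ := 5) (fun c2 => ?_) (fun c2 => ?_) (by norm_num)
      · simp only [Test.Holds, hc₂.zero] at c2
        refine (hrec hjS ?_ _ ?_).mono (T₁ := 4) (by norm_num) fun _ h _ => h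
        · intro k hk hk0 hk1
          rcases hI with hI | hI
          · exact absurd (hI.2 k hk0 hk1) hk
          · omega
        · intro s'' a b c d _
          simp only [Instr.exec, State.setReg]
          rw [Function.update_of_ne (by decide), Function.update_of_ne (by decide), a, b]
          exact Or.inr ⟨c, h0, by omega, rfl, d⟩
      · simp only [Test.Holds, hc₂.zero] at c2
        rcases hI with hI | ⟨i1, i2, i3, i4, i5⟩
        · omega
        refine Runs.ite (T₁ := 4) (fun c3 => ?_) (fun c3 => Runs.skip ?_ (by norm_num)) (by norm_num)
        · simp only [Test.Holds, g48] at c3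
          refine (hrec hjS ?_ _ ?_).mono (T₁ := 4) (by norm_num) fun _ h _ => h
          · intro k hk hk0 hk1
            have := i5 k hk hk0 hk1; omega
          · intro s'' a b c d _
            simp only [Instr.exec, State.setReg]
            rw [Function.update_of_ne (by decide), Function.update_of_ne (by decide), a, b]
            exact Or.inr ⟨c, h0, by omega, rfl, d⟩
        · intro _
          simp only [Test.Holds, g48] at c3
          simp only [Instr.exec, State.setReg]
          rw [Function.update_of_ne (by decide), Function.update_of_ne (by decide)]
          refine Or.inr ⟨i1, i2, by omega, i4, fun k hk hk0 hk1 => ?_⟩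
          by_cases hkj : k = j
          · rw [hkj]; omega
          · exact i5 k hk hk0 (by omega)
    · intro _
      have hjS : j ∈ S := by
        by_contra h
        simp [Test.Holds, g47, h, hc₂.zero] at c1
      simp only [Instr.exec, State.setReg]
      rw [Function.update_of_ne (by decide), Function.update_of_ne (by decide)]
      rcases hI with ⟨i1, i2⟩ | ⟨i1, i2, i3, i4, i5⟩
      · refine Or.inl ⟨i1, fun k hk0 hk1 => ?_⟩
        by_cases hkj : k = j
        · rwa [hkj]
        · exact i2 k hk0 (by omega)
      · refine Or.inr ⟨i1, i2, by omega, i4, fun k hk hk0 hk1 => ?_⟩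
        by_cases hkj : k = j
        · exact absurd hjS (hkj ▸ hk)
        · exact i5 k hk hk0 (by omega)
  · rintro s' ⟨hI | hI, -⟩ _
    · obtain ⟨j, h0, h1, h2⟩ := hS.search.exists_not_mem hnm
      exact absurd (hI.2 j h0 h1) h2
    · exact hI

end

/-! ### Dual update and row scan as programs -/

section

variable {W : ℤ → ℤ → ℤ} {n m i : ℤ} {S : Finset ℤ} {ord : ℤ → ℕ} {s : State}

/-- The loop covers the virtual column too, since row `i` is reached only through it. Rows are
addressed through the matching, and by `Search.inj` none is changed twice. -/
theorem Runs.dualStep (hs : Consts n m s) (hS : Searching W n m i S ord s) (hm : 0 ≤ m) :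
    Runs dualStep s (15 * m.toNat + 18) fun s' =>
      (∀ k ∈ S, s'.mem 7 (s.mem 9 k) = s.mem 7 (s.mem 9 k) - s.reg 43) ∧
      (∀ r, (∀ k ∈ S, s.mem 9 k ≠ r) → s'.mem 7 r = s.mem 7 r) ∧
      (∀ k ∈ S, s'.mem 8 k = s.mem 8 k + s.reg 43) ∧
      (∀ k, k ∉ S → s'.mem 8 k = s.mem 8 k) ∧
      (∀ k, k ∉ S → 0 ≤ k → k ≤ m → s'.mem 11 k = s.mem 11 k - s.reg 43) := by
  refine Runs.seq (T₁ := 2) (T₂ := 15 * m.toNat + 16)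
    (Runs.of_block (Q := fun s' => _) ?_ le_rfl) (by omega)
  generalize hs₁ : execAll _ s = s₁
  intro hf
  have hc₁ := hs.of_frame hf (by decide)
  have h41 : s₁.reg 41 = 0 := by
    simp [← hs₁, execAll, Instr.exec, State.setReg, hs.zero]
  have hm7 := hf.mem 7 (by decide)
  have hm8 := hf.mem 8 (by decide)
  have hm11 := hf.mem 11 (by decide)
  refine (Runs.of_forLoop (B := 13) (lo := 0) (hi := m + 1)
    (fun j s' =>
      (∀ k ∈ S, s'.mem 7 (s.mem 9 k) = s.mem 7 (s.mem 9 k) - if k < j then s.reg 43 else 0) ∧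
      (∀ r, (∀ k ∈ S, s.mem 9 k ≠ r) → s'.mem 7 r = s.mem 7 r) ∧
      (∀ k ∈ S, s'.mem 8 k = s.mem 8 k + if k < j then s.reg 43 else 0) ∧
      (∀ k, k ∉ S → s'.mem 8 k = s.mem 8 k) ∧
      (∀ k, k ∉ S → 0 ≤ k → s'.mem 11 k = s.mem 11 k - if k < j then s.reg 43 else 0))
    (by omega) (by decide) (by decide) (by decide) (by decide) (by decide) h41 hc₁.cols' hc₁.one
    ⟨?_, ?_, ?_, ?_, ?_⟩ ?_).mono (by omega) ?_
  · intro k hk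
    rw [hm7, if_neg (by have := hS.search.range k hk; omega)]; ring
  · intro r _; rw [hm7]
  · intro k hk
    rw [hm8, if_neg (by have := hS.search.range k hk; omega)]; ring
  · intro k _; rw [hm8]
  · intro k _ hk0
    rw [hm11, if_neg (by omega)]; ring
  · rintro j s' h0 h1 ⟨I1, I2, I3, I4, I5⟩ hj hf'
    have hc := hc₁.of_frame hf' (by decide)
    have e9 : s'.mem 9 = s.mem 9 := by rw [hf'.mem 9 (by decide), hf.mem 9 (by decide)]
    have e12 : s'.mem 12 = s.mem 12 := by rw [hf'.mem 12 (by decide), hf.mem 12 (by decide)]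
    have e43 : s'.reg 43 = s.reg 43 := by rw [hf'.reg 43 (by decide), hf.reg 43 (by decide)]
    refine Runs.seq (T₁ := 2) (T₂ := 11) (Runs.of_block (Q := fun s' => _) ?_ le_rfl) le_rfl
    generalize hs₂ : execAll _ s' = s₂
    intro hf₂
    have g47 : s₂.reg 47 = if j ∈ S then 1 else 0 := by
      simp [← hs₂, execAll, Instr.exec, State.setReg, hj, e12, hS.marks j h0 (by omega)]
    have g41 : s₂.reg 41 = j := by rw [hf₂.reg 41 (by decide), hj]
    have g4 := (hc.of_frame hf₂ (by decide)).one
    have g43 : s₂.reg 43 = s.reg 43 := by rw [hf₂.reg 43 (by decide), e43]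
    have g7 : s₂.mem 7 = s'.mem 7 := hf₂.mem 7 (by decide)
    have g8 : s₂.mem 8 = s'.mem 8 := hf₂.mem 8 (by decide)
    have g9 : s₂.mem 9 = s.mem 9 := by rw [hf₂.mem 9 (by decide), e9]
    have g11 : s₂.mem 11 = s'.mem 11 := hf₂.mem 11 (by decide)
    refine Runs.ite (T₁ := 8) (fun c1 => ?_) (fun c1 => ?_) (by norm_num)
    · have hjS : j ∈ S := by
        by_contra h
        simp [Test.Holds, g47, h, g4] at c1
      refine Runs.of_block (fun _ => ⟨fun k hk => ?_, fun r hr => ?_, fun k hk => ?_,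
        fun k hk => ?_, fun k hk hk0 => ?_⟩) le_rfl
      · by_cases hkj : k = j
        · subst hkj
          have := I1 k hjS
          rw [if_neg (lt_irrefl k)] at this
          simp [execAll, Instr.exec, State.setReg, g41, g9, g7, g43, this]
        · have hne : s.mem 9 k ≠ s.mem 9 j := fun he => hkj
            (hS.search.inj (hS.search.range k hk).1 (hS.search.range k hk).2 h0 (by omega)
              (hS.search.row_mem hk).1 he)
          have : (k < j + 1) = (k < j) := by
            apply propext; omega
          simp only [execAll, Instr.exec, State.setReg]
          simp [g41, g9, g7, hne, I1 k hk, this]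
      · have := hr j hjS
        simp [execAll, Instr.exec, State.setReg, g41, g9, g7, Ne.symm this, I2 r hr]
      · by_cases hkj : k = j
        · subst hkj
          have := I3 k hjS
          rw [if_neg (lt_irrefl k)] at this
          simp [execAll, Instr.exec, State.setReg, g41, g8, g43, this]
        · have : (k < j + 1) = (k < j) := by
            apply propext; omega
          simp [execAll, Instr.exec, State.setReg, g41, g8, hkj, I3 k hk, this]
      · have hkj : k ≠ j := fun h => hk (h ▸ hjS)
        simp [execAll, Instr.exec, State.setReg, g41, g8, hkj, I4 k hk]
      · have hkj : k ≠ j := fun h => hk (h ▸ hjS)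
        have : (k < j + 1) = (k < j) := by
          apply propext; omega
        simp [execAll, Instr.exec, State.setReg, g41, g11, I5 k hk hk0, this]
    · have hjS : j ∉ S := by
        intro h
        simp [Test.Holds, g47, h, g4] at c1
      refine Runs.of_block (fun _ => ⟨fun k hk => ?_, fun r hr => ?_, fun k hk => ?_,
        fun k hk => ?_, fun k hk hk0 => ?_⟩) (by simp [List.length])
      · have hkj : k ≠ j := fun h => hjS (h ▸ hk)
        have : (k < j + 1) = (k < j) := by
          apply propext; omega
        simp [execAll, Instr.exec, State.setReg, g7, I1 k hk, this]
      · simp [execAll, Instr.exec, State.setReg, g7, I2 r hr]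
      · have hkj : k ≠ j := fun h => hjS (h ▸ hk)
        have : (k < j + 1) = (k < j) := by
          apply propext; omega
        simp [execAll, Instr.exec, State.setReg, g8, I3 k hk, this]
      · simp [execAll, Instr.exec, State.setReg, g8, I4 k hk]
      · by_cases hkj : k = j
        · subst hkj
          have := I5 k hjS hk0
          rw [if_neg (lt_irrefl k)] at this
          simp [execAll, Instr.exec, State.setReg, g41, g11, g43, this]
        · have : (k < j + 1) = (k < j) := by
            apply propext; omega
          simp [execAll, Instr.exec, State.setReg, g41, g11, hkj, I5 k hk hk0, this]
  · rintro s' ⟨⟨I1, I2, I3, I4, I5⟩, -⟩ _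
    refine ⟨fun k hk => ?_, I2, fun k hk => ?_, I4, fun k hk hk0 hk1 => ?_⟩
    · rw [I1 k hk, if_pos (by have := hS.search.range k hk; omega)]
    · rw [I3 k hk, if_pos (by have := hS.search.range k hk; omega)]
    · rw [I5 k hk hk0, if_pos (by omega)]

/-- The column in `reg 42` has been reached by a tight edge, and is matched with the row in
`reg 44`. -/
structure Reached (W : ℤ → ℤ → ℤ) (n m i : ℤ) (S : Finset ℤ) (ord : ℤ → ℕ) (s : State) : Prop
    extends Searching W n m i S ord s where
  new : s.reg 42 ∉ S
  range : 0 ≤ s.reg 42 ∧ s.reg 42 < m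
  slack : s.mem 11 (s.reg 42) = 0
  partner : s.reg 44 = s.mem 9 (s.reg 42)

theorem Runs.relax (hs : Consts n m s) (hS : Searching W n m i S ord s) (hnm : n < m)
    (hm : 0 ≤ m) :
    Runs relax s (27 * m.toNat + 24) fun s' => Reached W n m i S ord s' := by
  refine Runs.seq ((Runs.argmin hs hS hnm hm).mono le_rfl ?_) (T₂ := 15 * m.toNat + 20) (by omega)
  rintro s₁ ⟨h1, h2, h3, h4, h5⟩ hf -
  have m7 := hf.mem 7 (by decide)
  have m8 := hf.mem 8 (by decide)
  have m9 := hf.mem 9 (by decide)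
  have m10 := hf.mem 10 (by decide)
  have m11 := hf.mem 11 (by decide)
  have m12 := hf.mem 12 (by decide)
  have hS₁ : Searching W n m i S ord s₁ :=
    ⟨by rw [m7, m8, m9, m10, m11]; exact hS.search, by rw [m12]; exact hS.marks⟩
  rw [← m11] at h4 h5
  refine Runs.seq ((Runs.dualStep (hs.of_frame hf (by decide)) hS₁ hm).mono le_rfl ?_)
    (T₂ := 2) (by omega)
  rintro s₂ ⟨g1, g2, g3, g4, g5⟩ hf₂ -
  have n9 := hf₂.mem 9 (by decide)
  have n10 := hf₂.mem 10 (by decide)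
  have n12 := hf₂.mem 12 (by decide)
  have n42 := hf₂.reg 42 (by decide)
  refine Runs.of_block ?_ le_rfl
  have key : Search W n m i S (s₂.mem 7) (s₂.mem 8) (s₁.mem 9) (s₁.mem 10) (s₂.mem 11) ord :=
    hS₁.search.relax h1 h2 h3 h4 h5 g1 g2 (fun k hk _ => g3 k hk)
      (fun j hj _ _ => g4 j hj) (fun j hj h0 h1 => g5 j hj h0 h1.le)
  have e42 : ((execAll [Instr.load 44 9 42] s₂).reg 42) = s₁.reg 42 := by
    simp [execAll, Instr.exec, State.setReg, n42]
  refine ⟨⟨?_, ?_⟩, ?_, ?_, ?_, ?_⟩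
  · simp only [execAll, Instr.exec, State.setReg, n9, n10]; exact key
  · simp only [execAll, Instr.exec, State.setReg, n12]; exact hS₁.marks
  · rw [e42]; exact h1
  · rw [e42]; exact ⟨h2, h3⟩
  · rw [e42]; simp only [execAll, Instr.exec, State.setReg]
    rw [g5 _ h1 h2 h3.le, h4, sub_self]
  · rw [e42]; simp [execAll, Instr.exec, State.setReg, n42]

/-- A slack is a minimum over all reached rows, so one comparison with the new row suffices. The
loop invariant also records that entries from the counter onward are untouched, because they are
still to be read. -/
theorem Runs.scan (hs : Consts n m s) (hmat : HasMatrix W n m s)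
    (hR : Reached W n m i S ord s) (hpos : 0 ≤ s.reg 44) (hm : 0 ≤ m) :
    Runs scan s (16 * m.toNat + 6) fun s' =>
      Searching W n m i (insert (s.reg 42) S) (Function.update ord (s.reg 42) S.card) s' := by
  obtain ⟨hS, hnew, hrange, hslack, hpartner⟩ := hR
  generalize hj₁ : s.reg 42 = j₁ at *
  generalize hr : s.reg 44 = r at *
  have hr1 : r < n := by
    have := hS.search.row
    rcases hS.search.stage.tight j₁ hrange.1 hrange.2 with h | h <;> omega
  refine Runs.seq (T₁ := 5) (T₂ := 16 * m.toNat + 1)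
    (Runs.of_block (Q := fun s' => _) ?_ le_rfl) (by omega)
  generalize hs₁ : execAll _ s = s₁
  intro hf
  have hc₁ := hs.of_frame hf (by decide)
  have h41 : s₁.reg 41 = 0 := by
    simp [← hs₁, execAll, Instr.exec, State.setReg, hs.zero]
  have h46 : s₁.reg 46 = s.mem 16 r := by
    simp [← hs₁, execAll, Instr.exec, State.setReg, hr]
  have h47 : s₁.reg 47 = s.mem 7 r := by
    simp [← hs₁, execAll, Instr.exec, State.setReg, hr]
  have h12 : s₁.mem 12 = Function.update (s.mem 12) j₁ 1 := by
    simp [← hs₁, execAll, Instr.exec, State.setReg, hj₁, hs.one]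
  have hm10 := hf.mem 10 (by decide)
  have hm11 := hf.mem 11 (by decide)
  have hmarks : ∀ k, 0 ≤ k → k ≤ m → s₁.mem 12 k = if k ∈ insert j₁ S then 1 else 0 := by
    intro k h0 h1
    rw [h12]
    by_cases hk : k = j₁
    · simp [hk]
    · simp [hk, hS.marks k h0 h1]
  refine (Runs.of_forLoop (B := 14) (lo := 0) (hi := m)
    (fun j s' =>
      (∀ k ∈ insert j₁ S, s'.mem 10 k = s.mem 10 k) ∧
      (∀ k, j ≤ k → s'.mem 11 k = s.mem 11 k ∧ s'.mem 10 k = s.mem 10 k) ∧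
      ∀ k, k ∉ insert j₁ S → 0 ≤ k → k < j →
        (s.mem 7 r + s.mem 8 k - W r k < s.mem 11 k ∧
          s'.mem 11 k = s.mem 7 r + s.mem 8 k - W r k ∧ s'.mem 10 k = j₁) ∨
        (s.mem 11 k ≤ s.mem 7 r + s.mem 8 k - W r k ∧ s'.mem 11 k = s.mem 11 k ∧
          s'.mem 10 k = s.mem 10 k))
    hm (by decide) (by decide) (by decide) (by decide) (by decide) h41 hc₁.cols hc₁.one
    ⟨fun k _ => by rw [hm10], fun k _ => by rw [hm10, hm11]; exact ⟨rfl, rfl⟩,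
      fun k _ _ _ => by omega⟩ ?_).mono (by simp; omega) ?_
  · rintro j s' h0 h1 ⟨I1, I2, I3⟩ hj hf'
    have hc := hc₁.of_frame hf' (by decide)
    have e12 : s'.mem 12 = s₁.mem 12 := hf'.mem 12 (by decide)
    have e8 : s'.mem 8 = s.mem 8 := by rw [hf'.mem 8 (by decide), hf.mem 8 (by decide)]
    have e5 : s'.mem 5 = s.mem 5 := by rw [hf'.mem 5 (by decide), hf.mem 5 (by decide)]
    have e46 : s'.reg 46 = s.mem 16 r := by rw [hf'.reg 46 (by decide), h46]
    have e47 : s'.reg 47 = s.mem 7 r := by rw [hf'.reg 47 (by decide), h47]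
    have e42 : s'.reg 42 = j₁ := by rw [hf'.reg 42 (by decide), hf.reg 42 (by decide), hj₁]
    refine Runs.seq (T₁ := 8) (T₂ := 6) (Runs.of_block (Q := fun s' => _) ?_ le_rfl) le_rfl
    generalize hs₂ : execAll _ s' = s₂
    intro hf₂
    have g51 : s₂.reg 51 = if j ∈ insert j₁ S then 1 else 0 := by
      rw [← hmarks j h0 h1.le, ← e12]
      simp [← hs₂, execAll, Instr.exec, State.setReg, hj]
    have g48 : s₂.reg 48 = s.mem 7 r + s.mem 8 j - W r j := by
      simp [← hs₂, execAll, Instr.exec, State.setReg, hj, e47, e8, e46, e5,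
        hmat r j hpos hr1 h0 h1]
    have g49 : s₂.reg 49 = s.mem 11 j := by
      simp [← hs₂, execAll, Instr.exec, State.setReg, hj, (I2 j le_rfl).1]
    have g41 : s₂.reg 41 = j := by rw [hf₂.reg 41 (by decide), hj]
    have g42 : s₂.reg 42 = j₁ := by rw [hf₂.reg 42 (by decide), e42]
    have g3 := (hc.of_frame hf₂ (by decide)).zero
    have g10 : s₂.mem 10 = s'.mem 10 := hf₂.mem 10 (by decide)
    have g11 : s₂.mem 11 = s'.mem 11 := hf₂.mem 11 (by decide)
    refine Runs.ite (T₁ := 5) (fun c1 => ?_) (fun c1 => Runs.skip ?_ (by norm_num)) (by norm_num)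
    · have hjS : j ∉ insert j₁ S := by
        intro h
        simp only [Test.Holds, g51, if_pos h, g3] at c1
        omega
      refine Runs.ite (T₁ := 3) (fun c2 => ?_) (fun c2 => Runs.skip ?_ (by norm_num)) (by norm_num)
      · refine Runs.of_block (fun _ => ⟨fun k hk => ?_, fun k hk => ?_, fun k hk hk0 hk1 => ?_⟩)
          le_rfl
        · have hkj : k ≠ j := fun h => hjS (h ▸ hk)
          simp [execAll, Instr.exec, State.setReg, g41, hkj, g10, I1 k hk]
        · have hkj : k ≠ j := by omega
          simp [execAll, Instr.exec, State.setReg, g41, hkj, g10, g11, I2 k (by omega)]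
        · by_cases hkj : k = j
          · subst hkj
            refine Or.inl ⟨?_, ?_, ?_⟩
            · simpa [Test.Holds, g48, g49] using c2
            · simp [execAll, Instr.exec, State.setReg, g41, g48]
            · simp [execAll, Instr.exec, State.setReg, g41, g42]
          · have := I3 k hk hk0 (by omega)
            simpa [execAll, Instr.exec, State.setReg, g41, hkj, g10, g11] using this
      · refine fun _ => ⟨fun k hk => ?_, fun k hk => ?_, fun k hk hk0 hk1 => ?_⟩
        · simp [Instr.exec, State.setReg, g10, I1 k hk]
        · simp [Instr.exec, State.setReg, g10, g11, I2 k (by omega)]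
        · by_cases hkj : k = j
          · subst hkj
            refine Or.inr ⟨?_, ?_, ?_⟩
            · simpa [Test.Holds, g48, g49] using c2
            · simp [Instr.exec, State.setReg, g11, (I2 k le_rfl).1]
            · simp [Instr.exec, State.setReg, g10, (I2 k le_rfl).2]
          · have := I3 k hk hk0 (by omega)
            simpa [Instr.exec, State.setReg, g10, g11] using this
    · have hjS : j ∈ insert j₁ S := by
        by_contra h
        simp only [Test.Holds, g51, if_neg h, g3] at c1
        exact c1 trivial
      refine fun _ => ⟨fun k hk => ?_, fun k hk => ?_, fun k hk hk0 hk1 => ?_⟩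
      · simp [Instr.exec, State.setReg, g10, I1 k hk]
      · simp [Instr.exec, State.setReg, g10, g11, I2 k (by omega)]
      · have hkj : k ≠ j := fun h => hk (h ▸ hjS)
        have := I3 k hk hk0 (by omega)
        simpa [Instr.exec, State.setReg, g10, g11] using this
  · rintro s' ⟨⟨I1, -, I3⟩, -⟩ hf'
    have e7 : s'.mem 7 = s.mem 7 := by rw [hf'.mem 7 (by decide), hf.mem 7 (by decide)]
    have e8 : s'.mem 8 = s.mem 8 := by rw [hf'.mem 8 (by decide), hf.mem 8 (by decide)]
    have e9 : s'.mem 9 = s.mem 9 := by rw [hf'.mem 9 (by decide), hf.mem 9 (by decide)]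
    constructor
    · rw [e7, e8, e9]
      exact hS.search.grow hnew hrange.1 hrange.2 hslack (hpartner ▸ hpos) (fun k hk _ => I1 k hk)
        (hpartner ▸ I3)
    · rw [hf'.mem 12 (by decide)]; exact hmarks

end

/-! ### Assembling the Hungarian method, with running times -/

section

variable {W : ℤ → ℤ → ℤ} {n m i : ℤ} {S : Finset ℤ} {ord : ℤ → ℕ} {s : State}

/-- The new column and `S` lie among the `m + 1` columns; this bounds the rounds of the search. -/
theorem Reached.card_lt (hR : Reached W n m i S ord s) : S.card < (m + 1).toNat := by
  have hsub : insert (s.reg 42) S ⊆ Finset.Ico 0 (m + 1) := by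
    intro k hk
    rw [Finset.mem_Ico]
    rcases Finset.mem_insert.1 hk with rfl | hk
    · have := hR.range; omega
    · have := hR.search.range k hk; omega
  have := Finset.card_le_card hsub
  rw [Finset.card_insert_of_notMem hR.new, Int.card_Ico] at this
  omega

/-- Each round adds a column to `S` at cost O(m), so a search is quadratic. Recomputing slacks from
scratch would make it cubic and spoil the total bound. -/
theorem Runs.search (hs : Consts n m s) (hmat : HasMatrix W n m s) (hnm : n < m) (hm : 0 ≤ m)
    (hS : Searching W n m i S ord s) :
    Runs search s
      ((27 * m.toNat + 24) + ((m.toNat + 1) * (43 * m.toNat + 31) + 1)) fun s' =>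
      (∃ S ord, Reached W n m i S ord s') ∧ s'.reg 44 < 0 := by
  refine Runs.seq ((Runs.relax hs hS hnm hm).mono le_rfl ?_) le_rfl
  intro s₁ hR hf _
  have hc₁ := hs.of_frame hf (by decide)
  have hcard := hR.card_lt
  refine (Runs.loop (B := 43 * m.toNat + 30) (n := (m + 1).toNat - S.card)
    (fun k s' => ∃ S ord, Reached W n m i S ord s' ∧ k = (m + 1).toNat - S.card) ?_
    ⟨S, ord, hR, rfl⟩).mono ?_ ?_
  · rintro k s' ⟨S', ord', hR', rfl⟩ hf' hc
    have hcard' := hR'.card_lt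
    have hc' := hc₁.of_frame hf' (by decide)
    refine Runs.seq (T₁ := 16 * m.toNat + 6) (T₂ := 27 * m.toNat + 24) ?_ (by omega)
    refine (Runs.scan hc' ((hmat.of_frame hf (by decide) (by decide)).of_frame hf' (by decide)
      (by decide)) hR' (by simp only [Test.Holds, hc'.neg] at hc; omega) hm).mono le_rfl ?_
    intro s₂ hS₂ hf₂ _
    refine (Runs.relax (hc'.of_frame hf₂ (by decide)) hS₂ hnm hm).mono le_rfl ?_
    intro s₃ hR₃ _
    refine ⟨_, ?_, _, _, hR₃, rfl⟩
    rw [Finset.card_insert_of_notMem hR'.new]; omega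
  · have : (m + 1).toNat - S.card ≤ m.toNat + 1 := by omega
    exact Nat.add_le_add_right (Nat.mul_le_mul_right _ this) 1
  · rintro s' ⟨⟨k, S', ord', hR', -⟩, hc⟩ hf'
    have hc' := hc₁.of_frame hf' (by decide)
    refine ⟨⟨S', ord', hR'⟩, ?_⟩
    simp only [Test.Holds, hc'.neg] at hc; omega

theorem Runs.shiftPath (hs : Consts n m s) (hR : Reached W n m i S ord s)
    (hneg : s.reg 44 < 0) :
    Runs shiftPath s ((m + 1).toNat * 6 + 1) fun s' =>
      Stage W n m (i + 1) (s'.mem 7) (s'.mem 8) (s'.mem 9) := by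
  refine (Runs.loop (B := 5) (n := S.card)
    (fun k s' => Augment W m i S (s.mem 7) (s.mem 8) (s.mem 10) ord (s.mem 9) (s'.mem 9) k
      (s'.reg 42)) ?_ (hR.search.augment hR.new hR.range.1 hR.range.2 hR.slack
        (hR.partner ▸ hneg))).mono ?_ ?_
  · intro k s' ha hf hc
    have hc' := hs.of_frame hf (by decide)
    simp only [Test.Holds, hc'.cols] at hc
    obtain ⟨hlt, ha'⟩ := ha.step hR.search hc.ne
    have m10 := hf.mem 10 (by decide)
    refine Runs.of_block ⟨_, hlt, ?_⟩ le_rfl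
    have e9 : (execAll [.load 47 10 42, .load 48 9 47, .store 9 42 48, .copy 42 47] s').mem 9 =
        Function.update (s'.mem 9) (s'.reg 42) (s'.mem 9 (s.mem 10 (s'.reg 42))) := by
      simp [execAll, Instr.exec, State.setReg, m10]
    have e42 : (execAll [.load 47 10 42, .load 48 9 47, .store 9 42 48, .copy 42 47] s').reg 42 =
        s.mem 10 (s'.reg 42) := by
      simp [execAll, Instr.exec, State.setReg, m10]
    rw [e9, e42]
    exact ha'
  · have := hR.card_lt
    have := Nat.mul_le_mul_right 6 this.le
    omega
  · rintro s' ⟨⟨k, ha⟩, hc⟩ hf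
    have hc' := hs.of_frame hf (by decide)
    simp only [Test.Holds, hc'.cols] at hc
    have hr := ha.range
    have e : s'.reg 42 = m := by omega
    rw [e] at ha
    rw [hf.mem 7 (by decide), hf.mem 8 (by decide)]
    exact ha.stage hR.search

theorem Runs.addRow (hs : Consts n m s) (hmat : HasMatrix W n m s) (hnm : n < m) (hm : 0 ≤ m)
    (hi : 0 ≤ i ∧ i < n) (h40 : s.reg 40 = i)
    (hst : Stage W n m i (s.mem 7) (s.mem 8) (s.mem 9)) :
    Runs addRow s ((m.toNat + 1) * (43 * m.toNat + 100)) fun s' =>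
      Stage W n m (i + 1) (s'.mem 7) (s'.mem 8) (s'.mem 9) := by
  refine Runs.seq ((Runs.searchInit hs hmat hm hi h40 hst).mono le_rfl ?_)
    (T₂ := ((27 * m.toNat + 24) + ((m.toNat + 1) * (43 * m.toNat + 31) + 1)) +
      ((m + 1).toNat * 6 + 1)) ?_
  · intro s₁ hS hf _
    have hc₁ := hs.of_frame hf (by decide)
    refine Runs.seq ((Runs.search hc₁ (hmat.of_frame hf (by decide) (by decide)) hnm hm hS).mono
      le_rfl ?_) le_rfl
    rintro s₂ ⟨⟨S, ord, hR⟩, hneg⟩ hf₂ -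
    exact Runs.shiftPath (hc₁.of_frame hf₂ (by decide)) hR hneg
  · have : (m + 1).toNat = m.toNat + 1 := by omega
    rw [this]
    nlinarith [Nat.zero_le m.toNat]

/-- The Hungarian method computes a matching of all rows and a certificate of its optimality. -/
theorem Runs.hungarian (hs : Consts n m s) (hmat : HasMatrix W n m s) (hn : 0 ≤ n)
    (hnm : n < m) (hW : ∀ r j, 0 ≤ r → r < n → 0 ≤ j → j < m → W r j ≤ s.reg 13) :
    Runs hungarian s (n.toNat * ((m.toNat + 1) * (43 * m.toNat + 100) + 2) +
      (5 * (n.toNat + m.toNat) + 9)) fun s' =>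
      Stage W n m n (s'.mem 7) (s'.mem 8) (s'.mem 9) := by
  have hm : 0 ≤ m := by omega
  refine Runs.seq ((Runs.dualInit hs hn hm hW).mono le_rfl ?_)
    (T₂ := n.toNat * ((m.toNat + 1) * (43 * m.toNat + 100) + 2) + 3) (by omega)
  intro s₁ hst hf _
  have hc₁ := hs.of_frame hf (by decide)
  refine Runs.seq (T₁ := 2) (T₂ := n.toNat * ((m.toNat + 1) * (43 * m.toNat + 100) + 2) + 1)
    (Runs.of_block (Q := fun s' => _) ?_ le_rfl) (by omega)
  generalize hs₂ : execAll _ s₁ = s₂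
  intro hf₂
  have hc₂ := hc₁.of_frame hf₂ (by decide)
  have h40 : s₂.reg 40 = 0 := by
    simp [← hs₂, execAll, Instr.exec, State.setReg, hc₁.zero]
  refine (Runs.of_forLoop (B := (m.toNat + 1) * (43 * m.toNat + 100)) (lo := 0) (hi := n)
    (fun j s' => Stage W n m j (s'.mem 7) (s'.mem 8) (s'.mem 9))
    hn (by decide) (by decide) (by decide) (by decide) (by decide) h40 hc₂.rows hc₂.one ?_
    ?_).mono (by simp) fun s' h _ => h.1
  · rw [hf₂.mem 7 (by decide), hf₂.mem 8 (by decide), hf₂.mem 9 (by decide)]; exact hst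
  · intro j s' h0 h1 hI hj hf'
    refine (Runs.addRow (hc₂.of_frame hf' (by decide))
      (((hmat.of_frame hf (by decide) (by decide)).of_frame hf₂ (by decide)
        (by decide)).of_frame hf' (by decide) (by decide)) hnm hm ⟨h0, h1⟩ hj hI).mono le_rfl ?_
    intro s'' h _ _
    simpa [Instr.exec, State.setReg] using h

end

section

variable {L : Context}

/-! ### Optimality of the matching -/

section

variable {W : ℤ → ℤ → ℤ} {n m : ℤ} {u v p : ℤ → ℤ}

/-- Complementary slackness: all rows are matched by tight edges, and unmatched columns have dual
value zero. -/
theorem Stage.sum_dual (h : Stage W n m n u v p) :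
    ∑ r ∈ Finset.Ico 0 n, u r + ∑ j ∈ Finset.Ico 0 m, v j =
      ∑ j ∈ Finset.Ico 0 m with 0 ≤ p j, W (p j) j := by
  have h1 : ∑ r ∈ Finset.Ico 0 n, u r = ∑ j ∈ Finset.Ico 0 m with 0 ≤ p j, u (p j) := by
    symm
    refine Finset.sum_bij (fun j _ => p j) ?_ ?_ ?_ fun _ _ => rfl
    · intro j hj
      simp only [Finset.mem_filter, Finset.mem_Ico] at hj ⊢
      rcases h.tight j hj.1.1 hj.1.2 with h2 | h2 <;> omega
    · intro j hj k hk he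
      simp only [Finset.mem_filter, Finset.mem_Ico] at hj hk
      exact h.inj j k hj.1.1 hj.1.2 hk.1.1 hk.1.2 hj.2 he
    · intro r hr
      rw [Finset.mem_Ico] at hr
      obtain ⟨j, h0, h1, rfl⟩ := h.surj r hr.1 hr.2
      exact ⟨j, by simp [h0, h1, hr.1], rfl⟩
  have h2 : ∑ j ∈ Finset.Ico 0 m, v j = ∑ j ∈ Finset.Ico 0 m with 0 ≤ p j, v j := by
    symm
    refine Finset.sum_subset (Finset.filter_subset _ _) fun j hj hn => ?_
    simp only [Finset.mem_filter, hj, true_and] at hn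
    rw [Finset.mem_Ico] at hj
    rcases h.tight j hj.1 hj.2 with h2 | h2
    · exact h2.2
    · exact absurd h2.1 hn
  rw [h1, h2, ← Finset.sum_add_distrib]
  refine Finset.sum_congr rfl fun j hj => ?_
  simp only [Finset.mem_filter, Finset.mem_Ico] at hj
  rcases h.tight j hj.1.1 hj.1.2 with h3 | h3
  · omega
  · exact h3.2.2

/-- With more zero columns than rows, the dual variables of the rows are nonnegative. -/
theorem Stage.row_nonneg (h : Stage W n m n u v p) {l : ℤ} (hl : 0 ≤ l) (hlm : l + n < m)
    (hW : ∀ r j, l ≤ j → W r j = 0) {r : ℤ} (hr0 : 0 ≤ r) (hr1 : r < n) : 0 ≤ u r := by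
  -- There are `m - l > n` zero columns and only `n` rows, so some zero column is free. There the
  -- column dual vanishes and feasibility reads `0 ≤ u r`.
  have hex : ∃ j, l ≤ j ∧ j < m ∧ p j = -1 := by
    by_contra! hc
    have hmat : ∀ j, l ≤ j → j < m → 0 ≤ p j ∧ p j < n := fun j h0 h1 => by
      rcases h.tight j (by omega) h1 with h2 | h2
      · exact absurd h2.1 (hc j h0 h1)
      · exact ⟨h2.1, h2.2.1⟩
    have hsub : Finset.image p (Finset.Ico l m) ⊆ Finset.Ico 0 n := by
      intro r hr
      obtain ⟨j, hj, rfl⟩ := Finset.mem_image.1 hr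
      rw [Finset.mem_Ico] at hj ⊢
      exact hmat j hj.1 hj.2
    have hcard := Finset.card_le_card hsub
    rw [Finset.card_image_of_injOn] at hcard
    · simp only [Int.card_Ico] at hcard
      omega
    · intro j hj k hk he
      rw [Finset.mem_coe, Finset.mem_Ico] at hj hk
      exact h.inj j k (by omega) hj.2 (by omega) hk.2 (hmat j hj.1 hj.2).1 he
  obtain ⟨j, h0, h1, h2⟩ := hex
  have hf := h.feasible r j hr0 hr1 (by omega) h1
  rw [hW r j h0] at hf
  rcases h.tight j (by omega) h1 with h3 | h3 <;> omega

/-- The matching found is at least as heavy as any other. -/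
theorem Stage.optimal (h : Stage W n m n u v p) {l : ℤ} (hl : 0 ≤ l) (hlm : l + n < m)
    (hW : ∀ r j, l ≤ j → W r j = 0) {ι : Type*} (T : Finset ι) (r c : ι → ℤ)
    (hr : ∀ x ∈ T, 0 ≤ r x ∧ r x < n) (hc : ∀ x ∈ T, 0 ≤ c x ∧ c x < m)
    (hri : Set.InjOn r (T : Set ι)) (hci : Set.InjOn c (T : Set ι)) :
    ∑ x ∈ T, W (r x) (c x) ≤ ∑ j ∈ Finset.Ico 0 m with 0 ≤ p j, W (p j) j := by
  rw [← h.sum_dual]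
  calc ∑ x ∈ T, W (r x) (c x) ≤ ∑ x ∈ T, (u (r x) + v (c x)) :=
        Finset.sum_le_sum fun x hx =>
          h.feasible _ _ (hr x hx).1 (hr x hx).2 (hc x hx).1 (hc x hx).2
    _ = ∑ j ∈ T.image r, u j + ∑ j ∈ T.image c, v j := by
        rw [Finset.sum_add_distrib, Finset.sum_image hri, Finset.sum_image hci]
    -- The competitor need not cover all rows or columns; extending the sums to all of them uses
    -- that both kinds of dual variables are nonnegative.
    _ ≤ _ := by
        refine add_le_add (Finset.sum_le_sum_of_subset_of_nonneg ?_ ?_)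
          (Finset.sum_le_sum_of_subset_of_nonneg ?_ ?_)
        · intro j hj
          obtain ⟨x, hx, rfl⟩ := Finset.mem_image.1 hj
          exact Finset.mem_Ico.2 (hr x hx)
        · intro j hj _
          rw [Finset.mem_Ico] at hj
          exact h.row_nonneg hl hlm hW hj.1 hj.2
        · intro j hj
          obtain ⟨x, hx, rfl⟩ := Finset.mem_image.1 hj
          exact Finset.mem_Ico.2 (hc x hx)
        · intro j hj _
          rw [Finset.mem_Ico] at hj
          exact h.nonneg j hj.1 hj.2

end

/-! ### The table of all pairs -/

/-- Fill the row `reg 35` of the table; `reg 38` is the next position. -/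
def fillRow : Prog :=
  .seq (block [.store 16 35 38, .load 30 1 35, .copy 36 3])
    (.seq (forLoop 36 1 4 (.seq (block [.load 31 2 36])
        (.seq buildPair (block [.sub 39 13 33, .store 5 38 39, .store 6 38 32, .add 38 38 4]))))
      (forLoop 36 8 4 (block [.store 5 38 3, .add 38 38 4])))

/-- Fill the table: weights in array `5`, addresses in array `6`, row offsets in array `16`. -/
def fill : Prog :=
  .seq (block [.copy 35 3, .copy 38 3, .copy 11 3, .copy 12 3, .copy 13 3])
    (forLoop 35 0 4 fillRow)

/-- An entry of the table. -/
structure Entry (ν : Numbering L) (k : ℕ) (θ₁ θ₂ : L.V → Term L) (s : State) (A B : Atom L)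
    (x : ℤ) : Prop where
  weight : s.mem 5 x = A.common B
  le : (A.common B : ℤ) ≤ s.reg 13
  atom : A.pred = B.pred → ∃ C, JoinsAtom ν k θ₁ θ₂ C A B ∧
    ∀ h' : ℤ → ℤ, (∀ y < s.reg 11, h' y = s.mem 3 y) → C.StoredAt ν h' (s.mem 6 x)

/-- Entries outlive the later work: allocated cells are not overwritten, and the substitutions are
only extended to new variables. -/
theorem Entry.mono {ν : Numbering L} {k k' : ℕ} {θ₁ θ₂ θ₁' θ₂' : L.V → Term L} {s s' : State}
    {A B : Atom L} {x : ℤ} (h : Entry ν k θ₁ θ₂ s A B x) (h5 : s'.mem 5 x = s.mem 5 x)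
    (h6 : s'.mem 6 x = s.mem 6 x) (h13 : s.reg 13 ≤ s'.reg 13) (h11 : s.reg 11 ≤ s'.reg 11)
    (h3 : ∀ y < s.reg 11, s'.mem 3 y = s.mem 3 y) (hk : k ≤ k') (e₁ : Extends ν k θ₁ θ₁')
    (e₂ : Extends ν k θ₂ θ₂') : Entry ν k' θ₁' θ₂' s' A B x := by
  refine ⟨h5.trans h.weight, h.le.trans h13, fun hp => ?_⟩
  obtain ⟨C, hC, hst⟩ := h.atom hp
  refine ⟨C, hC.mono hk e₁ e₂, fun h' hh' => ?_⟩
  rw [h6]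
  exact hst h' fun y hy => by rw [hh' y (by omega), h3 y hy]

/-- The table is correct at all positions below `reg 38`. -/
structure Table (ν : Numbering L) {N₁ N₂ : ℕ} (α : Fin N₁ → Atom L) (β : Fin N₂ → Atom L) (m : ℤ)
    (k : ℕ) (θ₁ θ₂ : L.V → Term L) (s : State) : Prop where
  fresh : s.reg 12 = k
  count : 0 ≤ s.reg 13
  entry : ∀ (i : Fin N₁) (j : Fin N₂), (i : ℕ) * m + (j : ℕ) < s.reg 38 →
    Entry ν k θ₁ θ₂ s (α i) (β j) ((i : ℕ) * m + (j : ℕ))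
  dummy : ∀ i j : ℤ, 0 ≤ i → N₂ ≤ j → j < m → i * m + j < s.reg 38 → s.mem 5 (i * m + j) = 0

/-- Uniqueness of division with remainder: different entries of the table occupy different cells. -/
theorem eq_of_mul_add_eq {m i i' j j' : ℤ} (h0 : 0 ≤ j) (h1 : j < m) (h0' : 0 ≤ j') (h1' : j' < m)
    (h : i * m + j = i' * m + j') : i = i' ∧ j = j' := by
  have hi : i = i' := by
    by_contra hne
    rcases lt_or_gt_of_ne hne with hlt | hlt <;> nlinarith
  subst hi; exact ⟨rfl, by omega⟩

section

variable {ν : Numbering L} {N₁ N₂ : ℕ} {α : Fin N₁ → Atom L} {β : Fin N₂ → Atom L} {m : ℤ}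
  {s : State} {l₁ l₂ h₀ : ℤ → ℤ}

/-- The input arrays are intact. -/
structure Inputs (ν : Numbering L) {N₁ N₂ : ℕ} (α : Fin N₁ → Atom L) (β : Fin N₂ → Atom L)
    (m : ℤ) (s : State) : Prop extends Ready s where
  rows : s.reg 0 = N₁
  cols : s.reg 1 = N₂
  width : s.reg 8 = m
  fst : ∀ i : Fin N₁, (α i).StoredAt ν (s.mem 0) (s.mem 1 (i : ℕ))
  snd : ∀ j : Fin N₂, (β j).StoredAt ν (s.mem 0) (s.mem 2 (j : ℕ))

theorem Inputs.of_frame {s' : State} {p : Prog} (h : Inputs ν α β m s) (hf : Frame p s s')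
    (hp : ∀ r ∈ [0, 1, 3, 4, 5, 8], r ∉ p.regs) (hq : ∀ r ∈ [0, 1, 2], r ∉ p.arrays) :
    Inputs ν α β m s' := by
  have m0 := hf.mem 0 (hq _ (by simp))
  have m1 := hf.mem 1 (hq _ (by simp))
  have m2 := hf.mem 2 (hq _ (by simp))
  refine ⟨⟨?_, ?_, ?_⟩, ?_, ?_, ?_, ?_, ?_⟩
  · rw [hf.reg _ (hp _ (by simp)), h.zero]
  · rw [hf.reg _ (hp _ (by simp)), h.one]
  · rw [hf.reg _ (hp _ (by simp)), h.two]
  · rw [hf.reg _ (hp _ (by simp)), h.rows]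
  · rw [hf.reg _ (hp _ (by simp)), h.cols]
  · rw [hf.reg _ (hp _ (by simp)), h.width]
  · rw [m0, m1]; exact h.fst
  · rw [m0, m2]; exact h.snd

/-- The machine cannot multiply, so the offset of row `i` is the running position, saved in array
`16`. Each pair continues with the substitutions left by the previous one, and the padding columns
are then filled with zeros. -/
theorem Runs.fillRow (hin : Inputs ν α β m s) (hm : (N₂ : ℤ) ≤ m) {N : ℕ}
    (hN : ∀ i, (α i).ter.card ≤ N) (i : Fin N₁) (h35 : s.reg 35 = (i : ℕ))
    (h38 : s.reg 38 = (i : ℕ) * m) (hT : ∃ k θ₁ θ₂, Table ν α β m k θ₁ θ₂ s)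
    (h16 : ∀ r : ℤ, 0 ≤ r → r < (i : ℕ) → s.mem 16 r = r * m) :
    Runs fillRow s (N₂ * (60 * N + 20) + 5 * (m - N₂).toNat + 7) fun s' =>
      s'.reg 38 = ((i : ℕ) + 1 : ℤ) * m ∧ (∃ k θ₁ θ₂, Table ν α β m k θ₁ θ₂ s') ∧
      ∀ r : ℤ, 0 ≤ r → r < (i : ℕ) + 1 → s'.mem 16 r = r * m := by
  refine Runs.seq (T₁ := 4) (T₂ := N₂ * (60 * N + 20) + 5 * (m - N₂).toNat + 3)
    (Runs.of_block (Q := fun s' => _) ?_ le_rfl) (by omega)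
  generalize hs₁ : execAll _ s = s₁
  intro hf
  have hin₁ := hin.of_frame hf (by decide) (by decide)
  have g30 : s₁.reg 30 = s₁.mem 1 (i : ℕ) := by
    simp [← hs₁, execAll, Instr.exec, State.setReg, h35]
  have g36 : s₁.reg 36 = 0 := by simp [← hs₁, execAll, Instr.exec, State.setReg, hin.zero]
  have g16 : ∀ r : ℤ, 0 ≤ r → r < (i : ℕ) + 1 → s₁.mem 16 r = r * m := by
    intro r h0 h1
    by_cases hr : r = (i : ℕ)
    · simp [← hs₁, execAll, Instr.exec, State.setReg, h35, h38, hr]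
    · simp [← hs₁, execAll, Instr.exec, State.setReg, h35, hr, h16 r h0 (by omega)]
  have g38 : s₁.reg 38 = (i : ℕ) * m + 0 := by rw [hf.reg 38 (by decide), h38, add_zero]
  have hT₁ : ∃ k θ₁ θ₂, Table ν α β m k θ₁ θ₂ s₁ := by
    obtain ⟨k, θ₁, θ₂, hT⟩ := hT
    have e38 := hf.reg 38 (by decide)
    have e5 := hf.mem 5 (by decide)
    refine ⟨k, θ₁, θ₂, by rw [hf.reg 12 (by decide), hT.fresh],
      by rw [hf.reg 13 (by decide)]; exact hT.count, fun i' j' h => ?_, ?_⟩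
    · rw [e38] at h
      exact (hT.entry i' j' h).mono (by rw [e5]) (by rw [hf.mem 6 (by decide)])
        (by rw [hf.reg 13 (by decide)]) (by rw [hf.reg 11 (by decide)])
        (by rw [hf.mem 3 (by decide)]; exact fun _ _ => rfl) le_rfl (fun _ _ => rfl) fun _ _ => rfl
    · rw [e38, e5]; exact hT.dummy
  refine Runs.seq (T₁ := N₂ * (60 * N + 20) + 1) (T₂ := 5 * (m - N₂).toNat + 2) ?_ (by omega)
  refine (Runs.of_forLoop (B := 60 * N + 18) (lo := 0) (hi := N₂)
    (fun j s' => s'.reg 38 = (i : ℕ) * m + j ∧ ∃ k θ₁ θ₂, Table ν α β m k θ₁ θ₂ s')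
    (by omega) (by decide) (by decide) (by decide) (by decide) (by decide) g36 hin₁.cols hin₁.one
    ⟨g38, hT₁⟩ ?_).mono (by simp) ?_
  · rintro j s' h0 h1 ⟨i38, k, θ₁, θ₂, hT'⟩ hj hf'
    obtain ⟨j, rfl⟩ : ∃ j' : Fin N₂, ((j' : ℕ) : ℤ) = j :=
      ⟨⟨j.toNat, by omega⟩, by simp [h0]⟩
    have hin' := hin₁.of_frame hf' (by decide) (by decide)
    refine Runs.seq (T₁ := 2) (T₂ := 60 * N + 16)
      (Runs.of_block (Q := fun s' => _) ?_ le_rfl) (by omega)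
    generalize hs₂ : execAll _ s' = s₂
    intro hf₂
    have hin₂ := hin'.of_frame hf₂ (by decide) (by decide)
    have q31 : s₂.reg 31 = s₂.mem 2 (j : ℕ) := by
      simp [← hs₂, execAll, Instr.exec, State.setReg, hj]
    have q30 : s₂.reg 30 = s₂.mem 1 (i : ℕ) := by
      rw [hf₂.reg 30 (by decide), hf'.reg 30 (by decide), g30, hf₂.mem 1 (by decide),
        hf'.mem 1 (by decide)]
    have q38 : s₂.reg 38 = (i : ℕ) * m + (j : ℕ) := by rw [hf₂.reg 38 (by decide), i38]
    have hNi := hN i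
    refine Runs.seq (T₁ := 60 * N + 10) (T₂ := 6) ?_ (by omega)
    refine (Runs.buildPair (k := k) θ₁ θ₂ hin₂.toReady
      (by rw [hf₂.reg 12 (by decide), hT'.fresh])
      (q30 ▸ hin₂.fst i) (q31 ▸ hin₂.snd j)).mono (by omega) ?_
    rintro s₃ ⟨k', η₁, η₂, hb⟩ hf₃ -
    refine Runs.of_block (fun _ => ?_) (by simp)
    have r38 : s₃.reg 38 = (i : ℕ) * m + (j : ℕ) := by rw [hf₃.reg 38 (by decide), q38]
    have r4 : s₃.reg 4 = 1 := (hin₂.of_frame hf₃ (by decide) (by decide)).one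
    have e11 : s₂.reg 11 = s'.reg 11 := hf₂.reg 11 (by decide)
    have e3 : s₂.mem 3 = s'.mem 3 := hf₂.mem 3 (by decide)
    have e13 : s₂.reg 13 = s'.reg 13 := hf₂.reg 13 (by decide)
    have e5 : s₃.mem 5 = s'.mem 5 := by rw [hf₃.mem 5 (by decide), hf₂.mem 5 (by decide)]
    have e6 : s₃.mem 6 = s'.mem 6 := by rw [hf₃.mem 6 (by decide), hf₂.mem 6 (by decide)]
    have hal := hb.alloc
    have htot := hb.total
    have hheap := hb.heap
    rw [e11] at hal
    rw [e13] at htot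
    rw [e11, e3] at hheap
    generalize hz : Instr.exec (.add 36 36 4) (execAll [.sub 39 13 33, .store 5 38 39,
      .store 6 38 32, .add 38 38 4] s₃) = z
    have z38 : z.reg 38 = (i : ℕ) * m + (j : ℕ) + 1 := by
      simp [← hz, execAll, Instr.exec, State.setReg, r38, r4]
    have z5 : z.mem 5 = Function.update (s'.mem 5) ((i : ℕ) * m + (j : ℕ))
        ((α i).common (β j)) := by
      simp [← hz, execAll, Instr.exec, State.setReg, r38, e5, hb.count]
    have z6 : z.mem 6 = Function.update (s'.mem 6) ((i : ℕ) * m + (j : ℕ)) (s₃.reg 32) := by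
      simp [← hz, execAll, Instr.exec, State.setReg, r38, e6]
    have z3 : z.mem 3 = s₃.mem 3 := by
      simp [← hz, execAll, Instr.exec, State.setReg]
    have z11 : z.reg 11 = s₃.reg 11 := by
      simp [← hz, execAll, Instr.exec, State.setReg]
    have z12 : z.reg 12 = s₃.reg 12 := by
      simp [← hz, execAll, Instr.exec, State.setReg]
    have z13 : z.reg 13 = s₃.reg 13 := by
      simp [← hz, execAll, Instr.exec, State.setReg]
    refine ⟨by rw [z38]; ring, k', η₁, η₂, by rw [z12, hb.fresh],
      by rw [z13, htot]; have := hT'.count; omega, fun i' j' hlt => ?_,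
      fun i' j' hi' hj' hjm hlt => ?_⟩
    · rw [z38] at hlt
      by_cases he : ((i' : ℕ) * m + (j' : ℕ) : ℤ) = (i : ℕ) * m + (j : ℕ)
      · have hj'2 := j'.2
        have hj2 := j.2
        obtain ⟨hi, hj⟩ := eq_of_mul_add_eq (by omega) (by omega) (by omega) (by omega) he
        obtain rfl : i' = i := Fin.ext (by exact_mod_cast hi)
        obtain rfl : j' = j := Fin.ext (by exact_mod_cast hj)
        refine ⟨by simp [z5], by rw [z13, htot]; have := hT'.count; omega, fun hp => ?_⟩
        obtain ⟨C, hC, hst⟩ := hb.atom hp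
        refine ⟨C, hC, fun h' hh' => ?_⟩
        rw [z6, Function.update_self]
        exact hst h' fun y hy => by rw [hh' y (by rw [z11]; exact hy), z3]
      · refine (hT'.entry i' j' (by omega)).mono ?_ ?_ ?_ ?_ ?_ hb.le hb.ext₁ hb.ext₂
        · rw [z5, Function.update_of_ne he]
        · rw [z6, Function.update_of_ne he]
        · rw [z13]; omega
        · rw [z11]; exact hal
        · rw [z3]; exact hheap
    · rw [z38] at hlt
      have hj2 := j.2
      have hne : i' * m + j' ≠ (i : ℕ) * m + (j : ℕ) := by
        intro he
        have := eq_of_mul_add_eq (by omega) (by omega) (by omega) (by omega) he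
        omega
      rw [z5, Function.update_of_ne hne]
      exact hT'.dummy i' j' hi' hj' hjm (by omega)
  rintro s₂ ⟨⟨q38, hT₂⟩, q36⟩ hf₂ -
  have hin₂ := hin₁.of_frame hf₂ (by decide) (by decide)
  refine (Runs.of_forLoop (B := 3) (lo := N₂) (hi := m)
    (fun j s' => s'.reg 38 = (i : ℕ) * m + j ∧ ∃ k θ₁ θ₂, Table ν α β m k θ₁ θ₂ s')
    hm (by decide) (by decide) (by decide) (by decide) (by decide) q36 hin₂.width hin₂.one
    ⟨q38, hT₂⟩ ?_).mono (by omega) ?_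
  · rintro j s' h0 h1 ⟨i38, k, θ₁, θ₂, hT'⟩ hj hf'
    have hin' := hin₂.of_frame hf' (by decide) (by decide)
    refine Runs.of_block (fun _ => ?_) (by simp)
    generalize hz : Instr.exec (.add 36 36 4) (execAll [.store 5 38 3, .add 38 38 4] s') = z
    have z38 : z.reg 38 = (i : ℕ) * m + j + 1 := by
      simp [← hz, execAll, Instr.exec, State.setReg, i38, hin'.one]
    have z5 : z.mem 5 = Function.update (s'.mem 5) ((i : ℕ) * m + j) 0 := by
      simp [← hz, execAll, Instr.exec, State.setReg, i38, hin'.zero]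
    have z6 : z.mem 6 = s'.mem 6 := by simp [← hz, execAll, Instr.exec, State.setReg]
    have z3 : z.mem 3 = s'.mem 3 := by simp [← hz, execAll, Instr.exec, State.setReg]
    have z11 : z.reg 11 = s'.reg 11 := by simp [← hz, execAll, Instr.exec, State.setReg]
    have z12 : z.reg 12 = s'.reg 12 := by simp [← hz, execAll, Instr.exec, State.setReg]
    have z13 : z.reg 13 = s'.reg 13 := by simp [← hz, execAll, Instr.exec, State.setReg]
    refine ⟨by rw [z38]; ring, k, θ₁, θ₂, by rw [z12, hT'.fresh], by rw [z13]; exact hT'.count, fun i' j' hlt => ?_,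
      fun i' j' hi' hj' hjm hlt => ?_⟩
    · rw [z38] at hlt
      have hj2 := j'.2
      have hne : ((i' : ℕ) * m + (j' : ℕ) : ℤ) ≠ (i : ℕ) * m + j := by
        intro he
        have := eq_of_mul_add_eq (by omega) (by omega) (by omega) (by omega) he
        omega
      exact (hT'.entry i' j' (by omega)).mono (by rw [z5, Function.update_of_ne hne]) (by rw [z6])
        z13.ge z11.ge (by rw [z3]; exact fun _ _ => rfl) le_rfl (fun _ _ => rfl) fun _ _ => rfl
    · rw [z38] at hlt
      rw [z5, Function.update_apply]
      split_ifs with he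
      · rfl
      · exact hT'.dummy i' j' hi' hj' hjm (by omega)
  rintro s' ⟨⟨i38, hT'⟩, -⟩ hf'
  refine ⟨by rw [i38]; ring, hT', ?_⟩
  rw [hf'.mem 16 (by decide), hf₂.mem 16 (by decide)]
  exact g16

end

end

/-! ### The complete program, its output and its running time -/

section

variable {L : Context}

/-- The constants, and the width of the table. -/
def setup : Prog :=
  block [.set 3 0, .set 4 1, .set 5 2, .set 7 (-1), .add 8 0 1, .add 8 8 4, .add 9 8 4]

/-- List the addresses of the atoms that belong to matched pairs of positive weight. -/
def collect : Prog :=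
  .seq (block [.copy 2 3, .copy 36 3])
    (forLoop 36 1 4 (.seq (block [.load 50 9 36]) (.ite (.lt 7 50)
      (.seq (block [.load 51 16 50, .add 51 51 36, .load 52 5 51, .load 53 6 51])
        (.ite (.lt 3 52) (block [.store 4 2 53, .add 2 2 4]) .skip)) .skip)))

/-- The program that computes a most specific generalization. -/
def msgProg : Prog := .seq setup (.seq fill (.seq hungarian collect))

section

variable {ν : Numbering L} {N₁ N₂ : ℕ} {α : Fin N₁ → Atom L} {β : Fin N₂ → Atom L} {m : ℤ}
  {s : State}

/-- The matrix of the numbers of common positions, extended by zero. -/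
noncomputable def pairWeight (α : Fin N₁ → Atom L) (β : Fin N₂ → Atom L) (r j : ℤ) : ℤ :=
  if h : (0 ≤ r ∧ r < N₁) ∧ 0 ≤ j ∧ j < N₂ then
    (α ⟨r.toNat, by omega⟩).common (β ⟨j.toNat, by omega⟩)
  else 0

theorem pairWeight_apply (i : Fin N₁) (j : Fin N₂) :
    pairWeight α β (i : ℕ) (j : ℕ) = (α i).common (β j) := by
  rw [pairWeight, dif_pos (by have := i.2; have := j.2; omega)]
  simp

theorem pairWeight_of_le (r : ℤ) {j : ℤ} (h : (N₂ : ℤ) ≤ j) : pairWeight α β r j = 0 :=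
  dif_neg (by omega)

theorem pairWeight_nonneg (r j : ℤ) : 0 ≤ pairWeight α β r j := by
  unfold pairWeight; split_ifs <;> omega

theorem Runs.fill (hin : Inputs ν α β m s) (hm : (N₂ : ℤ) ≤ m) {N : ℕ}
    (hN : ∀ i, (α i).ter.card ≤ N) :
    Runs fill s (N₁ * (N₂ * (60 * N + 20) + 5 * (m - N₂).toNat + 9) + 7) fun s' =>
      (∃ k θ₁ θ₂, ∀ i j, Entry ν k θ₁ θ₂ s' (α i) (β j)
        (s'.mem 16 (i : ℕ) + (j : ℕ))) ∧
      HasMatrix (pairWeight α β) N₁ m s' ∧ 0 ≤ s'.reg 13 := by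
  refine Runs.seq (T₁ := 6) (T₂ := N₁ * (N₂ * (60 * N + 20) + 5 * (m - N₂).toNat + 9) + 1)
    (Runs.of_block (Q := fun s' => _) ?_ le_rfl) (by omega)
  generalize hs₁ : execAll _ s = s₁
  intro hf
  have hin₁ := hin.of_frame hf (by decide) (by decide)
  have g35 : s₁.reg 35 = 0 := by simp [← hs₁, execAll, Instr.exec, State.setReg, hin.zero]
  have g38 : s₁.reg 38 = 0 := by simp [← hs₁, execAll, Instr.exec, State.setReg, hin.zero]
  have g12 : s₁.reg 12 = 0 := by simp [← hs₁, execAll, Instr.exec, State.setReg, hin.zero]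
  have g13 : s₁.reg 13 = 0 := by simp [← hs₁, execAll, Instr.exec, State.setReg, hin.zero]
  have hpos : ∀ i j : ℤ, 0 ≤ i → 0 ≤ j → 0 ≤ m → 0 ≤ i * m + j := fun i j hi hj hm =>
    add_nonneg (mul_nonneg hi hm) hj
  refine (Runs.of_forLoop (B := N₂ * (60 * N + 20) + 5 * (m - N₂).toNat + 7) (lo := 0) (hi := N₁)
    (fun i s' => s'.reg 38 = i * m ∧ (∃ k θ₁ θ₂, Table ν α β m k θ₁ θ₂ s') ∧
      ∀ r, 0 ≤ r → r < i → s'.mem 16 r = r * m)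
    (by omega) (by decide) (by decide) (by decide) (by decide) (by decide) g35 hin₁.rows hin₁.one
    -- As no variable is in use yet, the initial substitutions are arbitrary.
    ⟨by simp [g38], ⟨0, .var, .var, by simp [g12], g13.ge, ?_, ?_⟩, fun r _ _ => by omega⟩
    ?_).mono (by simp) ?_
  · intro i j hlt
    have := hpos (i : ℕ) (j : ℕ) (by omega) (by omega) (by omega)
    omega
  · intro i j hi hj hjm hlt
    have := hpos i j (by omega) (by omega) (by omega)
    omega
  · rintro i s' h0 h1 ⟨i38, hT, h16⟩ hi hf'
    obtain ⟨i, rfl⟩ : ∃ i' : Fin N₁, ((i' : ℕ) : ℤ) = i :=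
      ⟨⟨i.toNat, by omega⟩, by simp [h0]⟩
    refine (Runs.fillRow (hin₁.of_frame hf' (by decide) (by decide)) hm hN i hi i38 hT h16).mono
      le_rfl ?_
    rintro s'' ⟨a, ⟨k, θ₁, θ₂, hT''⟩, c⟩ _ _
    refine ⟨by simpa [Instr.exec, State.setReg] using a, ⟨k, θ₁, θ₂, ?_⟩,
      by simpa [Instr.exec, State.setReg] using c⟩
    refine ⟨by simpa [Instr.exec, State.setReg] using hT''.fresh,
      by simpa [Instr.exec, State.setReg] using hT''.count, fun i' j' hlt => ?_,
      by simpa [Instr.exec, State.setReg] using hT''.dummy⟩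
    refine (hT''.entry i' j' (by simpa [Instr.exec, State.setReg] using hlt)).mono ?_ ?_ ?_ ?_ ?_
      le_rfl (fun _ _ => rfl) fun _ _ => rfl <;> simp [Instr.exec, State.setReg]
  · rintro s' ⟨⟨h38, ⟨k, θ₁, θ₂, hT⟩, h16⟩, -⟩ _
    have hlt : ∀ (i : Fin N₁) (j : ℤ), j < m → (i : ℕ) * m + j < s'.reg 38 := by
      intro i j hj
      have h2 : ((i : ℕ) + 1 : ℤ) ≤ N₁ := by have := i.2; omega
      have h3 := mul_le_mul_of_nonneg_right h2 (by omega : 0 ≤ m)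
      rw [h38]; linarith
    have hent : ∀ i j, Entry ν k θ₁ θ₂ s' (α i) (β j) (s'.mem 16 (i : ℕ) + (j : ℕ)) := by
      intro i j
      rw [h16 _ (by omega) (by have := i.2; omega)]
      exact hT.entry i j (hlt i _ (by have := j.2; omega))
    refine ⟨⟨k, θ₁, θ₂, hent⟩, ?_, hT.count⟩
    intro r j hr0 hr1 hj0 hj1
    obtain ⟨i, rfl⟩ : ∃ i' : Fin N₁, ((i' : ℕ) : ℤ) = r :=
      ⟨⟨r.toNat, by omega⟩, by simp [hr0]⟩
    by_cases hj : j < N₂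
    · obtain ⟨j, rfl⟩ : ∃ j' : Fin N₂, ((j' : ℕ) : ℤ) = j :=
        ⟨⟨j.toNat, by omega⟩, by simp [hj0]⟩
      rw [(hent i j).weight, pairWeight_apply]
    · rw [pairWeight_of_le _ (by omega), h16 _ (by omega) hr1]
      exact hT.dummy _ _ (by omega) (by omega) hj1 (hlt i j hj1)

/-- The loop stops at `l`, before the padding columns. The weight test discards matched pairs with
different predicate symbols, which have no generalization to point to. -/
theorem Runs.collect {W : ℤ → ℤ → ℤ} {n l : ℤ} (hs : Consts n m s) (h1 : s.reg 1 = l)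
    (hl : 0 ≤ l) (hlm : l ≤ m) (hmat : HasMatrix W n m s)
    (hp : ∀ j, 0 ≤ j → j < l → s.mem 9 j < n) :
    Runs collect s (16 * l.toNat + 4) fun s' => ∃ Js : List ℤ, Js.Nodup ∧
      (∀ x, x ∈ Js ↔ 0 ≤ x ∧ x < l ∧ 0 ≤ s.mem 9 x ∧ 0 < W (s.mem 9 x) x) ∧
      s'.reg 2 = Js.length ∧ ∀ k (hk : k < Js.length),
        s'.mem 4 (k : ℕ) = s.mem 6 (s.mem 16 (s.mem 9 Js[k]) + Js[k]) := by
  refine Runs.seq (T₁ := 3) (T₂ := 16 * l.toNat + 1)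
    (Runs.of_block (Q := fun s' => _) ?_ le_rfl) (by omega)
  generalize hs₁ : execAll _ s = s₁
  intro hf
  have g1 : s₁.reg 1 = l := by rw [hf.reg 1 (by decide), h1]
  have hc₁ := hs.of_frame hf (by decide)
  have g36 : s₁.reg 36 = 0 := by simp [← hs₁, execAll, Instr.exec, State.setReg, hs.zero]
  have g2 : s₁.reg 2 = 0 := by simp [← hs₁, execAll, Instr.exec, State.setReg, hs.zero]
  refine (Runs.of_forLoop (B := 14) (lo := 0) (hi := l)
    (fun j s' => ∃ Js : List ℤ, Js.Nodup ∧
      (∀ x, x ∈ Js ↔ 0 ≤ x ∧ x < j ∧ 0 ≤ s.mem 9 x ∧ 0 < W (s.mem 9 x) x) ∧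
      s'.reg 2 = Js.length ∧ ∀ k (hk : k < Js.length),
        s'.mem 4 (k : ℕ) = s.mem 6 (s.mem 16 (s.mem 9 Js[k]) + Js[k]))
    hl (by decide) (by decide) (by decide) (by decide) (by decide) g36 g1 hc₁.one
    ⟨[], by simp, by simp; omega, by simp [g2], by simp⟩ ?_).mono (by simp; omega)
    fun _ h _ => h.1
  rintro j s' h0 hjl ⟨Js, hnd, hmem, h2, h4⟩ hj hf'
  have hc' := hc₁.of_frame hf' (by decide)
  have e9 : s'.mem 9 = s.mem 9 := by rw [hf'.mem 9 (by decide), hf.mem 9 (by decide)]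
  have e16 : s'.mem 16 = s.mem 16 := by rw [hf'.mem 16 (by decide), hf.mem 16 (by decide)]
  have e5 : s'.mem 5 = s.mem 5 := by rw [hf'.mem 5 (by decide), hf.mem 5 (by decide)]
  have e6 : s'.mem 6 = s.mem 6 := by rw [hf'.mem 6 (by decide), hf.mem 6 (by decide)]
  have hskip : ¬ (0 ≤ s.mem 9 j ∧ 0 < W (s.mem 9 j) j) → ∀ x,
      x ∈ Js ↔ 0 ≤ x ∧ x < j + 1 ∧ 0 ≤ s.mem 9 x ∧ 0 < W (s.mem 9 x) x := by
    intro hno x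
    rw [hmem]
    refine ⟨fun h => ⟨h.1, by omega, h.2.2⟩, fun h => ⟨h.1, ?_, h.2.2⟩⟩
    have : x ≠ j := fun he => hno (he ▸ h.2.2)
    omega
  refine Runs.seq (T₁ := 2) (T₂ := 12) (Runs.of_block (Q := fun s' => _) ?_ le_rfl) le_rfl
  generalize hs₂ : execAll _ s' = s₂
  intro hf₂
  have hc₂ := hc'.of_frame hf₂ (by decide)
  have g50 : s₂.reg 50 = s.mem 9 j := by
    simp [← hs₂, execAll, Instr.exec, State.setReg, hj, e9]
  have k2 : s₂.reg 2 = Js.length := by rw [hf₂.reg 2 (by decide), h2]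
  have k4 : s₂.mem 4 = s'.mem 4 := hf₂.mem 4 (by decide)
  refine Runs.ite (T₁ := 10) (fun c1 => ?_) (fun c1 => Runs.skip ?_ (by norm_num)) (by norm_num)
  · simp only [Test.Holds, hc₂.neg, g50] at c1
    refine Runs.seq (T₁ := 5) (T₂ := 5) (Runs.of_block (Q := fun s' => _) ?_ le_rfl) le_rfl
    generalize hs₃ : execAll _ s₂ = s₃
    intro hf₃
    have g52 : s₃.reg 52 = W (s.mem 9 j) j := by
      rw [← hmat _ j (by omega) (hp j h0 hjl) h0 (by omega)]
      simp [← hs₃, execAll, Instr.exec, State.setReg, g50, hf₂.mem 16 (by decide), e16,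
        hf₂.reg 36 (by decide), hj, hf₂.mem 5 (by decide), e5]
    have g53 : s₃.reg 53 = s.mem 6 (s.mem 16 (s.mem 9 j) + j) := by
      simp [← hs₃, execAll, Instr.exec, State.setReg, g50, hf₂.mem 16 (by decide), e16,
        hf₂.reg 36 (by decide), hj, hf₂.mem 6 (by decide), e6]
    have q2 : s₃.reg 2 = Js.length := by rw [hf₃.reg 2 (by decide), k2]
    have q4 : s₃.mem 4 = s'.mem 4 := by rw [hf₃.mem 4 (by decide), k4]
    have hc₃ := hc₂.of_frame hf₃ (by decide)
    refine Runs.ite (T₁ := 4) (fun c2 => ?_) (fun c2 => Runs.skip ?_ (by norm_num)) (by norm_num)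
    · simp only [Test.Holds, hc₃.zero, g52] at c2
      refine Runs.of_block (fun _ => ⟨Js ++ [j], ?_, ?_, ?_, ?_⟩) (by simp)
      · refine List.nodup_append.2 ⟨hnd, by simp, ?_⟩
        intro a ha b hb
        rw [hmem] at ha
        rw [List.mem_singleton] at hb
        omega
      · intro x
        rw [List.mem_append, hmem, List.mem_singleton]
        constructor
        · rintro (h | rfl)
          · exact ⟨h.1, by omega, h.2.2⟩
          · exact ⟨h0, by omega, by omega, c2⟩
        · rintro ⟨a, b, c⟩
          by_cases hx : x = j
          · exact Or.inr hx
          · exact Or.inl ⟨a, by omega, c⟩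
      · simp [execAll, Instr.exec, State.setReg, q2, hc₃.one]
      · intro k hk
        rw [List.length_append, List.length_singleton] at hk
        by_cases hkl : k = Js.length
        · subst hkl
          simp [execAll, Instr.exec, State.setReg, q2, g53]
        · have hne : (k : ℤ) ≠ Js.length := by exact_mod_cast hkl
          rw [List.getElem_append_left (by omega)]
          simp [execAll, Instr.exec, State.setReg, q2, q4, hkl, h4 k (by omega)]
    · simp only [Test.Holds, hc₃.zero, g52] at c2
      refine fun _ => ⟨Js, hnd, hskip fun h => c2 h.2, ?_, ?_⟩
      · simp [Instr.exec, State.setReg, q2]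
      · simpa [Instr.exec, State.setReg, q4] using h4
  · simp only [Test.Holds, hc₂.neg, g50] at c1
    refine fun _ => ⟨Js, hnd, hskip fun h => c1 (by omega), ?_, ?_⟩
    · simp [Instr.exec, State.setReg, k2]
    · simpa [Instr.exec, State.setReg, k4] using h4

end

/-- The atoms listed form a most specific generalization. -/
theorem exists_isMsg {ν : Numbering L} {G₁ G₂ : Goal L} (e₁ : Fin G₁.card ≃ G₁)
    (e₂ : Fin G₂.card ≃ G₂) {m : ℤ} (hm : (G₂.card : ℤ) + G₁.card < m) {u v p : ℤ → ℤ}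
    (hst : Stage (pairWeight (fun i => (e₁ i).1) fun j => (e₂ j).1) G₁.card m G₁.card u v p)
    {h l a : ℤ → ℤ} {b : ℤ → ℤ} {θ₁ θ₂ : L.V → Term L} {k₀ : ℕ}
    (hent : ∀ i j, (e₁ i).1.pred = (e₂ j).1.pred →
      ∃ C, JoinsAtom ν k₀ θ₁ θ₂ C (e₁ i).1 (e₂ j).1 ∧ C.StoredAt ν h (a (b (i : ℕ) + (j : ℕ))))
    {Js : List ℤ} (hnd : Js.Nodup)
    (hJs : ∀ x, x ∈ Js ↔ 0 ≤ x ∧ x < G₂.card ∧ 0 ≤ p x ∧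
      0 < pairWeight (fun i => (e₁ i).1) (fun j => (e₂ j).1) (p x) x)
    (hl : ∀ k (hk : k < Js.length), l (k : ℕ) = a (b (p Js[k]) + Js[k])) :
    ∃ G : Goal L, Goal.StoredIn ν h l Js.length G ∧ IsMsg {G₁, G₂} G := by
  classical
  set W := pairWeight (fun i => (e₁ i).1) fun j => (e₂ j).1 with hW
  have hex : ∀ k : Fin Js.length, ∃ (i : Fin G₁.card) (j : Fin G₂.card) (C : Atom L),
      p Js[k] = (i : ℕ) ∧ Js[k] = (j : ℕ) ∧ JoinsAtom ν k₀ θ₁ θ₂ C (e₁ i).1 (e₂ j).1 ∧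
      C.StoredAt ν h (l (k : ℕ)) := by
    intro k
    obtain ⟨h0, h1, h2, h3⟩ := (hJs Js[k]).1 (List.getElem_mem _)
    have h4 : p Js[k] < G₁.card := by
      rcases hst.tight Js[k] h0 (by omega) with h4 | h4 <;> omega
    obtain ⟨i, hi⟩ : ∃ i : Fin G₁.card, p Js[k] = (i : ℕ) :=
      ⟨⟨(p Js[k]).toNat, by omega⟩, (Int.toNat_of_nonneg h2).symm⟩
    obtain ⟨j, hj⟩ : ∃ j : Fin G₂.card, Js[k] = (j : ℕ) :=
      ⟨⟨(Js[k]).toNat, by omega⟩, (Int.toNat_of_nonneg h0).symm⟩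
    -- Atoms with different predicate symbols have weight zero and would not be listed.
    have hpred : (e₁ i).1.pred = (e₂ j).1.pred := by
      by_contra hne
      rw [hi, hj, hW, pairWeight_apply, Atom.common_of_ne hne] at h3
      simp at h3
    obtain ⟨C, hC, hs⟩ := hent i j hpred
    refine ⟨i, j, C, hi, hj, hC, ?_⟩
    have := hl k k.2
    rw [show Js[(k : ℕ)] = Js[k] from rfl, hi, hj] at this
    rwa [this]
  choose I J C hI hJ hC hs using hex
  have hJi : Function.Injective J := fun x y hxy => by
    have : Js[x] = Js[y] := by rw [hJ, hJ, hxy]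
    exact Fin.ext ((hnd.getElem_inj_iff).1 this)
  have hIi : Function.Injective I := fun x y hxy => by
    have hx := (hJs Js[x]).1 (List.getElem_mem _)
    have hy := (hJs Js[y]).1 (List.getElem_mem _)
    have : Js[x] = Js[y] := hst.inj _ _ hx.1 (by omega) hy.1 (by omega) hx.2.2.1
      (by rw [hI, hI, hxy])
    exact Fin.ext ((hnd.getElem_inj_iff).1 this)
  have h1 : ∀ x y, (C x).subst θ₁ = (C y).subst θ₁ → x = y := fun x y hxy => by
    rw [(hC x).fst, (hC y).fst] at hxy
    exact hIi (e₁.injective (Subtype.ext hxy))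
  have h2 : ∀ x y, (C x).subst θ₂ = (C y).subst θ₂ → x = y := fun x y hxy => by
    rw [(hC x).snd, (hC y).snd] at hxy
    exact hJi (e₂.injective (Subtype.ext hxy))
  have hCi : Function.Injective C := fun x y hxy => h1 x y (by rw [hxy])
  have hcard : (Finset.univ.image C).card = Js.length := by
    rw [Finset.card_image_of_injective _ hCi, Finset.card_fin]
  refine ⟨Finset.univ.image C, ⟨by rw [hcard], ?_⟩, ?_, ?_⟩
  · refine ⟨(finCongr hcard).trans (Equiv.ofBijective (fun k => ⟨C k, by simp⟩) ⟨?_, ?_⟩), ?_⟩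
    · intro x y hxy
      exact hCi (Subtype.ext_iff.1 hxy)
    · rintro ⟨D, hD⟩
      obtain ⟨k, -, rfl⟩ := Finset.mem_image.1 hD
      exact ⟨k, rfl⟩
    · intro x
      exact hs (finCongr hcard x)
  · refine isCommonGeneralization_pair.2 ⟨⟨θ₁, ?_, ?_⟩, ⟨θ₂, ?_, ?_⟩⟩
    · intro D hD
      obtain ⟨x, -, rfl⟩ := Finset.mem_image.1 hD
      rw [(hC x).fst]; exact (e₁ _).2
    · intro D hD E hE hDE
      obtain ⟨x, -, rfl⟩ := Finset.mem_image.1 hD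
      obtain ⟨y, -, rfl⟩ := Finset.mem_image.1 hE
      rw [h1 x y hDE]
    · intro D hD
      obtain ⟨x, -, rfl⟩ := Finset.mem_image.1 hD
      rw [(hC x).snd]; exact (e₂ _).2
    · intro D hD E hE hDE
      obtain ⟨x, -, rfl⟩ := Finset.mem_image.1 hD
      obtain ⟨y, -, rfl⟩ := Finset.mem_image.1 hE
      rw [h2 x y hDE]
  · intro G' hG'
    obtain ⟨⟨η₁, m₁, i₁⟩, ⟨η₂, m₂, i₂⟩⟩ := isCommonGeneralization_pair.1 hG'
    -- The instances of the atoms of `G'` are turned into row and column numbers, so that `G'`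
    -- becomes a competing matching.
    have hr : ∀ x : G', ∃ i, (e₁ i).1 = x.1.subst η₁ := fun x =>
      ⟨e₁.symm ⟨_, m₁ x.1 x.2⟩, by simp⟩
    have hc : ∀ x : G', ∃ j, (e₂ j).1 = x.1.subst η₂ := fun x =>
      ⟨e₂.symm ⟨_, m₂ x.1 x.2⟩, by simp⟩
    choose r hr using hr
    choose c hc using hc
    have hopt := hst.optimal (l := G₂.card) (by omega) hm (fun r j hj => pairWeight_of_le r hj)
      (Finset.univ : Finset G') (fun x => ((r x : ℕ) : ℤ)) (fun x => ((c x : ℕ) : ℤ))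
      (fun x _ => by have := (r x).2; omega) (fun x _ => by have := (c x).2; omega)
      (fun x _ y _ hxy => by
        have : r x = r y := Fin.ext (Int.ofNat.inj hxy)
        exact Subtype.ext (i₁ x.2 y.2 (by rw [← hr, ← hr, this])))
      (fun x _ y _ hxy => by
        have : c x = c y := Fin.ext (Int.ofNat.inj hxy)
        exact Subtype.ext (i₂ x.2 y.2 (by rw [← hc, ← hc, this])))
    have hleft : ((Goal.tau G').card : ℤ) ≤
        ∑ x : G', pairWeight (fun i => (e₁ i).1) (fun j => (e₂ j).1) (r x : ℕ) (c x : ℕ) := by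
      rw [Goal.card_tau, ← Finset.sum_coe_sort G' fun A => A.tau.card]
      push_cast
      refine Finset.sum_le_sum fun x _ => ?_
      rw [pairWeight_apply, hr, hc]
      exact_mod_cast Atom.card_tau_le_common η₁ η₂ x.1
    have himage : Js.toFinset = Finset.univ.image fun x : Fin Js.length => Js[x] := by
      ext y
      simp only [List.mem_toFinset, Finset.mem_image, Finset.mem_univ, true_and]
      constructor
      · intro hy
        obtain ⟨k, hk, rfl⟩ := List.getElem_of_mem hy
        exact ⟨⟨k, hk⟩, rfl⟩
      · rintro ⟨k, rfl⟩
        exact List.getElem_mem _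
    have hright : ∑ j ∈ Finset.Ico 0 m with 0 ≤ p j, W (p j) j =
        (Goal.tau (Finset.univ.image C)).card := by
      -- Matched columns that are not listed have weight zero, whether they are padding or proper,
      -- so the listed ones carry the whole weight.
      have hsub : Js.toFinset ⊆ Finset.filter (fun j => 0 ≤ p j) (Finset.Ico 0 m) := by
        intro j hj
        rw [List.mem_toFinset, hJs] at hj
        simp only [Finset.mem_filter, Finset.mem_Ico]
        omega
      rw [← Finset.sum_subset hsub, himage, Finset.sum_image, Goal.card_tau,
        Finset.sum_image fun x _ y _ h => hCi h]
      · push_cast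
        refine Finset.sum_congr rfl fun x _ => ?_
        rw [hI, hJ, hW, pairWeight_apply, (hC x).card]
      · intro x _ y _ hxy
        exact Fin.ext ((hnd.getElem_inj_iff).1 hxy)
      · intro j hj hn
        simp only [Finset.mem_filter, Finset.mem_Ico] at hj
        rw [List.mem_toFinset, hJs] at hn
        by_cases hj2 : j < G₂.card
        · have := pairWeight_nonneg (α := fun i => (e₁ i).1) (β := fun j => (e₂ j).1) (p j) j
          have h5 : ¬ 0 < W (p j) j := fun h5 => hn ⟨hj.1.1, hj2, hj.2, h5⟩
          rw [← hW] at this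
          omega
        · exact pairWeight_of_le _ (by omega)
    have := hleft.trans (hopt.trans_eq hright)
    exact_mod_cast this

/-- Only the construction of the generalizations depends on `N`. All other terms are at most cubic
in the maximum M, and M and M² are absorbed by M³, also when M = 0. The constant is generous. -/
theorem time_bound (a b N : ℕ) :
    8 + ((a * (b * (60 * N + 20) + 5 * (a + 1) + 9) + 7) +
      ((a * ((a + b + 1 + 1) * (43 * (a + b + 1) + 100) + 2) + (5 * (a + (a + b + 1)) + 9)) +
        (16 * b + 4))) ≤ 2000 * (a * b * N + max a b ^ 3 + 1) := by
  set M := max a b with hM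
  have ha : a ≤ M := le_max_left a b
  have hb : b ≤ M := le_max_right a b
  have h1 : M ≤ M ^ 3 := Nat.le_self_pow (by norm_num) M
  have h2 : M ^ 2 ≤ M ^ 3 := by
    rcases Nat.eq_zero_or_pos M with h | h
    · simp [h]
    · exact Nat.pow_le_pow_right h (by norm_num)
  have hab : a * b ≤ M ^ 2 := by rw [pow_two]; exact Nat.mul_le_mul ha hb
  have haa : a * a ≤ M ^ 2 := by rw [pow_two]; exact Nat.mul_le_mul ha ha
  have hbig : a * ((a + b + 1 + 1) * (43 * (a + b + 1) + 100) + 2) ≤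
      M * ((M + M + 1 + 1) * (43 * (M + M + 1) + 100) + 2) := by gcongr
  have e1 : M * ((M + M + 1 + 1) * (43 * (M + M + 1) + 100) + 2) =
      172 * M ^ 3 + 458 * M ^ 2 + 288 * M := by ring
  have e2 : a * (b * (60 * N + 20) + 5 * (a + 1) + 9) =
      60 * (a * b * N) + 20 * (a * b) + 5 * (a * a) + 14 * a := by ring
  rw [e2]
  rw [e1] at hbig
  omega

theorem Runs.msgProg {ν : Numbering L} {G₁ G₂ : Goal L} {s : State} (hs : IsInput ν s G₁ G₂) :
    Runs msgProg s (2000 * (G₁.card * G₂.card * G₁.sup (fun A => A.ter.card) +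
      max G₁.card G₂.card ^ 3 + 1)) fun s' => ∃ G, IsOutput ν s' G ∧ IsMsg {G₁, G₂} G := by
  obtain ⟨⟨hn₁, e₁, hs₁⟩, ⟨hn₂, e₂, hs₂⟩⟩ := hs
  have hN : ∀ i, (e₁ i).1.ter.card ≤ G₁.sup fun A => A.ter.card := fun i =>
    Finset.le_sup (f := fun A : Atom L => A.ter.card) (e₁ i).2
  generalize (G₁.sup fun A => A.ter.card) = N at hN ⊢
  refine Runs.mono (T₁ := _) ?_ (time_bound G₁.card G₂.card N) fun _ h _ => h
  set α : Fin G₁.card → Atom L := fun i => (e₁ i).1 with hα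
  set β : Fin G₂.card → Atom L := fun j => (e₂ j).1 with hβ
  -- The `G₂.card` proper columns are followed by `G₁.card + 1` zero columns, one more than there
  -- are rows, as `Stage.row_nonneg` requires.
  set m : ℤ := (G₁.card : ℤ) + G₂.card + 1 with hm
  have tm : m.toNat = G₁.card + G₂.card + 1 := by omega
  refine Runs.seq (T₁ := 8) (Runs.of_block (Q := fun s' => _) ?_ le_rfl) le_rfl
  generalize hz : execAll _ s = z
  intro hf
  have hin : Inputs ν α β m z := by
    refine ⟨⟨?_, ?_, ?_⟩, ?_, ?_, ?_, ?_, ?_⟩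
    · simp [← hz, execAll, Instr.exec, State.setReg]
    · simp [← hz, execAll, Instr.exec, State.setReg]
    · simp [← hz, execAll, Instr.exec, State.setReg]
    · rw [hf.reg 0 (by decide), hn₁]
    · rw [hf.reg 1 (by decide), hn₂]
    · simp [← hz, execAll, Instr.exec, State.setReg, hn₁, hn₂, hm]
    · rw [hf.mem 0 (by decide), hf.mem 1 (by decide)]; exact hs₁
    · rw [hf.mem 0 (by decide), hf.mem 2 (by decide)]; exact hs₂
  have hc : Consts G₁.card m z := by
    refine ⟨hin.rows, hin.zero, hin.one, ?_, hin.width, ?_⟩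
    · simp [← hz, execAll, Instr.exec, State.setReg]
    · simp [← hz, execAll, Instr.exec, State.setReg, hn₁, hn₂, hm]
  refine Runs.seq (T₁ := G₁.card * (G₂.card * (60 * N + 20) + 5 * (G₁.card + 1) + 9) + 7)
    ((Runs.fill hin (by omega) hN).mono
    (by rw [show (m - G₂.card).toNat = G₁.card + 1 by omega]) ?_) le_rfl
  rintro s₁ ⟨⟨k, θ₁, θ₂, hent⟩, hmat, h13⟩ hf₁ -
  have hc₁ := hc.of_frame hf₁ (by decide)
  refine Runs.seq ((Runs.hungarian hc₁ hmat (by omega) (by omega) ?_).mono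
    (T := G₁.card * ((G₁.card + G₂.card + 1 + 1) * (43 * (G₁.card + G₂.card + 1) + 100) + 2) +
      (5 * (G₁.card + (G₁.card + G₂.card + 1)) + 9)) ?_ ?_) le_rfl
  · intro r j hr0 hr1 hj0 _
    unfold pairWeight
    split_ifs with hrj
    -- `reg 13` has counted the non-variable nodes of all pairs together, so it dominates each
    -- single weight and can serve as initial row dual.
    · exact (hent _ _).le
    · exact h13
  · rw [tm, Int.toNat_natCast]
  intro s₂ hst hf₂ _
  have hc₂ := hc₁.of_frame hf₂ (by decide)
  refine (Runs.collect (l := G₂.card) hc₂ ?_ (by omega) (by omega)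
    (hmat.of_frame hf₂ (by decide) (by decide)) ?_).mono (by simp) ?_
  · rw [hf₂.reg 1 (by decide), hf₁.reg 1 (by decide), hin.cols]
  · intro j h0 h1
    rcases hst.tight j h0 (by omega) with h2 | h2 <;> omega
  rintro s₃ ⟨Js, hnd, hJs, h2, h4⟩ hf₃
  have e3 : s₃.mem 3 = s₁.mem 3 := by rw [hf₃.mem 3 (by decide), hf₂.mem 3 (by decide)]
  have e6 : s₂.mem 6 = s₁.mem 6 := hf₂.mem 6 (by decide)
  have e16 : s₂.mem 16 = s₁.mem 16 := hf₂.mem 16 (by decide)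
  obtain ⟨G, hG, hmsg⟩ := exists_isMsg (ν := ν) e₁ e₂ (m := m) (by omega) hst (h := s₃.mem 3)
    (l := s₃.mem 4) (a := s₂.mem 6) (b := s₂.mem 16) (θ₁ := θ₁) (θ₂ := θ₂) (k₀ := k)
    (fun i j hp => by
      obtain ⟨C, hC, hst'⟩ := (hent i j).atom hp
      exact ⟨C, hC, by rw [e6, e16, e3]; exact hst' _ fun _ _ => rfl⟩) hnd hJs h4
  exact ⟨G, by rw [IsOutput, h2]; exact hG, hmsg⟩

end

end AntiUnif

open AntiUnif
theorem mainTheorem4 :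
    (∃ (P : Prog) (C : ℕ), ∀ (L : Context) (ν : Numbering L) (G₁ G₂ : Goal L) (s : State),
      IsInput ν s G₁ G₂ →
        ∃ (s' : State) (t : ℕ) (G : Goal L),
          Exec P s s' t ∧ IsOutput ν s' G ∧ IsMsg {G₁, G₂} G ∧
          t ≤ C * (G₁.card * G₂.card * G₁.sup (fun A => A.ter.card)
                + max G₁.card G₂.card ^ 3 + 1)) ∧
    (∀ (L : Context) (G₁ G₂ : Goal L) (Φ : Term L × Term L → L.V ⊕ L.X),
      IsVariabilization (Goal.vars G₁ ∪ Goal.vars G₂) Φ →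
        ∀ M : Finset (Atom L × Atom L), IsMaxWeightMatching (weight Φ) G₁ G₂ M →
          IsMsg {G₁, G₂} (goalOfMatching Φ M)) := by
  refine ⟨⟨msgProg, 2000, fun L ν G₁ G₂ s hs => ?_⟩, fun L G₁ G₂ Φ hΦ M hM =>
    isMsg_goalOfMatching hΦ hM⟩
  obtain ⟨s', t, he, ht, G, hG, hmsg⟩ := Runs.msgProg hs
  exact ⟨s', t, G, he, hG, hmsg, ht⟩
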